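/- **Setting.** Let $\Gamma=\mathbb Z^2$ and $\det(\mathbf m,\mathbf n)=m_1n_2-m_2n_1$. The Virasoro-like algebra $L$ is the complex Lie algebra with basis $D(\mathbf r)$ ($\mathbf r\in\Gamma\setminus\{0\}$), $c_1$, $c_2$, where $c_1,c_2$ are central and, with $D(\mathbf 0)=0$ and $h(\mathbf m)=m_1c_1+m_2c_2$, $$[D(\mathbf m),D(\mathbf n)]=-\det(\mathbf m,\mathbf n)\,D(\mathbf m+\mathbf n)+\delta_{\mathbf m+\mathbf n,\mathbf 0}\,h(\mathbf m).$$ A $\mathbb Z^2$-graded $L$-module is an $L$-module $V=\bigoplus_{\mathbf n\in\mathbb Z^2}V_{\mathbf n}$ with $D(\mathbf m)V_{\mathbf n}\subseteq V_{\mathbf m+\mathbf n}$ for all $\mathbf m,\mathbf n$. It belongs to $\mathcal O_{\mathbb Z^2}$ if all $V_{\mathbf n}$ are finite-dimensional and $V$ is irreducible as a graded module, i.e. $V\neq0$ and its only graded submodules are $0$ and $V$. Let $\{\mathbf b_1,\mathbf b_2\}$ be a $\mathbb Z$-basis of $\Gamma$. Put $L_j=\langle D(j\mathbf b_1+m\mathbf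 b_2): m\in\mathbb Z\rangle\oplus\delta_{j,0}\langle c_1,c_2\rangle$ and $\mathcal H=\langle D(k\mathbf b_2),h(\mathbf b_2):k\in\mathbb Z\rangle$. A nonzero linear function $\psi$ on $L_0$ with $\psi(h(\mathbf b_2))=0$ is an *exp-polynomial function* over $L_0$ if there are polynomials $p_1,\dots,p_r\in\mathbb C[x]$ and $\alpha_1,\dots,\alpha_r\in\mathbb C\setminus\{0\}$ with $$\psi(D(k\mathbf b_2))=\frac1k\sum_{l=1}^r p_l(k)\alpha_l^k\quad(k\in\mathbb Z\setminus\{0\}),\qquad \psi(h(\mathbf b_1))=-\det(\mathbf b_1,\mathbf b_2)\sum_{l=1}^r p_l(0).$$ For such $\psi$, let $\widehat V^+(\psi)$ be the quotient, by its largest proper $\mathbb Z$-graded submodule, of the $L$-module induced from the one-dimensional module $\mathbb Cv_0$ over $\bigoplus_{j\ge0}L_j$ on which $L_j$ acts by $0$ for $j>0$ and $L_0$ acts by $\psi$; it is $\mathbb Z$-graded with $v_0$ in degree $0$ and $L_j$ of degree $j$. Let $V(\psi)=\widehat V^+(\psi)\otimes\mathbb C[t^{\pm1}]$ with the action $$D(p\mathbf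 b_1+q\mathbf b_2)(v\otimes t^k)=\bigl(D(p\mathbf b_1+q\mathbf b_2)v\bigr)\otimes t^{k+q},\qquad c_a(v\otimes t^k)=(c_av)\otimes t^k\quad(a=1,2),$$ where $v\otimes t^k$ has degree $m\mathbf b_1+k\mathbf b_2$ if $v$ is homogeneous of degree $m$. For $i\in\mathbb Z$ let $W_i=U(\mathcal H)(v_0\otimes t^i)$, and let $s\in\mathbb N$ be the positive integer, determined by $\psi$, such that the subalgebra of $\mathbb C[t^{\pm1}]$ generated by the $\psi(D(k\mathbf b_2))t^k$ ($k\ne0$) is $\mathbb C[t^{\pm s}]$; equivalently $W_i=v_0\otimes\mathbb C[t^{\pm s}]t^i$. The graded module $\overline V(\psi,i,s)$ is the quotient of $V(\psi)$ by its largest graded submodule that intersects $W_i$ trivially. **Corollary 4.8.** Let $V$ be a $\mathbb Z^2$-graded $L$-module on which the center of $L$ acts nontrivially (i.e. $c_1$ or $c_2$ does not act as $0$). Then $V\in\mathcal O_{\mathbb Z^2}$ if and only if there exist a $\mathbb Z$-basis $\{\mathbf b_1,\mathbf b_2\}$ of $\Gamma$, an exp-polynomial function $\psi$ over the corresponding $L_0$,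 and $i\in\mathbb Z$, $s\in\mathbb N$ (with $s$ attached to $\psi$ as above) such that $V$ is isomorphic to $\overline V(\psi,i,s)$. This holds both when "isomorphic" means isomorphic as $L$-modules and when it means isomorphic as graded modules up to a shift of the degrees, i.e. by an $L$-module isomorphism mapping $V_{\gamma}$ onto $\overline V(\psi,i,s)_{\gamma+\mathbf d}$ for some $\mathbf d\in\Gamma$ and all $\gamma\in\Gamma$. -/

import Mathlib

open scoped TensorProduct LaurentPolynomial

noncomputable section

namespace VirasoroLike

attribute [local instance] LieRing.ofAssociativeRing

/-! ## The Virasoro-like algebra -/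

/-- The grading group `Γ = ℤ e₁ ⊕ ℤ e₂`. -/
abbrev Gam : Type := ℤ × ℤ

/-- `det(m, n) = m₁ n₂ - m₂ n₁`. -/
def det (m n : Gam) : ℤ := m.1 * n.2 - m.2 * n.1

/-- Coefficient families with respect to the symbols `D(r)`, `r ∈ Γ \ {0}`, and `c₁`, `c₂`. -/
abbrev Coeff : Type := ({r : Gam // r ≠ 0} →₀ ℂ) × (ℂ × ℂ)

/-- The underlying space of the Virasoro-like algebra: it has a basis consisting of the
`D(r)` with `r ∈ Γ`, `r ≠ 0`, and of the two central elements `c₁`, `c₂`. -/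
def L : Type := Coeff

instance : AddCommGroup L := inferInstanceAs (AddCommGroup Coeff)

instance : Module ℂ L := inferInstanceAs (Module ℂ Coeff)

/-- The identification of coefficient families with elements of `L`. -/
def ofCoeff : Coeff ≃ₗ[ℂ] L := LinearEquiv.refl ℂ Coeff

/-- The element `D(r)`, with the convention `D(0) = 0`. -/
def D (r : Gam) : L := if hr : r ≠ 0 then ofCoeff (Finsupp.single ⟨r, hr⟩ 1, (0, 0)) else 0

/-- The first central element. -/
def c₁ : L := ofCoeff (0, (1, 0))

/-- The second central element. -/
def c₂ : L := ofCoeff (0, (0, 1))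

/-- `h(m) = m₁ c₁ + m₂ c₂`. -/
def h (m : Gam) : L := m.1 • c₁ + m.2 • c₂

/-- The linear map on `L` that takes the value `f r` at `D(r)` for `r ≠ 0`, and `u`, `w` at
`c₁`, `c₂`. -/
def lift {M : Type*} [AddCommGroup M] [Module ℂ M] (f : Gam → M) (u w : M) : L →ₗ[ℂ] M :=
  (LinearMap.coprod (Finsupp.linearCombination ℂ fun r : {r : Gam // r ≠ 0} => f r)
    (LinearMap.coprod (LinearMap.toSpanSingleton ℂ M u) (LinearMap.toSpanSingleton ℂ M w))) ∘ₗ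
    ofCoeff.symm.toLinearMap

section lift

variable {M : Type*} [AddCommGroup M] [Module ℂ M]

@[simp] theorem D_zero : D 0 = 0 := by simp [D]

@[simp] theorem h_zero : h 0 = 0 := by simp [h]

theorem lift_D (f : Gam → M) (u w : M) (hf : f 0 = 0) (r : Gam) : lift f u w (D r) = f r := by
  by_cases hr : r = 0
  · subst hr
    simp [hf]
  · simp [D, hr, lift]

@[simp] theorem lift_c₁ (f : Gam → M) (u w : M) : lift f u w c₁ = u := by simp [lift, c₁]

@[simp] theorem lift_c₂ (f : Gam → M) (u w : M) : lift f u w c₂ = w := by simp [lift, c₂]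

/-- A linear map on `L` is determined by its values at the `D(r)` and at `c₁`, `c₂`. -/
theorem hom_ext {f g : L →ₗ[ℂ] M} (hD : ∀ r, f (D r) = g (D r)) (h1 : f c₁ = g c₁)
    (h2 : f c₂ = g c₂) : f = g := by
  have key : f ∘ₗ ofCoeff.toLinearMap = g ∘ₗ ofCoeff.toLinearMap := by
    refine LinearMap.prod_ext (Finsupp.lhom_ext' fun r => LinearMap.ext_ring ?_)
      (LinearMap.prod_ext (LinearMap.ext_ring h1) (LinearMap.ext_ring h2))
    have := hD r
    simp only [D, dif_pos r.2] at this
    exact this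
  ext x
  simpa using congrArg (fun k => k (ofCoeff.symm x)) key

end lift

/-- The value `-det(m, n) D(m + n) + δ_{m + n, 0} h(m)` of `[D(m), D(n)]`. -/
def brD (m n : Gam) : L := (-det m n) • D (m + n) + if m + n = 0 then h m else 0

/-- The bracket of `L` as a bilinear map; `c₁` and `c₂` are central. -/
def br : L →ₗ[ℂ] L →ₗ[ℂ] L := lift (fun m => lift (brD m) 0 0) 0 0

@[simp] theorem brD_zero_right (m : Gam) : brD m 0 = 0 := by
  by_cases hm : m = 0
  · subst hm
    simp [brD]
  · simp [brD, hm, det]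

@[simp] theorem brD_zero_left (n : Gam) : brD 0 n = 0 := by
  simp [brD, det]

theorem br_D_D (m n : Gam) : br (D m) (D n) = brD m n := by
  rw [br, lift_D, lift_D _ _ _ (brD_zero_right m)]
  exact hom_ext (fun r => by rw [lift_D _ _ _ (brD_zero_right 0)]; simp) (by simp) (by simp)

@[simp] theorem br_c₁_left (x : L) : br c₁ x = 0 := by simp [br]

@[simp] theorem br_c₂_left (x : L) : br c₂ x = 0 := by simp [br]

@[simp] theorem br_c₁_right (x : L) : br x c₁ = 0 := by
  have : br.flip c₁ = 0 := hom_ext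
    (fun r => by
      rw [LinearMap.flip_apply, br, lift_D]
      · simp
      · exact hom_ext (fun r => by rw [lift_D _ _ _ (brD_zero_right 0)]; simp) (by simp) (by simp))
    (by simp) (by simp)
  exact congrArg (fun f => f x) this

@[simp] theorem br_c₂_right (x : L) : br x c₂ = 0 := by
  have : br.flip c₂ = 0 := hom_ext
    (fun r => by
      rw [LinearMap.flip_apply, br, lift_D]
      · simp
      · exact hom_ext (fun r => by rw [lift_D _ _ _ (brD_zero_right 0)]; simp) (by simp) (by simp))
    (by simp) (by simp)
  exact congrArg (fun f => f x) this

@[simp] theorem br_h_right (x : L) (m : Gam) : br x (h m) = 0 := by simp [h]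

@[simp] theorem br_h_left (x : L) (m : Gam) : br (h m) x = 0 := by simp [h]

theorem brD_skew (m n : Gam) : brD m n = -brD n m := by
  have e : n + m = m + n := add_comm _ _
  simp only [brD, e]
  by_cases hmn : m + n = 0
  · obtain rfl : n = -m := eq_neg_of_add_eq_zero_right hmn
    simp [h, det]
    abel
  · simp only [hmn, if_false, add_zero, ← neg_smul]
    congr 1
    simp only [det]
    ring

theorem br_skew (x y : L) : br x y = -br y x := by
  have : br = -br.flip := by
    refine hom_ext (fun m => hom_ext (fun n => ?_) (by simp) (by simp)) ?_ ?_
    · simp only [LinearMap.neg_apply, LinearMap.flip_apply, br_D_D]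
      exact brD_skew m n
    · ext; simp
    · ext; simp
  exact congrArg (fun f => f x y) this

theorem jacobi_D (l m n : Gam) :
    br (D l) (br (D m) (D n)) = br (br (D l) (D m)) (D n) + br (D m) (br (D l) (D n)) := by
  have key : ∀ a b c : Gam, br (D a) (br (D b) (D c)) = (-det b c) • brD a (b + c) := by
    intro a b c
    rw [br_D_D, brD, map_add, map_zsmul, br_D_D]
    split_ifs <;> simp
  rw [br_skew (br (D l) (D m)) (D n), key, key, key]
  have e1 : m + (l + n) = l + (m + n) := by abel
  have e2 : n + (l + m) = l + (m + n) := by abel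
  simp only [brD, e1, e2]
  by_cases h0 : l + (m + n) = 0
  · obtain rfl : n = -l - m := by
      have : n = l + (m + n) - l - m := by abel
      rw [this, h0, zero_sub]
    simp only [h0, if_true, D_zero, smul_zero, zero_add, h, det, smul_add, smul_smul]
    simp only [Prod.fst_sub, Prod.snd_sub, Prod.fst_neg, Prod.snd_neg, ← neg_smul, neg_add]
    rw [add_add_add_comm, ← add_smul, ← add_smul]
    congr 2 <;> ring
  · simp only [h0, if_false, add_zero, smul_smul, ← neg_smul, ← add_smul]
    congr 1
    simp only [det, Prod.fst_add, Prod.snd_add]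
    ring

theorem jacobi (x y z : L) : br x (br y z) = br (br x y) z + br y (br x z) := by
  have h3 : ∀ l m, br (D l) ∘ₗ br (D m) = br (br (D l) (D m)) + br (D m) ∘ₗ br (D l) := by
    intro l m
    exact hom_ext (fun n => by simpa using jacobi_D l m n) (by simp) (by simp)
  have h2 : ∀ l, (br.compr₂ (br (D l))) =
      br ∘ₗ br (D l) + br.compl₂ (br (D l)) := by
    intro l
    refine hom_ext (fun m => ?_) ?_ ?_
    · ext z; simpa using congrArg (fun f => f z) (h3 l m)
    · ext z; simp
    · ext z; simp
  have h0 : br.flip (br y z) = br.flip z ∘ₗ br.flip y + br y ∘ₗ br.flip z := by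
    refine hom_ext (fun l => ?_) (by simp) (by simp)
    have := congrArg (fun f => f y z) (h2 l)
    simpa using this
  simpa using congrArg (fun f => f x) h0

instance : LieRing L where
  bracket x y := br x y
  add_lie x y z := by change br (x + y) z = br x z + br y z; simp
  lie_add x y z := by change br x (y + z) = br x y + br x z; simp
  lie_self x := by
    have : br x x = -br x x := br_skew x x
    have h2 : (2 : ℂ) • br x x = 0 := by
      rw [two_smul]
      nth_rewrite 1 [this]
      simp
    exact (smul_eq_zero.mp h2).resolve_left two_ne_zero
  leibniz_lie x y z := jacobi x y z

instance : LieAlgebra ℂ L where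
  lie_smul t x y := by change br x (t • y) = t • br x y; simp

theorem lie_def (x y : L) : ⁅x, y⁆ = br x y := rfl

theorem lie_D_D (m n : Gam) :
    ⁅D m, D n⁆ = (-det m n) • D (m + n) + if m + n = 0 then h m else 0 := br_D_D m n

theorem D_lie_c₁ (m : Gam) : ⁅D m, c₁⁆ = 0 := br_c₁_right _

theorem D_lie_c₂ (m : Gam) : ⁅D m, c₂⁆ = 0 := br_c₂_right _

theorem c₁_lie (x : L) : ⁅c₁, x⁆ = 0 := br_c₁_left x

theorem c₂_lie (x : L) : ⁅c₂, x⁆ = 0 := br_c₂_left x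

/-- A representation of `L` on `M` from operators satisfying the defining relations of `L`. -/
def repOfRelations {M : Type*} [AddCommGroup M] [Module ℂ M] (f : Gam → Module.End ℂ M)
    (u w : Module.End ℂ M) (f0 : f 0 = 0)
    (hf : ∀ m n, f m * f n - f n * f m =
      (-det m n) • f (m + n) + if m + n = 0 then m.1 • u + m.2 • w else 0)
    (hu : ∀ m, f m * u = u * f m) (hw : ∀ m, f m * w = w * f m) (huw : u * w = w * u) :
    L →ₗ⁅ℂ⁆ Module.End ℂ M :=
  { lift f u w with
    map_lie' := by
      intro x y
      change lift f u w ⁅x, y⁆ = lift f u w x * lift f u w y - lift f u w y * lift f u w x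
      have hD : ∀ r, lift f u w (D r) = f r := lift_D f u w f0
      let μ : Module.End ℂ M →ₗ[ℂ] Module.End ℂ M →ₗ[ℂ] Module.End ℂ M :=
        LinearMap.mul ℂ (Module.End ℂ M)
      have key : br.compr₂ (lift f u w) =
          μ.compl₁₂ (lift f u w) (lift f u w) - (μ.compl₁₂ (lift f u w) (lift f u w)).flip := by
        refine hom_ext (fun m => hom_ext (fun n => ?_) ?_ ?_) (hom_ext (fun n => ?_) ?_ ?_)
          (hom_ext (fun n => ?_) ?_ ?_)
        · simp only [LinearMap.compr₂_apply, br_D_D, brD, map_add, map_zsmul, hD,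
            LinearMap.sub_apply, LinearMap.flip_apply, LinearMap.compl₁₂_apply, μ,
            LinearMap.mul_apply', hf]
          split_ifs <;> simp [h]
        all_goals simp [μ, hD, hu, hw, huw]
      rw [lie_def]
      simpa [μ] using congrArg (fun k => k x y) key }

section repOfRelations

variable {M : Type*} [AddCommGroup M] [Module ℂ M] {f : Gam → Module.End ℂ M}
  {u w : Module.End ℂ M} (f0 : f 0 = 0)
  (hf : ∀ m n, f m * f n - f n * f m =
    (-det m n) • f (m + n) + if m + n = 0 then m.1 • u + m.2 • w else 0)
  (hu : ∀ m, f m * u = u * f m) (hw : ∀ m, f m * w = w * f m) (huw : u * w = w * u)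

theorem repOfRelations_D (r : Gam) : repOfRelations f u w f0 hf hu hw huw (D r) = f r :=
  lift_D f u w f0 r

theorem repOfRelations_c₁ : repOfRelations f u w f0 hf hu hw huw c₁ = u := lift_c₁ f u w

theorem repOfRelations_c₂ : repOfRelations f u w f0 hf hu hw huw c₂ = w := lift_c₂ f u w

end repOfRelations

/-! ## Graded modules -/

/-- A subspace `N` is homogeneous with respect to a family `𝒢` of subspaces if it is spanned by
its intersections with the members of `𝒢`. -/
def IsHomogeneous {ι M : Type*} [AddCommGroup M] [Module ℂ M] (𝒢 : ι → Submodule ℂ M)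
    (N : Submodule ℂ M) : Prop :=
  N = ⨆ i, N ⊓ 𝒢 i

section Graded

variable {V : Type*} [AddCommGroup V] [Module ℂ V] [LieRingModule L V]

/-- `V = ⨁ V_n` (`n ∈ ℤ²`) is a `ℤ²`-graded `L`-module: `D(m) V_n ⊆ V_{m + n}`. -/
structure IsGradedModule (𝒱 : Gam → Submodule ℂ V) : Prop where
  isInternal : DirectSum.IsInternal 𝒱
  lie_mem : ∀ (m n : Gam), ∀ v ∈ 𝒱 n, ⁅D m, v⁆ ∈ 𝒱 (m + n)

/-- The class `𝒪_{ℤ²}`: the `ℤ²`-graded module `V = ⨁ V_n` is irreducible as a graded module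
(it is nonzero and its only graded submodules are `0` and `V`) and quasi-finite. -/
structure InO (𝒱 : Gam → Submodule ℂ V) : Prop where
  nontrivial : Nontrivial V
  irreducible : ∀ N : LieSubmodule ℂ L V, IsHomogeneous 𝒱 N.toSubmodule → N = ⊥ ∨ N = ⊤
  quasiFinite : ∀ n, FiniteDimensional ℂ (𝒱 n)

end Graded

/-! ## The `ℤ`-grading attached to a basis, and exp-polynomial functions

A `ℤ`-basis `{b₁, b₂}` of `Γ` is given as `b : Module.Basis (Fin 2) ℤ Gam`, with `b₁ = b 0` and
`b₂ = b 1`; so `r = b.repr r 0 • b₁ + b.repr r 1 • b₂` for all `r ∈ Γ`. -/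

/-- The degree `j` part of `L`: the span of the `D(j b₁ + m b₂)`, and of `c₁`, `c₂` if `j = 0`. -/
def Lgr (b : Module.Basis (Fin 2) ℤ Gam) (j : ℤ) : Submodule ℂ L :=
  Submodule.span ℂ (Set.range fun m : ℤ => D (j • b 0 + m • b 1)) ⊔
    if j = 0 then Submodule.span ℂ {c₁, c₂} else ⊥

/-- `L₀`. -/
abbrev L0 (b : Module.Basis (Fin 2) ℤ Gam) : Submodule ℂ L := Lgr b 0

theorem D_mem_L0 (b : Module.Basis (Fin 2) ℤ Gam) (k : ℤ) : D (k • b 1) ∈ L0 b :=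
  Submodule.mem_sup_left (Submodule.subset_span ⟨k, by simp⟩)

theorem h_mem_L0 (b : Module.Basis (Fin 2) ℤ Gam) (m : Gam) : h m ∈ L0 b := by
  refine Submodule.mem_sup_right ?_
  rw [if_pos rfl]
  exact add_mem (zsmul_mem (Submodule.subset_span (by simp)) _)
    (zsmul_mem (Submodule.subset_span (by simp)) _)

/-- `D(k b₂)` as an element of `L₀`. -/
def L0.D (b : Module.Basis (Fin 2) ℤ Gam) (k : ℤ) : L0 b :=
  ⟨VirasoroLike.D (k • b 1), D_mem_L0 b k⟩

/-- `h(m)` as an element of `L₀`. -/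
def L0.h (b : Module.Basis (Fin 2) ℤ Gam) (m : Gam) : L0 b := ⟨VirasoroLike.h m, h_mem_L0 b m⟩

/-- `ψ` is an exp-polynomial function over `L₀`: it is a nonzero linear function with
`ψ(h(b₂)) = 0`, `ψ(D(k b₂)) = (∑ i, p_i(k) α_i ^ k) / k` for `k ≠ 0` and
`ψ(h(b₁)) = -det(b₁, b₂) ∑ i, p_i(0)`, for some polynomials `p_i` and nonzero `α_i`. -/
def IsExpPolynomial (b : Module.Basis (Fin 2) ℤ Gam) (ψ : L0 b →ₗ[ℂ] ℂ) : Prop :=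
  ψ ≠ 0 ∧ ψ (L0.h b (b 1)) = 0 ∧
    ∃ (r : ℕ) (p : Fin r → Polynomial ℂ) (α : Fin r → ℂ),
      (∀ i, α i ≠ 0) ∧
      (∀ k : ℤ, k ≠ 0 → ψ (L0.D b k) = (∑ i, (p i).eval (k : ℂ) * α i ^ k) / k) ∧
      ψ (L0.h b (b 0)) = -(det (b 0) (b 1) : ℂ) * ∑ i, (p i).coeff 0

/-! ## The irreducible highest weight module `V̂⁺(ψ)` -/

/-- The universal enveloping algebra `U(L)`. -/
abbrev U : Type := UniversalEnvelopingAlgebra ℂ L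

/-- The degree `m` part of `U(L)` for the `ℤ`-grading, spanned by the products
`D(r₁) ⋯ D(r_k)` of total degree `m`. (Since `c₁`, `c₂` are commutators of elements `D(r)`, these
products span `U(L)`.) -/
def uDeg (b : Module.Basis (Fin 2) ℤ Gam) (m : ℤ) : Submodule ℂ U :=
  Submodule.span ℂ {x | ∃ l : List Gam, (l.map fun r => b.repr r 0).sum = m ∧
    x = (l.map fun r => UniversalEnvelopingAlgebra.ι ℂ (D r)).prod}

section Modules

variable (b : Module.Basis (Fin 2) ℤ Gam) (ψ : L0 b →ₗ[ℂ] ℂ)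

/-- The left ideal of `U(L)` generated by `L_j`, `j > 0`, and by `x - ψ(x)`, `x ∈ L₀`. -/
def vermaIdeal : Submodule U U :=
  Submodule.span U
    ({y | ∃ j : ℤ, 0 < j ∧ ∃ x ∈ Lgr b j, y = UniversalEnvelopingAlgebra.ι ℂ x} ∪
      {y | ∃ x : L0 b, y = UniversalEnvelopingAlgebra.ι ℂ (x : L) - algebraMap ℂ U (ψ x)})

/-- The module induced from the one-dimensional `(L₀ + L₊)`-module `ℂ v₀` on which `L₊` acts by
zero and `L₀` acts by `ψ`; the class of `1` is `v₀`. -/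
abbrev Verma : Type := U ⧸ vermaIdeal b ψ

/-- The degree `m` part of the induced module, `v₀` having degree `0`. -/
def vermaDeg (m : ℤ) : Submodule ℂ (Verma b ψ) :=
  (uDeg b m).map ((vermaIdeal b ψ).mkQ.restrictScalars ℂ)

/-- The largest proper graded submodule of the induced module. -/
def vermaRadical : Submodule U (Verma b ψ) :=
  sSup {N | IsHomogeneous (vermaDeg b ψ) (N.restrictScalars ℂ) ∧ N ≠ ⊤}

/-- The module `V̂⁺(ψ)`. -/
def VHat : Type := Verma b ψ ⧸ vermaRadical b ψ

instance : AddCommGroup (VHat b ψ) :=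
  inferInstanceAs (AddCommGroup (Verma b ψ ⧸ vermaRadical b ψ))

instance : Module U (VHat b ψ) :=
  inferInstanceAs (Module U (Verma b ψ ⧸ vermaRadical b ψ))

instance : Module ℂ (VHat b ψ) :=
  inferInstanceAs (Module ℂ (Verma b ψ ⧸ vermaRadical b ψ))

instance : IsScalarTower ℂ U (VHat b ψ) :=
  inferInstanceAs (IsScalarTower ℂ U (Verma b ψ ⧸ vermaRadical b ψ))

instance : LieRingModule L (VHat b ψ) where
  bracket x v := UniversalEnvelopingAlgebra.ι ℂ x • v
  add_lie x y v := by
    change UniversalEnvelopingAlgebra.ι ℂ (x + y) • v = _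
    rw [map_add, add_smul]
  lie_add x v w := smul_add _ v w
  leibniz_lie x y v := by
    change UniversalEnvelopingAlgebra.ι ℂ x • UniversalEnvelopingAlgebra.ι ℂ y • v =
      UniversalEnvelopingAlgebra.ι ℂ ⁅x, y⁆ • v +
        UniversalEnvelopingAlgebra.ι ℂ y • UniversalEnvelopingAlgebra.ι ℂ x • v
    rw [LieHom.map_lie, LieRing.of_associative_ring_bracket, sub_smul, mul_smul, mul_smul,
      sub_add_cancel]

instance : LieModule ℂ L (VHat b ψ) where
  smul_lie t x v := by
    change UniversalEnvelopingAlgebra.ι ℂ (t • x) • v = t • UniversalEnvelopingAlgebra.ι ℂ x • v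
    rw [map_smul, smul_assoc]
  lie_smul t x v := by
    change UniversalEnvelopingAlgebra.ι ℂ x • t • v = t • UniversalEnvelopingAlgebra.ι ℂ x • v
    rw [smul_comm]

/-- The projection `U(L) → V̂⁺(ψ)`, `u ↦ u v₀`. -/
def toVHat : U →ₗ[U] VHat b ψ :=
  (vermaRadical b ψ).mkQ ∘ₗ (vermaIdeal b ψ).mkQ

/-- The highest weight vector `v₀` of `V̂⁺(ψ)`. -/
def vac : VHat b ψ := toVHat b ψ 1

/-- The degree `m` part of the `ℤ`-graded module `V̂⁺(ψ)`. -/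
def vHatDeg (m : ℤ) : Submodule ℂ (VHat b ψ) :=
  (uDeg b m).map ((toVHat b ψ).restrictScalars ℂ)

/-! ## The modules `V(ψ)` and `V̄(ψ, i, s)` -/

/-- `V(ψ) = V̂⁺(ψ) ⊗ ℂ[t, t⁻¹]`. -/
def VPsi : Type := VHat b ψ ⊗[ℂ] ℂ[T;T⁻¹]

instance : AddCommGroup (VPsi b ψ) := inferInstanceAs (AddCommGroup (VHat b ψ ⊗[ℂ] ℂ[T;T⁻¹]))

instance : Module ℂ (VPsi b ψ) := inferInstanceAs (Module ℂ (VHat b ψ ⊗[ℂ] ℂ[T;T⁻¹]))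

/-- The identification of `V̂⁺(ψ) ⊗ ℂ[t, t⁻¹]` with `V(ψ)`. -/
def ofTensor : (VHat b ψ ⊗[ℂ] ℂ[T;T⁻¹]) ≃ₗ[ℂ] VPsi b ψ := LinearEquiv.refl ℂ _

/-- The element `v ⊗ t^k` of `V(ψ)`, as a linear function of `v`. -/
def tmulT (k : ℤ) : VHat b ψ →ₗ[ℂ] VPsi b ψ :=
  (ofTensor b ψ).toLinearMap ∘ₗ
    (TensorProduct.mk ℂ (VHat b ψ) ℂ[T;T⁻¹]).flip (LaurentPolynomial.T k)

/-- The operator `v ⊗ f ↦ (x v) ⊗ (t^j f)` on `V(ψ)`. -/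
def twist (x : L) (j : ℤ) : Module.End ℂ (VPsi b ψ) :=
  (ofTensor b ψ).conj (TensorProduct.map (LieModule.toEnd ℂ L (VHat b ψ) x)
    (LinearMap.mulLeft ℂ (LaurentPolynomial.T j : ℂ[T;T⁻¹])))

theorem twist_tmulT (x : L) (j k : ℤ) (v : VHat b ψ) :
    twist b ψ x j (tmulT b ψ k v) = tmulT b ψ (k + j) ⁅x, v⁆ := by
  rw [add_comm k j]
  simp only [tmulT, LaurentPolynomial.T_add]
  exact congrArg (ofTensor b ψ) (TensorProduct.map_tmul _ _ _ _)

theorem end_ext {f g : Module.End ℂ (VPsi b ψ)}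
    (hfg : ∀ k v, f (tmulT b ψ k v) = g (tmulT b ψ k v)) : f = g := by
  have key : f ∘ₗ (ofTensor b ψ).toLinearMap = g ∘ₗ (ofTensor b ψ).toLinearMap := by
    refine TensorProduct.ext' fun v p => ?_
    induction p using LaurentPolynomial.induction_on' with
    | add p q hp hq => rw [TensorProduct.tmul_add, map_add, map_add, hp, hq]
    | C_mul_T n a =>
      rw [← LaurentPolynomial.smul_eq_C_mul, TensorProduct.tmul_smul, map_smul, map_smul]
      exact congrArg (a • ·) (hfg n v)
  ext x
  simpa using congrArg (fun k => k ((ofTensor b ψ).symm x)) key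

theorem twist_comm (x y : L) (i j : ℤ) :
    twist b ψ x i * twist b ψ y j - twist b ψ y j * twist b ψ x i =
      twist b ψ ⁅x, y⁆ (i + j) := by
  refine end_ext b ψ fun k v => ?_
  simp only [LinearMap.sub_apply, Module.End.mul_apply, twist_tmulT, lie_lie, map_sub]
  rw [add_right_comm k j i, add_assoc k i j]

theorem twist_add (x y : L) (j : ℤ) :
    twist b ψ (x + y) j = twist b ψ x j + twist b ψ y j :=
  end_ext b ψ fun k v => by simp [twist_tmulT]

theorem twist_smul (t : ℂ) (x : L) (j : ℤ) :
    twist b ψ (t • x) j = t • twist b ψ x j :=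
  end_ext b ψ fun k v => by simp [twist_tmulT]

theorem twist_zsmul (t : ℤ) (x : L) (j : ℤ) :
    twist b ψ (t • x) j = t • twist b ψ x j := by
  rw [← Int.cast_smul_eq_zsmul ℂ t x, twist_smul, Int.cast_smul_eq_zsmul]

theorem twist_zero (j : ℤ) : twist b ψ 0 j = 0 := by
  simpa using twist_smul b ψ 0 0 j

/-- The representation of `L` on `V(ψ)`: `D(i b₁ + j b₂)` acts by
`v ⊗ t^k ↦ (D(i b₁ + j b₂) v) ⊗ t^(k + j)`, and `c₁`, `c₂` act on the first factor. -/
def vPsiRep : L →ₗ⁅ℂ⁆ Module.End ℂ (VPsi b ψ) :=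
  repOfRelations (fun r => twist b ψ (D r) (b.repr r 1)) (twist b ψ c₁ 0) (twist b ψ c₂ 0)
    (by simp [twist_zero])
    (by
      intro m n
      rw [twist_comm, lie_D_D, twist_add, twist_zsmul, map_add, Finsupp.add_apply]
      congr 1
      split_ifs with hmn
      · have e : b.repr m 1 + b.repr n 1 = 0 := by
          rw [← Finsupp.add_apply, ← map_add, hmn]
          simp
        rw [e, h, twist_add, twist_zsmul, twist_zsmul]
      · rw [twist_zero])
    (fun m => by rw [← sub_eq_zero, twist_comm, D_lie_c₁, twist_zero])
    (fun m => by rw [← sub_eq_zero, twist_comm, D_lie_c₂, twist_zero])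
    (by rw [← sub_eq_zero, twist_comm, c₁_lie, twist_zero])

theorem vPsiRep_D (r : Gam) : vPsiRep b ψ (D r) = twist b ψ (D r) (b.repr r 1) :=
  repOfRelations_D _ _ _ _ _ r

theorem vPsiRep_c₁ : vPsiRep b ψ c₁ = twist b ψ c₁ 0 := repOfRelations_c₁ _ _ _ _ _

theorem vPsiRep_c₂ : vPsiRep b ψ c₂ = twist b ψ c₂ 0 := repOfRelations_c₂ _ _ _ _ _

instance : LieRingModule L (VPsi b ψ) := LieRingModule.compLieHom (VPsi b ψ) (vPsiRep b ψ)

instance : LieModule ℂ L (VPsi b ψ) := LieModule.compLieHom (VPsi b ψ) (vPsiRep b ψ)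

theorem lie_D_tmulT (r : Gam) (k : ℤ) (v : VHat b ψ) :
    ⁅D r, tmulT b ψ k v⁆ = tmulT b ψ (k + b.repr r 1) ⁅D r, v⁆ := by
  change vPsiRep b ψ (D r) (tmulT b ψ k v) = _
  rw [vPsiRep_D, twist_tmulT]

theorem lie_c₁_tmulT (k : ℤ) (v : VHat b ψ) : ⁅c₁, tmulT b ψ k v⁆ = tmulT b ψ k ⁅c₁, v⁆ := by
  change vPsiRep b ψ c₁ (tmulT b ψ k v) = _
  rw [vPsiRep_c₁, twist_tmulT, add_zero]

theorem lie_c₂_tmulT (k : ℤ) (v : VHat b ψ) : ⁅c₂, tmulT b ψ k v⁆ = tmulT b ψ k ⁅c₂, v⁆ := by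
  change vPsiRep b ψ c₂ (tmulT b ψ k v) = _
  rw [vPsiRep_c₂, twist_tmulT, add_zero]

/-- The degree `γ` part of `V(ψ)`, where `v ⊗ t^k` has degree `m b₁ + k b₂` for `v` of
degree `m`. -/
def vPsiDeg (γ : Gam) : Submodule ℂ (VPsi b ψ) :=
  (vHatDeg b ψ (b.repr γ 0)).map (tmulT b ψ (b.repr γ 1))

/-- The Heisenberg subalgebra `ℋ`, spanned by the `D(k b₂)` and `h(b₂)`. -/
def heis : Submodule ℂ L :=
  Submodule.span ℂ (Set.range (fun k : ℤ => D (k • b 1)) ∪ {h (b 1)})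

/-- `W_i = U(ℋ) (v₀ ⊗ t^i)`, the smallest `ℋ`-stable subspace that contains `v₀ ⊗ t^i`. -/
def topSpace (i : ℤ) : Submodule ℂ (VPsi b ψ) :=
  sInf {N | tmulT b ψ i (vac b ψ) ∈ N ∧ ∀ x ∈ heis b, ∀ w ∈ N, ⁅x, w⁆ ∈ N}

/-- The largest graded submodule of `V(ψ)` that intersects `W_i` trivially. -/
def maxSub (i : ℤ) : LieSubmodule ℂ L (VPsi b ψ) :=
  sSup {N | IsHomogeneous (vPsiDeg b ψ) N.toSubmodule ∧ N.toSubmodule ⊓ topSpace b ψ i = ⊥}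

/-- The module `V̄(ψ, i, s)`, the quotient of `V(ψ)` by its largest graded submodule that
intersects `W_i` trivially. The number `s` is determined by `ψ`, see `HasStep`. -/
abbrev VBar (i : ℤ) : Type := VPsi b ψ ⧸ maxSub b ψ i

/-- The degree `γ` part of `V̄(ψ, i, s)`. -/
def vBarDeg (i : ℤ) (γ : Gam) : Submodule ℂ (VBar b ψ i) :=
  (vPsiDeg b ψ γ).map (LieSubmodule.Quotient.mk' (maxSub b ψ i)).toLinearMap

/-- The image of the homomorphism `U(ℋ) → ℂ[t, t⁻¹]` with `D(k b₂) ↦ ψ(D(k b₂)) t^k` for `k ≠ 0`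
and `h(b₂) ↦ 0`. -/
def aPsi : Subalgebra ℂ ℂ[T;T⁻¹] :=
  Algebra.adjoin ℂ {f | ∃ k : ℤ, k ≠ 0 ∧ f = ψ (L0.D b k) • LaurentPolynomial.T k}

/-- `s` is the positive integer such that the image of `U(ℋ)` in `ℂ[t, t⁻¹]` is `ℂ[t^s, t^(-s)]`;
equivalently, `W_i = v₀ ⊗ ℂ[t^s, t^(-s)] t^i`. -/
def HasStep (s : ℕ) : Prop :=
  0 < s ∧ aPsi b ψ =
    Algebra.adjoin ℂ {LaurentPolynomial.T (s : ℤ), LaurentPolynomial.T (-(s : ℤ))}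

end Modules

end VirasoroLike

end

/-! Two things have to be seen: V̄(ψ, i, s) lies in 𝒪 whatever grading it carries, and every module
in 𝒪 with nontrivial central action is of this form.

Irreducibility of V̄ is built into its construction (`vBar_irreducible`). For finiteness write ψ(D(k
b₂)) = g(k)/k. Level 1 times level -1 acts on v₀ by multiples of g(k + m) (`lie_one_lie_neg_one`),
and an exp-polynomial g satisfies a two-sided linear recurrence with some polynomial P. Bracketing
acts on combinations ∑ Q_i D(j b₁ + (n + i) b₂) through a first order differential operator on Q
(`lie_recL_E`), so high powers of P annihilate each vector in each negative level, and every level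
of V̂⁺(ψ) is finite-dimensional (`lowSpan_fg`). An isomorphism of ungraded modules is enough,
because the grading of V̄ is unique up to a shift (`grading_vBar_unique`): its highest weight
vectors form a copy of ℂ[T, T⁻¹], in which 1 is forced to be homogeneous.

Conversely, in an irreducible quasi-finite module h(m) acts by a scalar η(m), and η ≠ 0. When η(m) ≠
0, the Heisenberg algebra on ℤm makes dimensions grow on one side of the line
(`exists_sign_le_finrank`). A dimension count then gives a vector killed by D(e₁) and D(e₂) for a
basis e₁, e₂ of Γ, and from this one of ±m is a direction in which every vector is eventually killed
(`pos_or_pos_neg`). These directions, the predicate `Pos`, form a semigroup without opposite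
elements, and D(-r) is injective for r in it, so dimensions do not increase along r. Growth against
this bound leaves only the case where `Pos` contains an open half plane whose boundary b₂ satisfies
η(b₂) = 0 (`exists_halfplane_basis`).

Hence there is a top level (`exists_top_level`). The D(k b₂) commute there and act as multiples ψ_k
of translations (`exists_top_sequence`). Finite dimension one level below the top is a linear
recurrence for k ψ_k, so ψ is exp-polynomial (`mem_expPoly_of_top_sequence`). Finally, irreducible
graded modules having homogeneous vectors on which words of degree zero act by equal scalars are
isomorphic (`exists_graded_equiv`). -/

open scoped TensorProduct LaurentPolynomial

noncomputable section

namespace VirasoroLike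

attribute [local instance] LieRing.ofAssociativeRing

set_option linter.unusedSectionVars false

/-! ## Projections of a grading -/

section Grading

variable {ι M : Type*} [AddCommGroup M] [Module ℂ M]

/-- The `π i` are the projections onto the components of the grading `𝒢` of `M`. -/
structure GradProj (𝒢 : ι → Submodule ℂ M) (π : ι → M →ₗ[ℂ] M) : Prop where
  same : ∀ i, ∀ x ∈ 𝒢 i, π i x = x
  ne : ∀ i j, i ≠ j → ∀ x ∈ 𝒢 j, π i x = 0
  span : ⨆ i, 𝒢 i = ⊤

variable {𝒢 : ι → Submodule ℂ M} {π : ι → M →ₗ[ℂ] M}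

theorem exists_gradProj [DecidableEq ι] (h : DirectSum.IsInternal 𝒢) : ∃ π, GradProj 𝒢 π := by
  let e := LinearEquiv.ofBijective (DirectSum.coeLinearMap 𝒢) h
  have he : ∀ i (x : 𝒢 i), e.symm (x : M) = DirectSum.lof ℂ ι (fun i => 𝒢 i) i x := by
    intro i x
    rw [LinearEquiv.symm_apply_eq]
    exact (DirectSum.coeLinearMap_lof 𝒢 i x).symm
  refine ⟨fun i => (𝒢 i).subtype ∘ₗ DirectSum.component ℂ ι (fun i => 𝒢 i) i ∘ₗ e.symm.toLinearMap,
    ?_, ?_, h.submodule_iSup_eq_top⟩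
  · intro i x hx
    have := he i ⟨x, hx⟩
    simp only [LinearMap.comp_apply, LinearEquiv.coe_coe] at *
    rw [this, DirectSum.component.lof_self]
    rfl
  · intro i j hij x hx
    have := he j ⟨x, hx⟩
    simp only [LinearMap.comp_apply, LinearEquiv.coe_coe] at *
    rw [this, DirectSum.component.of, dif_neg (Ne.symm hij)]
    rfl

namespace GradProj

theorem apply_mem (h : GradProj 𝒢 π) (i : ι) (x : M) : π i x ∈ 𝒢 i := by
  have hx : x ∈ ⨆ i, 𝒢 i := h.span ▸ Submodule.mem_top
  induction hx using Submodule.iSup_induction' with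
  | mem j x hx =>
    by_cases hij : i = j
    · subst hij; rwa [h.same i x hx]
    · rw [h.ne i j hij x hx]; exact zero_mem _
  | zero => simp
  | add x y _ _ hx hy => rw [map_add]; exact add_mem hx hy

theorem mem_of_forall (h : GradProj 𝒢 π) {N : Submodule ℂ M} {x : M} (hN : ∀ i, π i x ∈ N) :
    x ∈ N := by
  suffices H : x ∈ Submodule.span ℂ (Set.range fun i => π i x) from
    Submodule.span_le.2 (by rintro _ ⟨i, rfl⟩; exact hN i) H
  have hx : x ∈ ⨆ i, 𝒢 i := h.span ▸ Submodule.mem_top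
  rw [Submodule.mem_iSup_iff_exists_finsupp] at hx
  obtain ⟨f, hf, rfl⟩ := hx
  have key : ∀ i, π i (f.sum fun _ y => y) = f i := by
    classical
    intro i
    rw [map_finsuppSum, Finsupp.sum, Finset.sum_eq_single i]
    · exact h.same i _ (hf i)
    · intro j _ hj
      exact h.ne i j (Ne.symm hj) _ (hf j)
    · intro hi
      simp [Finsupp.notMem_support_iff.1 hi]
  simp only [key]
  exact Submodule.sum_mem _ fun i _ => Submodule.subset_span ⟨i, rfl⟩

theorem eq_zero (h : GradProj 𝒢 π) {x : M} (hx : ∀ i, π i x = 0) : x = 0 := by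
  have := h.mem_of_forall (N := ⊥) (x := x) (by simpa using hx)
  simpa using this

theorem exists_ne (h : GradProj 𝒢 π) {x : M} (hx : x ≠ 0) : ∃ i, π i x ≠ 0 := by
  by_contra! H
  exact hx (h.eq_zero H)

theorem isHomogeneous (h : GradProj 𝒢 π) {N : Submodule ℂ M} (hN : ∀ i, ∀ x ∈ N, π i x ∈ N) :
    IsHomogeneous 𝒢 N := by
  refine le_antisymm (fun x hx => h.mem_of_forall fun i => ?_) (iSup_le fun i => inf_le_left)
  exact Submodule.mem_iSup_of_mem i ⟨hN i x hx, h.apply_mem i x⟩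

theorem proj_mem (h : GradProj 𝒢 π) {N : Submodule ℂ M} (hN : IsHomogeneous 𝒢 N) (i : ι) {x : M}
    (hx : x ∈ N) : π i x ∈ N := by
  rw [hN] at hx
  induction hx using Submodule.iSup_induction' with
  | mem j x hx =>
    by_cases hij : i = j
    · subst hij; rw [h.same i x hx.2]; exact hx.1
    · rw [h.ne i j hij x hx.2]; exact zero_mem _
  | zero => simp
  | add x y _ _ hx hy => rw [map_add]; exact add_mem hx hy

/-- If homogeneous elements span, an inclusion of families contained in a grading is an equality. -/
theorem eq_of_le (h : GradProj 𝒢 π) {𝒳 : ι → Submodule ℂ M} (hle : ∀ i, 𝒳 i ≤ 𝒢 i)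
    (htop : ⨆ i, 𝒳 i = ⊤) (i : ι) : 𝒳 i = 𝒢 i := by
  refine le_antisymm (hle i) fun x hx => ?_
  have key : ∀ y ∈ ⨆ i, 𝒳 i, π i y ∈ 𝒳 i := by
    intro y hy
    induction hy using Submodule.iSup_induction' with
    | mem j y hy =>
      by_cases hij : i = j
      · subst hij; rwa [h.same i y (hle _ hy)]
      · rw [h.ne i j hij y (hle _ hy)]; exact zero_mem _
    | zero => simp
    | add y z _ _ hy hz => rw [map_add]; exact add_mem hy hz
  rw [← h.same i x hx]
  exact key x (htop ▸ Submodule.mem_top)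

/-- The supremum of homogeneous subspaces meeting one component trivially meets it trivially. -/
theorem sSup_inf_eq_bot (h : GradProj 𝒢 π) (i : ι) {S : Set (Submodule ℂ M)}
    (hS : ∀ N ∈ S, IsHomogeneous 𝒢 N ∧ N ⊓ 𝒢 i = ⊥) : sSup S ⊓ 𝒢 i = ⊥ := by
  rw [eq_bot_iff]
  rintro x ⟨hx, hxi⟩
  have key : ∀ y ∈ sSup S, π i y = 0 := by
    intro y hy
    rw [sSup_eq_iSup'] at hy
    induction hy using Submodule.iSup_induction' with
    | mem N y hy =>
      have : π i y ∈ (N : Submodule ℂ M) ⊓ 𝒢 i :=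
        ⟨h.proj_mem (hS _ N.2).1 i hy, h.apply_mem i y⟩
      rw [(hS _ N.2).2] at this
      simpa using this
    | zero => simp
    | add y z _ _ hy hz => rw [map_add, hy, hz, add_zero]
  rw [Submodule.mem_bot, ← h.same i x hxi]
  exact key x hx

theorem sSup_homogeneous {S : Set (Submodule ℂ M)} (hS : ∀ N ∈ S, IsHomogeneous 𝒢 N) :
    IsHomogeneous 𝒢 (sSup S) := by
  refine le_antisymm (sSup_le fun N hN => ?_) (iSup_le fun i => inf_le_left)
  nth_rewrite 1 [hS N hN]
  exact iSup_mono fun i => inf_le_inf_right _ (le_sSup hN)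

/-- A grading induces a grading on every quotient by a homogeneous subspace. -/
theorem map (h : GradProj 𝒢 π) {M' : Type*} [AddCommGroup M'] [Module ℂ M'] (f : M →ₗ[ℂ] M')
    (hf : Function.Surjective f) {K : Submodule ℂ M} (hK : ∀ x, f x = 0 ↔ x ∈ K)
    (hk : IsHomogeneous 𝒢 K) :
    ∃ π' : ι → M' →ₗ[ℂ] M', GradProj (fun i => (𝒢 i).map f) π' ∧ ∀ i x, π' i (f x) = f (π i x) := by
  let e := f.quotKerEquivOfSurjective hf
  have hle : ∀ i, LinearMap.ker f ≤ LinearMap.ker (f ∘ₗ π i) := fun i x hx =>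
    (hK _).2 (h.proj_mem hk i ((hK x).1 hx))
  have he : ∀ x, e.symm (f x) = (LinearMap.ker f).mkQ x := by
    intro x
    rw [LinearEquiv.symm_apply_eq]
    rfl
  refine ⟨fun i => (LinearMap.ker f).liftQ (f ∘ₗ π i) (hle i) ∘ₗ e.symm.toLinearMap, ?_, ?_⟩
  · refine ⟨?_, ?_, ?_⟩
    · rintro i _ ⟨x, hx, rfl⟩
      simp [he, h.same i x hx]
    · rintro i j hij _ ⟨x, hx, rfl⟩
      simp [he, h.ne i j hij x hx]
    · rw [← Submodule.map_iSup, h.span, Submodule.map_top, LinearMap.range_eq_top.2 hf]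
  · intro i x
    simp [he]

theorem comap_homogeneous (h : GradProj 𝒢 π) {M' : Type*} [AddCommGroup M'] [Module ℂ M']
    {f : M →ₗ[ℂ] M'} {π' : ι → M' →ₗ[ℂ] M'} {𝒢' : ι → Submodule ℂ M'} (h' : GradProj 𝒢' π')
    (hf : ∀ i x, π' i (f x) = f (π i x)) {N : Submodule ℂ M'} (hN : IsHomogeneous 𝒢' N) :
    IsHomogeneous 𝒢 (N.comap f) := by
  refine h.isHomogeneous fun i x hx => ?_
  rw [Submodule.mem_comap, ← hf]
  exact h'.proj_mem hN i hx

end GradProj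

end Grading

/-! ## Products of the operators `D(r)` -/

section Words

variable {V : Type*} [AddCommGroup V] [Module ℂ V] [LieRingModule L V] [LieModule ℂ L V]

/-- Since the center consists of commutators of the D(r), stability and intertwining conditions only
have to be checked on the D(r). -/
theorem c₁_eq_lie : c₁ = ⁅D (1, 0), D (-1, 0)⁆ := by
  rw [lie_D_D, if_pos (by simp)]
  simp [h, det]

theorem c₂_eq_lie : c₂ = ⁅D (0, 1), D (0, -1)⁆ := by
  rw [lie_D_D, if_pos (by simp)]
  simp [h, det]

theorem c₁_lie_eq (v : V) :
    ⁅c₁, v⁆ = ⁅D (1, 0), ⁅D (-1, 0), v⁆⁆ - ⁅D (-1, 0), ⁅D (1, 0), v⁆⁆ := by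
  rw [c₁_eq_lie, lie_lie]

theorem c₂_lie_eq (v : V) :
    ⁅c₂, v⁆ = ⁅D (0, 1), ⁅D (0, -1), v⁆⁆ - ⁅D (0, -1), ⁅D (0, 1), v⁆⁆ := by
  rw [c₂_eq_lie, lie_lie]

theorem h_lie (m : Gam) (v : V) : ⁅h m, v⁆ = (m.1 : ℂ) • ⁅c₁, v⁆ + (m.2 : ℂ) • ⁅c₂, v⁆ := by
  rw [h, add_lie, ← Int.cast_smul_eq_zsmul ℂ, ← Int.cast_smul_eq_zsmul ℂ, smul_lie, smul_lie]

theorem lie_lie_D (m n : Gam) (v : V) : ⁅D m, ⁅D n, v⁆⁆ =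
    ⁅D n, ⁅D m, v⁆⁆ + (-(det m n : ℂ)) • ⁅D (m + n), v⁆ + if m + n = 0 then ⁅h m, v⁆ else 0 := by
  have : ⁅⁅D m, D n⁆, v⁆ = (-(det m n : ℂ)) • ⁅D (m + n), v⁆ + if m + n = 0 then ⁅h m, v⁆ else 0 := by
    rw [lie_D_D, add_lie, ← Int.cast_smul_eq_zsmul ℂ, smul_lie]
    split_ifs <;> simp
  rw [leibniz_lie, this]
  abel

theorem lie_D_comm (x : L) (hx : ∀ y : L, ⁅x, y⁆ = 0) (y : L) (v : V) : ⁅x, ⁅y, v⁆⁆ = ⁅y, ⁅x, v⁆⁆ := by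
  rw [leibniz_lie, hx, zero_lie, zero_add]

/-- A property of elements of `L` holds if it holds for the `D(r)` and is stable under linear
combinations and brackets. -/
theorem mem_of_D_mem {P : Submodule ℂ L} (hD : ∀ r, D r ∈ P) (h1 : c₁ ∈ P) (h2 : c₂ ∈ P) (x : L) :
    x ∈ P := by
  have : P.mkQ = 0 := hom_ext (by simpa using hD) (by simpa using h1) (by simpa using h2)
  have := congrArg (fun f => f x) this
  simpa using this

theorem lie_mem_of_D {N : Submodule ℂ V} (hN : ∀ r, ∀ v ∈ N, ⁅D r, v⁆ ∈ N) (x : L) {v : V}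
    (hv : v ∈ N) : ⁅x, v⁆ ∈ N := by
  let P : Submodule ℂ L :=
    { carrier := {x | ∀ v ∈ N, ⁅x, v⁆ ∈ N}
      add_mem' := fun ha hb v hv => by rw [add_lie]; exact add_mem (ha v hv) (hb v hv)
      zero_mem' := fun v _ => by simp
      smul_mem' := fun t x hx v hv => by rw [smul_lie]; exact N.smul_mem t (hx v hv) }
  refine mem_of_D_mem (P := P) (fun r v hv => hN r v hv) (fun v hv => ?_) (fun v hv => ?_) x v hv
  · rw [c₁_lie_eq]
    exact sub_mem (hN _ _ (hN _ _ hv)) (hN _ _ (hN _ _ hv))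
  · rw [c₂_lie_eq]
    exact sub_mem (hN _ _ (hN _ _ hv)) (hN _ _ (hN _ _ hv))

/-- A subspace stable under all `D(r)` is a submodule. -/
def lieSubOfD (N : Submodule ℂ V) (hN : ∀ r, ∀ v ∈ N, ⁅D r, v⁆ ∈ N) : LieSubmodule ℂ L V :=
  { N with lie_mem := fun {x _} hv => lie_mem_of_D hN x hv }

variable (V) in
/-- The operator `D(r₁) ⋯ D(r_k)` on `V`. -/
def act (l : List Gam) : Module.End ℂ V := (l.map fun r => LieModule.toEnd ℂ L V (D r)).prod

@[simp] theorem act_nil (v : V) : act V [] v = v := rfl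

@[simp] theorem act_cons (r : Gam) (l : List Gam) (v : V) : act V (r :: l) v = ⁅D r, act V l v⁆ := by
  simp [act]

@[simp] theorem act_append (l l' : List Gam) (v : V) : act V (l ++ l') v = act V l (act V l' v) := by
  simp [act]

theorem act_central (x : L) (hx : ∀ y : L, ⁅x, y⁆ = 0) (l : List Gam) (v : V) :
    ⁅x, act V l v⁆ = act V l ⁅x, v⁆ := by
  induction l with
  | nil => rfl
  | cons r l ih => rw [act_cons, act_cons, lie_D_comm x hx, ih]

theorem h_central (m : Gam) (y : L) : ⁅h m, y⁆ = 0 := br_h_left y m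

theorem act_mem {𝒱 : Gam → Submodule ℂ V} (hD : ∀ m n, ∀ v ∈ 𝒱 n, ⁅D m, v⁆ ∈ 𝒱 (m + n))
    (l : List Gam) {d : Gam} {v : V} (hv : v ∈ 𝒱 d) : act V l v ∈ 𝒱 (l.sum + d) := by
  induction l with
  | nil => simpa using hv
  | cons r l ih =>
    rw [act_cons, List.sum_cons, add_assoc]
    exact hD _ _ _ ih

theorem act_mem_of_lie_mem (N : LieSubmodule ℂ L V) (l : List Gam) {v : V} (hv : v ∈ N) :
    act V l v ∈ N := by
  induction l with
  | nil => exact hv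
  | cons r l ih => rw [act_cons]; exact N.lie_mem ih

theorem map_act {W : Type*} [AddCommGroup W] [Module ℂ W] [LieRingModule L W] [LieModule ℂ L W]
    (f : V →ₗ[ℂ] W) (hf : ∀ r v, f ⁅D r, v⁆ = ⁅D r, f v⁆) (l : List Gam) (v : V) :
    f (act V l v) = act W l (f v) := by
  induction l with
  | nil => rfl
  | cons r l ih => rw [act_cons, act_cons, hf, ih]

/-- A linear map commuting with all `D(r)` is `L`-linear. -/
theorem map_lie_of_D {W : Type*} [AddCommGroup W] [Module ℂ W] [LieRingModule L W]
    [LieModule ℂ L W] (f : V →ₗ[ℂ] W) (hf : ∀ r v, f ⁅D r, v⁆ = ⁅D r, f v⁆) (x : L) (v : V) :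
    f ⁅x, v⁆ = ⁅x, f v⁆ := by
  let P : Submodule ℂ L :=
    { carrier := {x | ∀ v, f ⁅x, v⁆ = ⁅x, f v⁆}
      add_mem' := fun ha hb v => by rw [add_lie, add_lie, map_add, ha, hb]
      zero_mem' := fun v => by simp
      smul_mem' := fun t x hx v => by rw [smul_lie, smul_lie, map_smul, hx] }
  refine mem_of_D_mem (P := P) (fun r v => hf r v) (fun v => ?_) (fun v => ?_) x v
  · simp only [c₁_lie_eq, map_sub, hf]
  · simp only [c₂_lie_eq, map_sub, hf]

/-- The submodule generated by `v`. -/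
def gen (v : V) : LieSubmodule ℂ L V :=
  lieSubOfD (Submodule.span ℂ (Set.range fun l => act V l v)) fun r w hw => by
    induction hw using Submodule.span_induction with
    | mem x hx =>
      obtain ⟨l, rfl⟩ := hx
      exact Submodule.subset_span ⟨r :: l, act_cons r l v⟩
    | zero => simp
    | add x y _ _ hx hy => rw [lie_add]; exact add_mem hx hy
    | smul a x _ hx => rw [lie_smul]; exact Submodule.smul_mem _ a hx

theorem act_mem_gen (l : List Gam) (v : V) : act V l v ∈ gen v := Submodule.subset_span ⟨l, rfl⟩

theorem self_mem_gen (v : V) : v ∈ gen v := act_mem_gen [] v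

theorem gen_le {N : LieSubmodule ℂ L V} {v : V} (hv : v ∈ N) : gen v ≤ N := by
  change Submodule.span ℂ _ ≤ N.toSubmodule
  rw [Submodule.span_le]
  rintro _ ⟨l, rfl⟩
  exact act_mem_of_lie_mem N l hv

theorem gen_proj_mem {ι : Type*} {𝒱 : ι → Submodule ℂ V} {π : ι → V →ₗ[ℂ] V} (hπ : GradProj 𝒱 π)
    {v : V} {δ : List Gam → ι} (hδ : ∀ l, act V l v ∈ 𝒱 (δ l)) {x : V} (hx : x ∈ gen v) (γ : ι) :
    π γ x ∈ Submodule.span ℂ {y | ∃ l, δ l = γ ∧ y = act V l v} := by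
  change x ∈ Submodule.span ℂ _ at hx
  induction hx using Submodule.span_induction with
  | mem x hx =>
    obtain ⟨l, rfl⟩ := hx
    by_cases hl : δ l = γ
    · subst hl
      rw [hπ.same _ _ (hδ l)]
      exact Submodule.subset_span ⟨l, rfl, rfl⟩
    · rw [hπ.ne _ _ (Ne.symm hl) _ (hδ l)]
      exact zero_mem _
  | zero => simp
  | add x y _ _ hx hy => rw [map_add]; exact add_mem hx hy
  | smul a x _ hx => rw [map_smul]; exact Submodule.smul_mem _ a hx

theorem gen_homogeneous {ι : Type*} {𝒱 : ι → Submodule ℂ V} {π : ι → V →ₗ[ℂ] V}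
    (hπ : GradProj 𝒱 π) {v : V} {δ : List Gam → ι} (hδ : ∀ l, act V l v ∈ 𝒱 (δ l)) :
    IsHomogeneous 𝒱 (gen v).toSubmodule := by
  refine hπ.isHomogeneous fun γ x hx => ?_
  refine Submodule.span_le.2 ?_ (gen_proj_mem hπ hδ hx γ)
  rintro _ ⟨l, _, rfl⟩
  exact act_mem_gen l v

/-- Straightening: if the subspaces `T k` are killed by the `D(r)` of positive level, stable under
the center, and permuted by the `D(j b₂)`, then products of level zero permute them as well, and
products of positive level kill them. -/
theorem act_top (b : Module.Basis (Fin 2) ℤ Gam) (T : ℤ → Submodule ℂ V)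
    (hpos : ∀ r, 0 < b.repr r 0 → ∀ k, ∀ x ∈ T k, ⁅D r, x⁆ = 0)
    (hzero : ∀ r, b.repr r 0 = 0 → ∀ k, ∀ x ∈ T k, ⁅D r, x⁆ ∈ T (k + b.repr r 1))
    (hh : ∀ m, ∀ k, ∀ x ∈ T k, ⁅h m, x⁆ ∈ T k) (l : List Gam) (k : ℤ) (x : V) (hx : x ∈ T k) :
    (0 < b.repr l.sum 0 → act V l x = 0) ∧
      (b.repr l.sum 0 = 0 → act V l x ∈ T (k + b.repr l.sum 1)) := by
  -- Both claims become one membership, with target zero for positive total level and no condition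
  -- for negative level; this form passes through sums of words.
  let Tgt : Gam → ℤ → Submodule ℂ V := fun γ k =>
    if 0 < b.repr γ 0 then ⊥ else if b.repr γ 0 = 0 then T (k + b.repr γ 1) else ⊤
  suffices H : ∀ n, ∀ l : List Gam, l.length ≤ n → ∀ k, ∀ x ∈ T k, act V l x ∈ Tgt l.sum k by
    have := H _ l le_rfl k x hx
    refine ⟨fun hl => ?_, fun hl => ?_⟩
    · simpa [Tgt, hl] using this
    · simpa [Tgt, hl] using this
  intro n
  induction n with
  | zero =>
    intro l hl k x hx
    obtain rfl : l = [] := List.length_eq_zero_iff.1 (by omega)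
    simpa [Tgt] using hx
  | succ n ih =>
    -- A letter r of nonnegative level is pushed to the right. Every commutator is a shorter word of
    -- the same total degree, covered by `ih`; once r is last it acts on `T k` directly.
    have key : ∀ r, 0 ≤ b.repr r 0 → ∀ suf pre : List Gam, (pre ++ r :: suf).length ≤ n + 1 →
        ∀ k, ∀ x ∈ T k, act V (pre ++ r :: suf) x ∈ Tgt (pre ++ r :: suf).sum k := by
      intro r hr suf
      induction suf with
      | nil =>
        intro pre hpre k x hx
        rw [act_append, act_cons, act_nil]
        rcases hr.lt_or_eq with hr | hr
        · rw [hpos r hr k x hx, map_zero]; exact zero_mem _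
        · have := ih pre (by simp at hpre; omega) _ _ (hzero r hr.symm k x hx)
          have e : Tgt (pre ++ [r]).sum k = Tgt pre.sum (k + b.repr r 1) := by
            simp only [Tgt, List.sum_append, List.sum_singleton, map_add, Finsupp.add_apply, ← hr,
              add_zero]
            rw [add_comm (b.repr pre.sum 1), add_assoc]
          rwa [e]
      | cons a suf ihs =>
        intro pre hpre k x hx
        have e1 : act V (pre ++ r :: a :: suf) x = act V ((pre ++ [a]) ++ r :: suf) x +
            (-(det r a : ℂ)) • act V (pre ++ (r + a) :: suf) x +
            if r + a = 0 then act V (pre ++ suf) ⁅h r, x⁆ else 0 := by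
          simp only [act_append, act_cons, act_nil]
          rw [lie_lie_D r a, map_add, map_add, map_smul]
          congr 1
          split_ifs
          · rw [act_central _ (h_central r)]
          · simp
        have s1 : ((pre ++ [a]) ++ r :: suf).sum = (pre ++ r :: a :: suf).sum := by
          simp only [List.sum_append, List.sum_cons, List.sum_nil]; abel
        have s2 : (pre ++ (r + a) :: suf).sum = (pre ++ r :: a :: suf).sum := by
          simp only [List.sum_append, List.sum_cons]; abel
        have l1 := hpre
        simp only [List.length_append, List.length_cons] at l1
        rw [e1]
        refine add_mem (add_mem ?_ (Submodule.smul_mem _ _ ?_)) ?_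
        · rw [← s1]
          exact ihs _ (by simp; omega) k x hx
        · rw [← s2]
          exact ih _ (by simp; omega) k x hx
        · split_ifs with hra
          · have s3 : (pre ++ suf).sum = (pre ++ r :: a :: suf).sum := by
              simp only [List.sum_append, List.sum_cons]
              rw [← add_assoc r a, hra, zero_add]
            rw [← s3]
            exact ih _ (by simp; omega) k _ (hh r k x hx)
          · exact zero_mem _
    intro l hl k x hx
    cases l with
    | nil => simpa [Tgt] using hx
    | cons r l =>
      by_cases hr : 0 ≤ b.repr r 0
      · exact key r hr l [] hl k x hx
      -- A leading letter of negative level: if the total level is still nonnegative, the tail has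
      -- positive level and already kills x.
      · have IH := ih l (by simpa using hl) k x hx
        by_cases hl0 : 0 ≤ b.repr (r :: l).sum 0
        · have : 0 < b.repr l.sum 0 := by
            simp only [List.sum_cons, map_add, Finsupp.add_apply] at hl0
            omega
          have : act V l x = 0 := by simpa [Tgt, this] using IH
          rw [act_cons, this, lie_zero]
          exact zero_mem _
        · have : Tgt (r :: l).sum k = ⊤ := by
            simp only [Tgt]
            rw [if_neg (by omega), if_neg (by omega)]
          rw [this]
          trivial

end Words

/-! ## Twisting by an additive function -/

/-- The functions `A → V`; an element `D(r)` acts through `V` and shifts the argument by `φ r`. -/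
def Twist {A : Type*} [AddCommGroup A] (_φ : Gam →+ A) (V : Type*) : Type _ := A → V

section Twist

variable {A : Type*} [AddCommGroup A] (φ : Gam →+ A)
variable (V : Type*) [AddCommGroup V] [Module ℂ V] [LieRingModule L V] [LieModule ℂ L V]

instance : AddCommGroup (Twist φ V) := inferInstanceAs (AddCommGroup (A → V))

instance : Module ℂ (Twist φ V) := inferInstanceAs (Module ℂ (A → V))

/-- The operator `f ↦ (a ↦ x f(a - c))`. -/
def shiftOp (x : L) (c : A) : Module.End ℂ (Twist φ V) where
  toFun f := fun a => ⁅x, f (a - c)⁆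
  map_add' f g := by
    funext a
    exact lie_add x (f (a - c)) (g (a - c))
  map_smul' t f := by
    funext a
    exact lie_smul t x (f (a - c))

theorem shiftOp_apply (x : L) (c : A) (f : Twist φ V) (a : A) :
    shiftOp φ V x c f a = ⁅x, f (a - c)⁆ := rfl

theorem shiftOp_comm (x y : L) (c d : A) : shiftOp φ V x c * shiftOp φ V y d -
    shiftOp φ V y d * shiftOp φ V x c = shiftOp φ V ⁅x, y⁆ (c + d) := by
  refine LinearMap.ext fun f => funext fun a => ?_
  change ⁅x, ⁅y, f (a - c - d)⁆⁆ - ⁅y, ⁅x, f (a - d - c)⁆⁆ = ⁅⁅x, y⁆, f (a - (c + d))⁆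
  rw [lie_lie, sub_sub, sub_sub, add_comm d c]

theorem shiftOp_add (x y : L) (c : A) :
    shiftOp φ V (x + y) c = shiftOp φ V x c + shiftOp φ V y c :=
  LinearMap.ext fun f => funext fun a => add_lie x y (f (a - c))

theorem shiftOp_zsmul (t : ℤ) (x : L) (c : A) :
    shiftOp φ V (t • x) c = t • shiftOp φ V x c := by
  rw [← Int.cast_smul_eq_zsmul ℂ, ← Int.cast_smul_eq_zsmul ℂ]
  exact LinearMap.ext fun f => funext fun a => smul_lie (t : ℂ) x (f (a - c))

theorem shiftOp_zero (c : A) : shiftOp φ V 0 c = 0 :=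
  LinearMap.ext fun f => funext fun a => zero_lie (f (a - c))

/-- The representation of `L` on the twisted functions. -/
def twistRep : L →ₗ⁅ℂ⁆ Module.End ℂ (Twist φ V) :=
  repOfRelations (fun r => shiftOp φ V (D r) (φ r)) (shiftOp φ V c₁ 0) (shiftOp φ V c₂ 0)
    (by simp [shiftOp_zero])
    (by
      intro m n
      rw [shiftOp_comm, lie_D_D, shiftOp_add, shiftOp_zsmul, map_add]
      congr 1
      split_ifs with hmn
      · rw [← map_add, hmn, map_zero, h, shiftOp_add, shiftOp_zsmul, shiftOp_zsmul]
      · rw [shiftOp_zero])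
    (fun m => by rw [← sub_eq_zero, shiftOp_comm, D_lie_c₁, shiftOp_zero])
    (fun m => by rw [← sub_eq_zero, shiftOp_comm, D_lie_c₂, shiftOp_zero])
    (by rw [← sub_eq_zero, shiftOp_comm, c₁_lie, shiftOp_zero])

instance : LieRingModule L (Twist φ V) := LieRingModule.compLieHom (Twist φ V) (twistRep φ V)

instance : LieModule ℂ L (Twist φ V) := LieModule.compLieHom (Twist φ V) (twistRep φ V)

theorem twist_D_apply (r : Gam) (f : Twist φ V) (a : A) : ⁅D r, f⁆ a = ⁅D r, f (a - φ r)⁆ := by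
  change twistRep φ V (D r) f a = _
  rw [twistRep, repOfRelations_D]
  rfl

theorem twist_c₁_apply (f : Twist φ V) (a : A) : ⁅c₁, f⁆ a = ⁅c₁, f a⁆ := by
  change twistRep φ V c₁ f a = _
  rw [twistRep, repOfRelations_c₁, shiftOp_apply, sub_zero]

theorem twist_c₂_apply (f : Twist φ V) (a : A) : ⁅c₂, f⁆ a = ⁅c₂, f a⁆ := by
  change twistRep φ V c₂ f a = _
  rw [twistRep, repOfRelations_c₂, shiftOp_apply, sub_zero]

end Twist


/-! ## Comparison of irreducible graded modules -/

section Compare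

variable {V : Type*} [AddCommGroup V] [Module ℂ V] [LieRingModule L V] [LieModule ℂ L V]
variable {W : Type*} [AddCommGroup W] [Module ℂ W] [LieRingModule L W] [LieModule ℂ L W]

/-- The linear map that takes a word `l` to `D(l₁) ⋯ D(l_k) v`. -/
def wordMap (v : V) : (List Gam →₀ ℂ) →ₗ[ℂ] V := Finsupp.linearCombination ℂ fun l => act V l v

@[simp] theorem wordMap_single (v : V) (l : List Gam) (c : ℂ) :
    wordMap v (Finsupp.single l c) = c • act V l v := by
  simp [wordMap]

theorem range_wordMap (v : V) : LinearMap.range (wordMap v) = (gen v).toSubmodule :=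
  Finsupp.range_linearCombination ℂ

theorem wordMap_cons (v : V) (r : Gam) (a : List Gam →₀ ℂ) :
    wordMap v (Finsupp.lmapDomain ℂ ℂ (List.cons r) a) = ⁅D r, wordMap v a⁆ := by
  induction a using Finsupp.induction_linear with
  | zero => simp
  | add a a' ha ha' => rw [map_add, map_add, map_add, lie_add, ha, ha']
  | single l c => simp

/-- The part of degree `γ` of a combination of words. -/
def wordPart (γ : Gam) : (List Gam →₀ ℂ) →ₗ[ℂ] (List Gam →₀ ℂ) :=
  Finsupp.lsum ℂ fun l => if l.sum = γ then Finsupp.lsingle l else 0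

theorem wordPart_single (γ : Gam) (l : List Gam) (c : ℂ) :
    wordPart γ (Finsupp.single l c) = if l.sum = γ then Finsupp.single l c else 0 := by
  simp only [wordPart, Finsupp.lsum_single]
  split_ifs <;> rfl

theorem wordMap_part {𝒱 : Gam → Submodule ℂ V} {π : Gam → V →ₗ[ℂ] V} (hπ : GradProj 𝒱 π)
    (hD : ∀ m n, ∀ v ∈ 𝒱 n, ⁅D m, v⁆ ∈ 𝒱 (m + n)) {d : Gam} {v : V} (hv : v ∈ 𝒱 d) (γ : Gam)
    (a : List Gam →₀ ℂ) : wordMap v (wordPart γ a) = π (γ + d) (wordMap v a) := by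
  induction a using Finsupp.induction_linear with
  | zero => simp
  | add a a' ha ha' => simp only [map_add, ha, ha']
  | single l c =>
    rw [wordPart_single, wordMap_single, map_smul]
    split_ifs with hl
    · subst hl
      rw [hπ.same _ _ (act_mem hD l hv), wordMap_single]
    · rw [hπ.ne _ _ _ _ (act_mem hD l hv), map_zero, smul_zero]
      exact fun e => hl (add_right_cancel e).symm

theorem gen_eq_top {𝒱 : Gam → Submodule ℂ V} {π : Gam → V →ₗ[ℂ] V} (hπ : GradProj 𝒱 π)
    (hD : ∀ m n, ∀ v ∈ 𝒱 n, ⁅D m, v⁆ ∈ 𝒱 (m + n))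
    (hirr : ∀ N : LieSubmodule ℂ L V, IsHomogeneous 𝒱 N.toSubmodule → N = ⊥ ∨ N = ⊤)
    {d : Gam} {v : V} (hv : v ∈ 𝒱 d) (hv0 : v ≠ 0) : gen v = ⊤ := by
  refine (hirr _ (gen_homogeneous hπ fun l => act_mem hD l hv)).resolve_left fun H => hv0 ?_
  have := self_mem_gen v
  rw [H] at this
  simpa using this

theorem component_eq_span {𝒱 : Gam → Submodule ℂ V} {π : Gam → V →ₗ[ℂ] V} (hπ : GradProj 𝒱 π)
    (hD : ∀ m n, ∀ v ∈ 𝒱 n, ⁅D m, v⁆ ∈ 𝒱 (m + n)) {d : Gam} {v : V} (hv : v ∈ 𝒱 d)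
    (htop : gen v = ⊤) (γ : Gam) :
    𝒱 (γ + d) = Submodule.span ℂ {y | ∃ l : List Gam, l.sum = γ ∧ y = act V l v} := by
  refine le_antisymm (fun x hx => ?_) (Submodule.span_le.2 ?_)
  · have := gen_proj_mem hπ (fun l => act_mem hD l hv) (x := x) (by rw [htop]; trivial) (γ + d)
    rw [hπ.same _ _ hx] at this
    simpa using this
  · rintro _ ⟨l, rfl, rfl⟩
    exact act_mem hD l hv

/-- The relations of v, applied to w, form a graded submodule of W. If it were all of W, some
relation of v would produce w; its degree zero part acts by one scalar c on both vectors, so c v = 0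
while c w = w. By irreducibility it is therefore zero. -/
theorem ker_wordMap_le {𝒱 : Gam → Submodule ℂ V} {π : Gam → V →ₗ[ℂ] V} (hπ : GradProj 𝒱 π)
    (hD : ∀ m n, ∀ v ∈ 𝒱 n, ⁅D m, v⁆ ∈ 𝒱 (m + n))
    {𝒲 : Gam → Submodule ℂ W} {ρ : Gam → W →ₗ[ℂ] W} (hρ : GradProj 𝒲 ρ)
    (hD' : ∀ m n, ∀ v ∈ 𝒲 n, ⁅D m, v⁆ ∈ 𝒲 (m + n))
    (hirr : ∀ N : LieSubmodule ℂ L W, IsHomogeneous 𝒲 N.toSubmodule → N = ⊥ ∨ N = ⊤)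
    {d d' : Gam} {v : V} {w : W} (hv : v ∈ 𝒱 d) (hw : w ∈ 𝒲 d') (hv0 : v ≠ 0) (hw0 : w ≠ 0)
    (hχ : ∀ l : List Gam, l.sum = 0 → ∃ c : ℂ, act V l v = c • v ∧ act W l w = c • w) :
    LinearMap.ker (wordMap v) ≤ LinearMap.ker (wordMap w) := by
  have hχ' : ∀ a, ∃ c : ℂ, wordMap v (wordPart 0 a) = c • v ∧ wordMap w (wordPart 0 a) = c • w := by
    intro a
    induction a using Finsupp.induction_linear with
    | zero => exact ⟨0, by simp⟩
    | add a a' ha ha' =>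
      obtain ⟨c, h1, h2⟩ := ha
      obtain ⟨c', h1', h2'⟩ := ha'
      exact ⟨c + c', by simp only [map_add, h1, h1', add_smul],
        by simp only [map_add, h2, h2', add_smul]⟩
    | single l c =>
      rw [wordPart_single]
      split_ifs with hl
      · obtain ⟨t, h1, h2⟩ := hχ l hl
        exact ⟨c * t, by simp [h1, mul_smul], by simp [h2, mul_smul]⟩
      · exact ⟨0, by simp⟩
  let N : LieSubmodule ℂ L W := lieSubOfD ((LinearMap.ker (wordMap v)).map (wordMap w)) (by
    rintro r _ ⟨a, ha, rfl⟩
    refine ⟨Finsupp.lmapDomain ℂ ℂ (List.cons r) a, ?_, wordMap_cons w r a⟩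
    have ha' : wordMap v a = 0 := ha
    change wordMap v _ = 0
    rw [wordMap_cons, ha', lie_zero])
  have hN : IsHomogeneous 𝒲 N.toSubmodule := by
    refine hρ.isHomogeneous ?_
    rintro γ _ ⟨a, ha, rfl⟩
    have ha' : wordMap v a = 0 := ha
    refine ⟨wordPart (γ - d') a, ?_, ?_⟩
    · change wordMap v _ = 0
      rw [wordMap_part hπ hD hv, ha', map_zero]
    · rw [wordMap_part hρ hD' hw, sub_add_cancel]
  rcases hirr N hN with H | H
  · intro a ha
    have : wordMap w a ∈ N := ⟨a, ha, rfl⟩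
    rw [H] at this
    simpa using this
  · have : w ∈ N := by rw [H]; trivial
    obtain ⟨a, ha, haw⟩ := this
    have ha' : wordMap v a = 0 := ha
    obtain ⟨c, h1, h2⟩ := hχ' a
    rw [wordMap_part hπ hD hv, ha', map_zero] at h1
    rw [wordMap_part hρ hD' hw, haw, zero_add, hρ.same _ _ hw] at h2
    rcases smul_eq_zero.1 h1.symm with h0 | h0
    · rw [h0, zero_smul] at h2; exact absurd h2 hw0
    · exact absurd h0 hv0

/-- Two irreducible graded modules with homogeneous vectors on which the products of degree zero
act by the same scalars are isomorphic. -/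
theorem exists_graded_equiv {𝒱 : Gam → Submodule ℂ V} {π : Gam → V →ₗ[ℂ] V} (hπ : GradProj 𝒱 π)
    (hD : ∀ m n, ∀ v ∈ 𝒱 n, ⁅D m, v⁆ ∈ 𝒱 (m + n))
    (hirrV : ∀ N : LieSubmodule ℂ L V, IsHomogeneous 𝒱 N.toSubmodule → N = ⊥ ∨ N = ⊤)
    {𝒲 : Gam → Submodule ℂ W} {ρ : Gam → W →ₗ[ℂ] W} (hρ : GradProj 𝒲 ρ)
    (hD' : ∀ m n, ∀ v ∈ 𝒲 n, ⁅D m, v⁆ ∈ 𝒲 (m + n))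
    (hirrW : ∀ N : LieSubmodule ℂ L W, IsHomogeneous 𝒲 N.toSubmodule → N = ⊥ ∨ N = ⊤)
    {d d' : Gam} {v : V} {w : W} (hv : v ∈ 𝒱 d) (hw : w ∈ 𝒲 d') (hv0 : v ≠ 0) (hw0 : w ≠ 0)
    (hχ : ∀ l : List Gam, l.sum = 0 → ∃ c : ℂ, act V l v = c • v ∧ act W l w = c • w) :
    ∃ e : V ≃ₗ⁅ℂ,L⁆ W, ∀ γ, (𝒱 γ).map e.toLinearEquiv.toLinearMap = 𝒲 (γ + (d' - d)) := by
  have hker : LinearMap.ker (wordMap v) = LinearMap.ker (wordMap w) :=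
    le_antisymm (ker_wordMap_le hπ hD hρ hD' hirrW hv hw hv0 hw0 hχ)
      (ker_wordMap_le hρ hD' hπ hD hirrV hw hv hw0 hv0 fun l hl =>
        let ⟨c, h1, h2⟩ := hχ l hl; ⟨c, h2, h1⟩)
  have tV := gen_eq_top hπ hD hirrV hv hv0
  have tW := gen_eq_top hρ hD' hirrW hw hw0
  have sV : Function.Surjective (wordMap v) := by
    rw [← LinearMap.range_eq_top, range_wordMap, tV]; rfl
  have sW : Function.Surjective (wordMap w) := by
    rw [← LinearMap.range_eq_top, range_wordMap, tW]; rfl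
  let e : V ≃ₗ[ℂ] W := ((wordMap v).quotKerEquivOfSurjective sV).symm ≪≫ₗ
    Submodule.quotEquivOfEq _ _ hker ≪≫ₗ (wordMap w).quotKerEquivOfSurjective sW
  have he : ∀ a, e (wordMap v a) = wordMap w a := by
    intro a
    have : ((wordMap v).quotKerEquivOfSurjective sV).symm (wordMap v a) =
        (LinearMap.ker (wordMap v)).mkQ a := by
      rw [LinearEquiv.symm_apply_eq]; rfl
    simp only [e, LinearEquiv.trans_apply, this]
    rfl
  have heD : ∀ r x, e ⁅D r, x⁆ = ⁅D r, e x⁆ := by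
    intro r x
    obtain ⟨a, rfl⟩ := sV x
    rw [← wordMap_cons, he, he, wordMap_cons]
  refine ⟨{ e with map_lie' := fun {x y} => map_lie_of_D e.toLinearMap heD x y }, fun γ => ?_⟩
  have key := component_eq_span hπ hD hv tV (γ - d)
  have key' := component_eq_span hρ hD' hw tW (γ - d)
  rw [sub_add_cancel] at key
  have e1 : γ + (d' - d) = γ - d + d' := by abel
  change (𝒱 γ).map e.toLinearMap = _
  rw [e1, key', key, Submodule.map_span]
  congr 1
  ext y
  constructor
  · rintro ⟨_, ⟨l, hl, rfl⟩, rfl⟩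
    refine ⟨l, hl, ?_⟩
    simpa using he (Finsupp.single l 1)
  · rintro ⟨l, hl, rfl⟩
    refine ⟨_, ⟨l, hl, rfl⟩, ?_⟩
    simpa using he (Finsupp.single l 1)

end Compare


/-! ## Modules over the enveloping algebra -/

section Enveloping

local notation "ιU" => UniversalEnvelopingAlgebra.ι ℂ (L := L)

/-- The action of `L` on a module over its enveloping algebra. -/
@[reducible] def lieRingModuleOfU (M : Type*) [AddCommGroup M] [Module U M] : LieRingModule L M where
  bracket x v := ιU x • v
  add_lie x y v := by
    change ιU (x + y) • v = _
    rw [map_add, add_smul]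
  lie_add x v w := smul_add _ v w
  leibniz_lie x y v := by
    change ιU x • ιU y • v = ιU ⁅x, y⁆ • v + ιU y • ιU x • v
    rw [LieHom.map_lie, LieRing.of_associative_ring_bracket, sub_smul, mul_smul, mul_smul,
      sub_add_cancel]

instance : LieRingModule L U := lieRingModuleOfU U

theorem lie_U_def (x : L) (u : U) : ⁅x, u⁆ = ιU x * u := rfl

instance : LieModule ℂ L U where
  smul_lie t x v := by simp only [lie_U_def, map_smul, smul_mul_assoc]
  lie_smul t x v := by simp only [lie_U_def, mul_smul_comm]

/-- A subspace of a `U(L)`-module stable under `L` is stable under `U(L)`. -/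
theorem smul_mem_of_iota {M : Type*} [AddCommGroup M] [Module ℂ M] [Module U M]
    [IsScalarTower ℂ U M] {N : Submodule ℂ M} (hN : ∀ x : L, ∀ v ∈ N, ιU x • v ∈ N) (u : U) {v : M}
    (hv : v ∈ N) : u • v ∈ N := by
  let S : Subalgebra ℂ U :=
    { carrier := {u | ∀ v ∈ N, u • v ∈ N}
      mul_mem' := fun ha hb v hv => by rw [mul_smul]; exact ha _ (hb _ hv)
      add_mem' := fun ha hb v hv => by rw [add_smul]; exact add_mem (ha _ hv) (hb _ hv)
      algebraMap_mem' := fun t v hv => by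
        rw [algebraMap_smul]; exact N.smul_mem t hv }
  let f : L →ₗ⁅ℂ⁆ S :=
    { toFun := fun x => ⟨ιU x, fun v hv => hN x v hv⟩
      map_add' := fun x y => Subtype.ext (map_add _ x y)
      map_smul' := fun t x => Subtype.ext (map_smul _ t x)
      map_lie' := fun {x y} => Subtype.ext (LieHom.map_lie ιU x y) }
  -- By the universal property, the lift of L into the stabilizer subalgebra `S` splits the
  -- inclusion, so `S` is all of U(L).
  have : S.val.comp (UniversalEnvelopingAlgebra.lift ℂ f) = AlgHom.id ℂ U := by
    refine UniversalEnvelopingAlgebra.hom_ext (h := LieHom.ext fun x => ?_)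
    change ((UniversalEnvelopingAlgebra.lift ℂ f (ιU x) : S) : U) = ιU x
    rw [UniversalEnvelopingAlgebra.lift_ι_apply]
    rfl
  have hu := congrArg (fun g => g u) this
  have hu' : ((UniversalEnvelopingAlgebra.lift ℂ f u : S) : U) = u := hu
  rw [← hu']
  exact (UniversalEnvelopingAlgebra.lift ℂ f u).2 v hv

theorem gen_one : gen (1 : U) = ⊤ := by
  refine eq_top_iff.2 fun u _ => ?_
  have := smul_mem_of_iota (N := (gen (1 : U)).toSubmodule)
    (fun x v hv => (gen (1 : U)).lie_mem (x := x) hv) u (self_mem_gen 1)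
  simpa using this

theorem act_U (l : List Gam) : act U l 1 = (l.map fun r => ιU (D r)).prod := by
  induction l with
  | nil => rfl
  | cons r l ih => rw [act_cons, ih, List.map_cons, List.prod_cons, lie_U_def]

variable (b : Module.Basis (Fin 2) ℤ Gam)

/-- The level `r ↦ r₁` for `r = r₁ b₁ + r₂ b₂`. -/
def lvl : Gam →+ ℤ where
  toFun r := b.repr r 0
  map_zero' := by simp
  map_add' := by simp

theorem lvl_sum (l : List Gam) : (l.map fun r => b.repr r 0).sum = b.repr l.sum 0 :=
  (map_list_sum (lvl b) l).symm

theorem uDeg_eq (m : ℤ) :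
    uDeg b m = Submodule.span ℂ {x | ∃ l : List Gam, b.repr l.sum 0 = m ∧ x = act U l 1} := by
  simp only [uDeg, lvl_sum, act_U]

theorem act_mem_uDeg (l : List Gam) : act U l 1 ∈ uDeg b (b.repr l.sum 0) := by
  rw [uDeg_eq]
  exact Submodule.subset_span ⟨l, rfl, rfl⟩

open Classical in
/-- The projections onto the components of `U(L)`. -/
def uProj (m : ℤ) : U →ₗ[ℂ] U :=
  -- U(L) acts on functions ℤ → U(L), with D(r) moving the support by the level of r. Applying u to
  -- the function with value 1 at 0 and evaluating at m reads off the component of degree m.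
  (LinearMap.proj m : (ℤ → U) →ₗ[ℂ] U) ∘ₗ (LinearMap.applyₗ (R := ℂ) (M := Twist (lvl b) U)
    (M₂ := Twist (lvl b) U) (Pi.single 0 1 : ℤ → U)) ∘ₗ
    (UniversalEnvelopingAlgebra.lift ℂ (twistRep (lvl b) U)).toLinearMap

theorem uProj_one (m : ℤ) : uProj b m 1 = if m = 0 then 1 else 0 := by
  change (UniversalEnvelopingAlgebra.lift ℂ (twistRep (lvl b) U) 1) (Pi.single 0 1 : ℤ → U) m = _
  rw [map_one]
  change (Pi.single 0 1 : ℤ → U) m = _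
  by_cases hm : m = 0
  · subst hm; simp
  · simp [hm]

theorem uProj_lie (r : Gam) (u : U) (m : ℤ) :
    uProj b m ⁅D r, u⁆ = ⁅D r, uProj b (m - b.repr r 0) u⁆ := by
  change (UniversalEnvelopingAlgebra.lift ℂ (twistRep (lvl b) U) (ιU (D r) * u))
    (Pi.single 0 1 : ℤ → U) m = _
  rw [map_mul, UniversalEnvelopingAlgebra.lift_ι_apply]
  exact twist_D_apply (lvl b) U r _ m

theorem uProj_act (l : List Gam) (m : ℤ) :
    uProj b m (act U l 1) = if m = b.repr l.sum 0 then act U l 1 else 0 := by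
  induction l generalizing m with
  | nil => simp [uProj_one]
  | cons r l ih =>
    rw [act_cons, uProj_lie, ih, List.sum_cons, map_add, Finsupp.add_apply]
    by_cases hm : m = b.repr r 0 + b.repr l.sum 0
    · rw [if_pos (by omega), if_pos hm]
    · rw [if_neg (by omega), if_neg hm, lie_zero]

theorem uDeg_gradProj : GradProj (uDeg b) (uProj b) := by
  refine ⟨fun m x hx => ?_, fun m n hmn x hx => ?_, ?_⟩
  · rw [uDeg_eq] at hx
    induction hx using Submodule.span_induction with
    | mem x hx =>
      obtain ⟨l, rfl, rfl⟩ := hx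
      rw [uProj_act, if_pos rfl]
    | zero => simp
    | add x y _ _ hx hy => rw [map_add, hx, hy]
    | smul a x _ hx => rw [map_smul, hx]
  · rw [uDeg_eq] at hx
    induction hx using Submodule.span_induction with
    | mem x hx =>
      obtain ⟨l, rfl, rfl⟩ := hx
      rw [uProj_act, if_neg hmn]
    | zero => simp
    | add x y _ _ hx hy => rw [map_add, hx, hy, add_zero]
    | smul a x _ hx => rw [map_smul, hx, smul_zero]
  · refine eq_top_iff.2 fun u _ => ?_
    have hu : u ∈ gen (1 : U) := by rw [gen_one]; trivial
    refine Submodule.span_le.2 ?_ hu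
    rintro _ ⟨l, rfl⟩
    exact Submodule.mem_iSup_of_mem _ (act_mem_uDeg b l)

end Enveloping

/-! ## The highest weight modules -/

section Highest

local notation "ιU" => UniversalEnvelopingAlgebra.ι ℂ (L := L)

variable (b : Module.Basis (Fin 2) ℤ Gam) (ψ : L0 b →ₗ[ℂ] ℂ)

theorem repr_eq (r : Gam) : r = b.repr r 0 • b 0 + b.repr r 1 • b 1 := by
  have := b.sum_repr r
  rw [Fin.sum_univ_two] at this
  exact this.symm

theorem repr_comb_zero (i j : ℤ) : b.repr (i • b 0 + j • b 1) 0 = i := by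
  rw [map_add, map_zsmul, map_zsmul, b.repr_self, b.repr_self]
  simp

theorem repr_comb_one (i j : ℤ) : b.repr (i • b 0 + j • b 1) 1 = j := by
  rw [map_add, map_zsmul, map_zsmul, b.repr_self, b.repr_self]
  simp

theorem repr_smul_zero (j : ℤ) : b.repr (j • b 1) 0 = 0 := by
  simpa using repr_comb_zero b 0 j

theorem repr_smul_one (j : ℤ) : b.repr (j • b 1) 1 = j := by
  simpa using repr_comb_one b 0 j

theorem D_mem_Lgr (r : Gam) : D r ∈ Lgr b (b.repr r 0) :=
  Submodule.mem_sup_left (Submodule.subset_span ⟨b.repr r 1, congrArg D (repr_eq b r).symm⟩)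

/-- A linear condition on `L₀` holds if it holds for the `D(k b₂)` and the center. -/
theorem L0_induction {P : Submodule ℂ L} (hD : ∀ k : ℤ, D (k • b 1) ∈ P) (h1 : c₁ ∈ P)
    (h2 : c₂ ∈ P) : L0 b ≤ P := by
  refine sup_le (Submodule.span_le.2 ?_) ?_
  · rintro _ ⟨m, rfl⟩
    simpa using hD m
  · rw [if_pos rfl, Submodule.span_le]
    rintro _ (rfl | rfl)
    · exact h1
    · exact h2

theorem iota_mem_uDeg_zero {x : L} (hx : x ∈ L0 b) : ιU x ∈ uDeg b 0 := by
  have hl : ∀ l : List Gam, b.repr l.sum 0 = 0 → act U l 1 ∈ uDeg b 0 := fun l hl => by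
    have := act_mem_uDeg b l
    rwa [hl] at this
  have e : ∀ x : L, ιU x = ⁅x, (1 : U)⁆ := fun x => by rw [lie_U_def, mul_one]
  refine L0_induction b (P := (uDeg b 0).comap (ιU : L →ₗ[ℂ] U)) (fun k => ?_) ?_ ?_ hx
  · have := hl [k • b 1] (by rw [List.sum_singleton, repr_smul_zero])
    rwa [act_cons, act_nil, ← e] at this
  · change ιU c₁ ∈ uDeg b 0
    rw [e, c₁_lie_eq]
    refine sub_mem (hl [(1, 0), (-1, 0)] ?_) (hl [(-1, 0), (1, 0)] ?_)
    all_goals simp only [List.sum_cons, List.sum_nil, Prod.mk_add_mk, add_zero, add_neg_cancel,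
      neg_add_cancel, Prod.mk_zero_zero, map_zero, Finsupp.zero_apply]
  · change ιU c₂ ∈ uDeg b 0
    rw [e, c₂_lie_eq]
    refine sub_mem (hl [(0, 1), (0, -1)] ?_) (hl [(0, -1), (0, 1)] ?_)
    all_goals simp only [List.sum_cons, List.sum_nil, Prod.mk_add_mk, add_zero, add_neg_cancel,
      neg_add_cancel, Prod.mk_zero_zero, map_zero, Finsupp.zero_apply]

theorem one_mem_uDeg_zero : (1 : U) ∈ uDeg b 0 := by
  have := act_mem_uDeg b []
  simpa using this

/-- The generators are homogeneous, and the elements all of whose components lie in the ideal are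
stable under left multiplication, since D(r) only shifts degrees. -/
theorem vermaIdeal_homogeneous :
    IsHomogeneous (uDeg b) ((vermaIdeal b ψ).restrictScalars ℂ) := by
  have hp := uDeg_gradProj b
  let N : Submodule ℂ U :=
    { carrier := {u | ∀ m, uProj b m u ∈ vermaIdeal b ψ}
      add_mem' := fun hx hy m => by rw [map_add]; exact add_mem (hx m) (hy m)
      zero_mem' := fun m => by rw [map_zero]; exact zero_mem _
      smul_mem' := fun t x hx m => by
        rw [map_smul]; exact ((vermaIdeal b ψ).restrictScalars ℂ).smul_mem t (hx m) }
  have hN : ∀ r, ∀ u ∈ N, ⁅D r, u⁆ ∈ N := fun r u hu m => by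
    rw [uProj_lie, lie_U_def, ← smul_eq_mul]
    exact Submodule.smul_mem _ _ (hu _)
  have hU : ∀ u : U, ∀ x ∈ N, u • x ∈ N := fun u x hx =>
    smul_mem_of_iota (fun x v hv => lie_mem_of_D hN x hv) u hx
  refine hp.isHomogeneous fun m x hx => ?_
  suffices H : x ∈ N from H m
  change x ∈ Submodule.span U _ at hx
  have hom : ∀ y ∈ vermaIdeal b ψ, ∀ j, y ∈ uDeg b j → y ∈ N := by
    intro y hy j hj m
    by_cases hm : m = j
    · subst hm; rwa [hp.same _ _ hj]
    · rw [hp.ne _ _ hm _ hj]; exact zero_mem _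
  induction hx using Submodule.span_induction with
  | mem y hy =>
    have hy' : y ∈ vermaIdeal b ψ := Submodule.subset_span hy
    rcases hy with ⟨j, hj, x, hx, rfl⟩ | ⟨x, rfl⟩
    · refine hom _ hy' j ?_
      rw [Lgr, if_neg hj.ne', sup_bot_eq] at hx
      refine (Submodule.span_le (p := (uDeg b j).comap (ιU : L →ₗ[ℂ] U))).2 ?_ hx
      rintro _ ⟨m, rfl⟩
      have := act_mem_uDeg b [j • b 0 + m • b 1]
      rwa [act_cons, act_nil, lie_U_def, mul_one, List.sum_singleton, repr_comb_zero] at this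
    · refine hom _ hy' 0 (sub_mem (iota_mem_uDeg_zero b x.2) ?_)
      rw [Algebra.algebraMap_eq_smul_one]
      exact Submodule.smul_mem _ _ (one_mem_uDeg_zero b)
  | zero => exact zero_mem _
  | add x y _ _ hx hy => exact add_mem hx hy
  | smul u x _ hx => exact hU u x hx

instance : LieRingModule L (Verma b ψ) := lieRingModuleOfU _

theorem lie_verma_def (x : L) (v : Verma b ψ) : ⁅x, v⁆ = ιU x • v := rfl

instance : LieModule ℂ L (Verma b ψ) where
  smul_lie t x v := by rw [lie_verma_def, lie_verma_def, map_smul, smul_assoc]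
  lie_smul t x v := by rw [lie_verma_def, lie_verma_def, smul_comm]

/-- The generator of the induced module. -/
def vermaVac : Verma b ψ := (vermaIdeal b ψ).mkQ 1

theorem act_vermaVac (l : List Gam) :
    act (Verma b ψ) l (vermaVac b ψ) = (vermaIdeal b ψ).mkQ (act U l 1) :=
  (map_act ((vermaIdeal b ψ).mkQ.restrictScalars ℂ) (fun _ _ => rfl) l 1).symm

theorem act_vac (l : List Gam) : act (VHat b ψ) l (vac b ψ) = toVHat b ψ (act U l 1) :=
  (map_act ((toVHat b ψ).restrictScalars ℂ) (fun r u => (toVHat b ψ).map_smul (ιU (D r)) u) l 1).symm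

theorem verma_lie_pos {r : Gam} (hr : 0 < b.repr r 0) : ⁅D r, vermaVac b ψ⁆ = 0 := by
  change (vermaIdeal b ψ).mkQ (ιU (D r) * 1) = 0
  rw [mul_one, Submodule.mkQ_apply, Submodule.Quotient.mk_eq_zero]
  exact Submodule.subset_span (Or.inl ⟨_, hr, _, D_mem_Lgr b r, rfl⟩)

theorem verma_lie_L0 (x : L0 b) : ⁅(x : L), vermaVac b ψ⁆ = ψ x • vermaVac b ψ := by
  rw [← sub_eq_zero]
  change (vermaIdeal b ψ).mkQ (ιU (x : L) * 1) - (vermaIdeal b ψ).mkQ (ψ x • 1) = 0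
  rw [← map_sub, mul_one, Submodule.mkQ_apply, Submodule.Quotient.mk_eq_zero,
    ← Algebra.algebraMap_eq_smul_one]
  exact Submodule.subset_span (Or.inr ⟨x, rfl⟩)

theorem vac_lie_pos {r : Gam} (hr : 0 < b.repr r 0) : ⁅D r, vac b ψ⁆ = 0 := by
  change (vermaRadical b ψ).mkQ ⁅D r, vermaVac b ψ⁆ = 0
  rw [verma_lie_pos b ψ hr, map_zero]

theorem vac_lie_L0 (x : L0 b) : ⁅(x : L), vac b ψ⁆ = ψ x • vac b ψ := by
  change (vermaRadical b ψ).mkQ ⁅(x : L), vermaVac b ψ⁆ = _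
  rw [verma_lie_L0]
  exact ((vermaRadical b ψ).mkQ.restrictScalars ℂ).map_smul _ _

theorem eq_smul_of_lvl_zero {r : Gam} (hr : b.repr r 0 = 0) : r = b.repr r 1 • b 1 := by
  have := repr_eq b r
  rwa [hr, zero_smul, zero_add] at this

theorem vac_lie_zero {r : Gam} (hr : b.repr r 0 = 0) :
    ⁅D r, vac b ψ⁆ = ψ (L0.D b (b.repr r 1)) • vac b ψ := by
  have := vac_lie_L0 b ψ (L0.D b (b.repr r 1))
  rw [← this]
  change _ = ⁅D (b.repr r 1 • b 1), vac b ψ⁆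
  rw [← eq_smul_of_lvl_zero b hr]

theorem vac_lie_h (m : Gam) : ⁅h m, vac b ψ⁆ = ψ (L0.h b m) • vac b ψ := vac_lie_L0 b ψ (L0.h b m)

/-- Words of level zero act on a highest weight vector by scalars, words of positive level by
zero. -/
theorem act_highest {M : Type*} [AddCommGroup M] [Module ℂ M] [LieRingModule L M] [LieModule ℂ L M]
    {x : M} (hpos : ∀ r, 0 < b.repr r 0 → ⁅D r, x⁆ = 0)
    (hzero : ∀ r, b.repr r 0 = 0 → ∃ c : ℂ, ⁅D r, x⁆ = c • x) (hh : ∀ m, ∃ c : ℂ, ⁅h m, x⁆ = c • x)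
    (l : List Gam) : (0 < b.repr l.sum 0 → act M l x = 0) ∧
      (b.repr l.sum 0 = 0 → ∃ c : ℂ, act M l x = c • x) := by
  have := act_top b (fun _ => Submodule.span ℂ {x}) ?_ ?_ ?_ l 0 x (Submodule.mem_span_singleton_self x)
  · refine ⟨this.1, fun hl => ?_⟩
    obtain ⟨c, hc⟩ := Submodule.mem_span_singleton.1 (this.2 hl)
    exact ⟨c, hc.symm⟩
  · intro r hr _ y hy
    obtain ⟨c, rfl⟩ := Submodule.mem_span_singleton.1 hy
    rw [lie_smul, hpos r hr, smul_zero]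
  · intro r hr _ y hy
    obtain ⟨c, rfl⟩ := Submodule.mem_span_singleton.1 hy
    obtain ⟨t, ht⟩ := hzero r hr
    rw [lie_smul, ht]
    exact Submodule.smul_mem _ _ (Submodule.smul_mem _ _ (Submodule.mem_span_singleton_self x))
  · intro m _ y hy
    obtain ⟨c, rfl⟩ := Submodule.mem_span_singleton.1 hy
    obtain ⟨t, ht⟩ := hh m
    rw [lie_smul, ht]
    exact Submodule.smul_mem _ _ (Submodule.smul_mem _ _ (Submodule.mem_span_singleton_self x))

theorem vermaDeg_eq (m : ℤ) : vermaDeg b ψ m = Submodule.span ℂ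
    {x | ∃ l : List Gam, b.repr l.sum 0 = m ∧ x = act (Verma b ψ) l (vermaVac b ψ)} := by
  rw [vermaDeg, uDeg_eq, Submodule.map_span]
  congr 1
  ext x
  constructor
  · rintro ⟨_, ⟨l, hl, rfl⟩, rfl⟩
    exact ⟨l, hl, (act_vermaVac b ψ l).symm⟩
  · rintro ⟨l, hl, rfl⟩
    exact ⟨_, ⟨l, hl, rfl⟩, (act_vermaVac b ψ l).symm⟩

theorem vHatDeg_eq (m : ℤ) : vHatDeg b ψ m = Submodule.span ℂ
    {x | ∃ l : List Gam, b.repr l.sum 0 = m ∧ x = act (VHat b ψ) l (vac b ψ)} := by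
  rw [vHatDeg, uDeg_eq, Submodule.map_span]
  congr 1
  ext x
  constructor
  · rintro ⟨_, ⟨l, hl, rfl⟩, rfl⟩
    exact ⟨l, hl, (act_vac b ψ l).symm⟩
  · rintro ⟨l, hl, rfl⟩
    exact ⟨_, ⟨l, hl, rfl⟩, (act_vac b ψ l).symm⟩

theorem vermaDeg_zero_le : vermaDeg b ψ 0 ≤ Submodule.span ℂ {vermaVac b ψ} := by
  rw [vermaDeg_eq, Submodule.span_le]
  rintro _ ⟨l, hl, rfl⟩
  obtain ⟨c, hc⟩ := (act_highest b (fun r hr => verma_lie_pos b ψ hr)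
    (fun r hr => ⟨ψ (L0.D b (b.repr r 1)), by
      rw [← verma_lie_L0]
      change _ = ⁅D (b.repr r 1 • b 1), _⁆
      rw [← eq_smul_of_lvl_zero b hr]⟩)
    (fun m => ⟨ψ (L0.h b m), verma_lie_L0 b ψ (L0.h b m)⟩) l).2 hl
  rw [hc]
  exact Submodule.smul_mem _ _ (Submodule.mem_span_singleton_self _)

/-- The projection of `U(L)` onto the induced module. -/
def toVerma : U →ₗ[ℂ] Verma b ψ := (vermaIdeal b ψ).mkQ.restrictScalars ℂ

theorem toVerma_surjective : Function.Surjective (toVerma b ψ) := fun x => by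
  obtain ⟨u, hu⟩ := Submodule.mkQ_surjective (vermaIdeal b ψ) x
  exact ⟨u, hu⟩

theorem toVerma_eq_zero (u : U) :
    toVerma b ψ u = 0 ↔ u ∈ (vermaIdeal b ψ).restrictScalars ℂ :=
  Submodule.Quotient.mk_eq_zero _

theorem vermaDeg_gradProj : ∃ π, GradProj (vermaDeg b ψ) π := by
  obtain ⟨π, hπ, -⟩ := (uDeg_gradProj b).map (toVerma b ψ) (toVerma_surjective b ψ)
    (toVerma_eq_zero b ψ) (vermaIdeal_homogeneous b ψ)
  exact ⟨π, hπ⟩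

/-- The projection of the induced module onto `V̂⁺(ψ)`. -/
def vermaToVHat : Verma b ψ →ₗ[ℂ] VHat b ψ := (vermaRadical b ψ).mkQ.restrictScalars ℂ

theorem vermaToVHat_surjective : Function.Surjective (vermaToVHat b ψ) :=
  fun x => by
  obtain ⟨u, hu⟩ := Submodule.mkQ_surjective (vermaRadical b ψ) x
  exact ⟨u, hu⟩

theorem vermaToVHat_eq_zero (u : Verma b ψ) :
    vermaToVHat b ψ u = 0 ↔ u ∈ (vermaRadical b ψ).restrictScalars ℂ :=
  Submodule.Quotient.mk_eq_zero _

theorem vermaToVHat_smul (u : U) (v : Verma b ψ) :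
    vermaToVHat b ψ (u • v) = u • vermaToVHat b ψ v :=
  (vermaRadical b ψ).mkQ.map_smul u v

theorem map_vermaDeg (m : ℤ) : (vermaDeg b ψ m).map (vermaToVHat b ψ) = vHatDeg b ψ m := by
  rw [vermaDeg, ← Submodule.map_comp]
  rfl

theorem vermaRadical_eq : (vermaRadical b ψ).restrictScalars ℂ =
    sSup {N' | ∃ N : Submodule U (Verma b ψ), (IsHomogeneous (vermaDeg b ψ) (N.restrictScalars ℂ) ∧
      N ≠ ⊤) ∧ N.restrictScalars ℂ = N'} :=
  map_sSup (Submodule.restrictScalarsLatticeHom ℂ U (Verma b ψ))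
    {N : Submodule U (Verma b ψ) | IsHomogeneous (vermaDeg b ψ) (N.restrictScalars ℂ) ∧ N ≠ ⊤}

theorem vermaRadical_homogeneous :
    IsHomogeneous (vermaDeg b ψ) ((vermaRadical b ψ).restrictScalars ℂ) := by
  rw [vermaRadical_eq]
  refine GradProj.sSup_homogeneous ?_
  rintro _ ⟨N, hN, rfl⟩
  exact hN.1

theorem vermaVac_mem_zero : vermaVac b ψ ∈ vermaDeg b ψ 0 := by
  rw [vermaDeg_eq]
  exact Submodule.subset_span ⟨[], by simp, rfl⟩

/-- Degree 0 is spanned by the generator, so a proper graded submodule meets it trivially; by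
homogeneity the sum of all of them does too. -/
theorem vac_ne_zero (hv : vermaVac b ψ ≠ 0) : vac b ψ ≠ 0 := by
  intro H
  replace H : vermaVac b ψ ∈ vermaRadical b ψ := (Submodule.Quotient.mk_eq_zero _).1 H
  obtain ⟨π, hπ⟩ := vermaDeg_gradProj b ψ
  have key := hπ.sSup_inf_eq_bot 0 (S := {N' | ∃ N : Submodule U (Verma b ψ),
    (IsHomogeneous (vermaDeg b ψ) (N.restrictScalars ℂ) ∧ N ≠ ⊤) ∧ N.restrictScalars ℂ = N'}) (by
    rintro _ ⟨N, hN, rfl⟩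
    refine ⟨hN.1, ?_⟩
    rw [eq_bot_iff]
    rintro x ⟨hx, hx0⟩
    obtain ⟨c, rfl⟩ := Submodule.mem_span_singleton.1 (vermaDeg_zero_le b ψ hx0)
    by_cases hc : c = 0
    · simp [hc]
    · refine absurd ?_ hN.2
      rw [eq_top_iff]
      have h1 : vermaVac b ψ ∈ N := by
        have := (N.restrictScalars ℂ).smul_mem c⁻¹ hx
        rwa [smul_smul, inv_mul_cancel₀ hc, one_smul] at this
      intro y _
      obtain ⟨u, rfl⟩ := Submodule.mkQ_surjective _ y
      have := N.smul_mem u h1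
      rwa [vermaVac, ← map_smul, smul_eq_mul, mul_one] at this)
  rw [← vermaRadical_eq] at key
  have : vermaVac b ψ ∈ (⊥ : Submodule ℂ (Verma b ψ)) := key ▸ ⟨H, vermaVac_mem_zero b ψ⟩
  exact hv (by simpa using this)

/-- The universal property of the induced module: the annihilator of x is a left ideal that contains
the generators of `vermaIdeal`. -/
theorem lift_apply_eq_zero {M : Type*} [AddCommGroup M] [Module ℂ M] [LieRingModule L M]
    [LieModule ℂ L M] {x : M} (hpos : ∀ j : ℤ, 0 < j → ∀ y ∈ Lgr b j, ⁅y, x⁆ = 0)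
    (hzero : ∀ y : L0 b, ⁅(y : L), x⁆ = ψ y • x) {u : U} (hu : u ∈ vermaIdeal b ψ) :
    UniversalEnvelopingAlgebra.lift ℂ (LieModule.toEnd ℂ L M) u x = 0 := by
  let F := UniversalEnvelopingAlgebra.lift ℂ (LieModule.toEnd ℂ L M)
  let N : Submodule U U :=
    { carrier := {u | F u x = 0}
      add_mem' := fun {u v} hu hv => by
        have hu' : F u x = 0 := hu
        have hv' : F v x = 0 := hv
        change F (u + v) x = 0
        rw [map_add, LinearMap.add_apply, hu', hv', add_zero]
      zero_mem' := by
        change F 0 x = 0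
        rw [map_zero, LinearMap.zero_apply]
      smul_mem' := fun u v hv => by
        have hv' : F v x = 0 := hv
        change F (u * v) x = 0
        rw [map_mul, Module.End.mul_apply, hv', map_zero] }
  have hι : ∀ y : L, F (ιU y) x = ⁅y, x⁆ := fun y => by
    simp only [F]
    rw [UniversalEnvelopingAlgebra.lift_ι_apply]
    rfl
  have hle : vermaIdeal b ψ ≤ N := by
    refine Submodule.span_le.2 ?_
    rintro _ (⟨j, hj, y, hy, rfl⟩ | ⟨y, rfl⟩)
    · change F (ιU y) x = 0
      rw [hι, hpos j hj y hy]
    · change F (ιU (y : L) - algebraMap ℂ U (ψ y)) x = 0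
      rw [map_sub, LinearMap.sub_apply, hι, hzero, AlgHom.commutes, Module.algebraMap_end_apply,
        sub_self]
  exact hle hu

/-- The generator of the induced module is nonzero if some `L`-module has a highest weight vector
of weight `ψ`. -/
theorem vermaVac_ne_zero {M : Type*} [AddCommGroup M] [Module ℂ M] [LieRingModule L M]
    [LieModule ℂ L M] {x : M} (hx : x ≠ 0) (hpos : ∀ j : ℤ, 0 < j → ∀ y ∈ Lgr b j, ⁅y, x⁆ = 0)
    (hzero : ∀ y : L0 b, ⁅(y : L), x⁆ = ψ y • x) : vermaVac b ψ ≠ 0 := by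
  intro H
  replace H : (1 : U) ∈ vermaIdeal b ψ := (Submodule.Quotient.mk_eq_zero _).1 H
  have := lift_apply_eq_zero b ψ hpos hzero H
  rw [map_one] at this
  exact hx this

/-- The scalars by which words act on the generator of the induced module are those by which they
act on any highest weight vector. -/
theorem act_eq_smul_of_verma {M : Type*} [AddCommGroup M] [Module ℂ M] [LieRingModule L M]
    [LieModule ℂ L M] {x : M} (hpos : ∀ j : ℤ, 0 < j → ∀ y ∈ Lgr b j, ⁅y, x⁆ = 0)
    (hzero : ∀ y : L0 b, ⁅(y : L), x⁆ = ψ y • x) {l : List Gam} {c : ℂ}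
    (hl : act (Verma b ψ) l (vermaVac b ψ) = c • vermaVac b ψ) : act M l x = c • x := by
  have h1 : act U l 1 - c • (1 : U) ∈ vermaIdeal b ψ := by
    refine (Submodule.Quotient.mk_eq_zero _).1 ?_
    rw [Submodule.Quotient.mk_sub, sub_eq_zero]
    exact (act_vermaVac b ψ l).symm.trans hl
  have h2 := lift_apply_eq_zero b ψ hpos hzero h1
  have h3 : ∀ l : List Gam,
      UniversalEnvelopingAlgebra.lift ℂ (LieModule.toEnd ℂ L M) (act U l 1) x = act M l x := by
    intro l
    induction l with
    | nil =>
      change UniversalEnvelopingAlgebra.lift ℂ (LieModule.toEnd ℂ L M) 1 x = x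
      rw [map_one]
      rfl
    | cons r l ih =>
      rw [act_cons, act_cons, lie_U_def, map_mul, Module.End.mul_apply, ih,
        UniversalEnvelopingAlgebra.lift_ι_apply]
      rfl
  rw [map_sub, LinearMap.sub_apply, map_smul, LinearMap.smul_apply, h3, map_one,
    Module.End.one_apply, sub_eq_zero] at h2
  exact h2

theorem vHatDeg_gradProj_aux {π : ℤ → Verma b ψ →ₗ[ℂ] Verma b ψ}
    (hπ : GradProj (vermaDeg b ψ) π) : ∃ π', GradProj (vHatDeg b ψ) π' ∧
      ∀ i x, π' i (vermaToVHat b ψ x) = vermaToVHat b ψ (π i x) := by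
  have := hπ.map (vermaToVHat b ψ) (vermaToVHat_surjective b ψ) (vermaToVHat_eq_zero b ψ)
    (vermaRadical_homogeneous b ψ)
  simpa only [map_vermaDeg] using this

theorem vHatDeg_gradProj : ∃ π, GradProj (vHatDeg b ψ) π := by
  obtain ⟨π, hπ⟩ := vermaDeg_gradProj b ψ
  obtain ⟨π', hπ', -⟩ := vHatDeg_gradProj_aux b ψ hπ
  exact ⟨π', hπ'⟩

theorem gen_vac : gen (vac b ψ) = ⊤ := by
  refine eq_top_iff.2 fun x _ => ?_
  have hs : Function.Surjective (toVHat b ψ) :=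
    (Submodule.mkQ_surjective (vermaRadical b ψ)).comp (Submodule.mkQ_surjective (vermaIdeal b ψ))
  obtain ⟨u, rfl⟩ := hs x
  have hu : u ∈ (gen (1 : U)).toSubmodule := by rw [gen_one]; trivial
  refine (Submodule.span_le (p := (gen (vac b ψ)).toSubmodule.comap
    ((toVHat b ψ).restrictScalars ℂ))).2 ?_ hu
  rintro _ ⟨l, rfl⟩
  change toVHat b ψ (act U l 1) ∈ (gen (vac b ψ)).toSubmodule
  rw [← act_vac]
  exact act_mem_gen l _

/-- `V̂⁺(ψ)` is irreducible as a `ℤ`-graded module. -/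
theorem vHat_irreducible (N : LieSubmodule ℂ L (VHat b ψ))
    (hN : IsHomogeneous (vHatDeg b ψ) N.toSubmodule) : N = ⊥ ∨ N = ⊤ := by
  obtain ⟨π, hπ⟩ := vermaDeg_gradProj b ψ
  obtain ⟨π', hπ', hc⟩ := vHatDeg_gradProj_aux b ψ hπ
  let N' : Submodule U (Verma b ψ) :=
    { N.toSubmodule.comap (vermaToVHat b ψ) with
      smul_mem' := fun u v hv => by
        change vermaToVHat b ψ (u • v) ∈ N.toSubmodule
        rw [vermaToVHat_smul]
        exact smul_mem_of_iota (N := N.toSubmodule) (fun x w hw => N.lie_mem (x := x) hw) u hv }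
  have hN' : IsHomogeneous (vermaDeg b ψ) (N'.restrictScalars ℂ) :=
    hπ.comap_homogeneous hπ' hc hN
  by_cases ht : N' = ⊤
  · right
    refine eq_top_iff.2 fun x _ => ?_
    obtain ⟨y, rfl⟩ := vermaToVHat_surjective b ψ x
    have : y ∈ N' := by rw [ht]; trivial
    exact this
  · left
    refine eq_bot_iff.2 fun x hx => ?_
    obtain ⟨y, rfl⟩ := vermaToVHat_surjective b ψ x
    have hy : y ∈ N' := hx
    have hle : N' ≤ vermaRadical b ψ := le_sSup (show N' ∈ {N : Submodule U (Verma b ψ) |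
      IsHomogeneous (vermaDeg b ψ) (N.restrictScalars ℂ) ∧ N ≠ ⊤} from ⟨hN', ht⟩)
    have : y ∈ vermaRadical b ψ := hle hy
    have : vermaToVHat b ψ y = 0 := (vermaToVHat_eq_zero b ψ y).2 this
    rw [this]
    exact zero_mem _

theorem vac_highest (l : List Gam) : (0 < b.repr l.sum 0 → act (VHat b ψ) l (vac b ψ) = 0) ∧
    (b.repr l.sum 0 = 0 → ∃ c : ℂ, act (VHat b ψ) l (vac b ψ) = c • vac b ψ) :=
  act_highest b (fun _ hr => vac_lie_pos b ψ hr) (fun _ hr => ⟨_, vac_lie_zero b ψ hr⟩)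
    (fun m => ⟨_, vac_lie_h b ψ m⟩) l

theorem vac_mem : vac b ψ ∈ vHatDeg b ψ 0 := by
  rw [vHatDeg_eq]
  exact Submodule.subset_span ⟨[], by simp, rfl⟩

theorem vHatDeg_zero : vHatDeg b ψ 0 = Submodule.span ℂ {vac b ψ} := by
  refine le_antisymm ?_ (Submodule.span_le.2 (by simpa using vac_mem b ψ))
  rw [vHatDeg_eq, Submodule.span_le]
  rintro _ ⟨l, hl, rfl⟩
  obtain ⟨c, hc⟩ := (vac_highest b ψ l).2 hl
  rw [hc]
  exact Submodule.smul_mem _ _ (Submodule.mem_span_singleton_self _)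

theorem vHatDeg_pos {m : ℤ} (hm : 0 < m) : vHatDeg b ψ m = ⊥ := by
  rw [vHatDeg_eq, eq_bot_iff, Submodule.span_le]
  rintro _ ⟨l, rfl, rfl⟩
  simpa using (vac_highest b ψ l).1 hm

theorem vHat_lie_mem (r : Gam) (m : ℤ) {v : VHat b ψ} (hv : v ∈ vHatDeg b ψ m) :
    ⁅D r, v⁆ ∈ vHatDeg b ψ (b.repr r 0 + m) := by
  rw [vHatDeg_eq] at hv ⊢
  induction hv using Submodule.span_induction with
  | mem x hx =>
    obtain ⟨l, rfl, rfl⟩ := hx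
    exact Submodule.subset_span ⟨r :: l, by simp, by simp⟩
  | zero => simp
  | add x y _ _ hx hy => rw [lie_add]; exact add_mem hx hy
  | smul a x _ hx => rw [lie_smul]; exact Submodule.smul_mem _ a hx

theorem vHat_act_mem (l : List Gam) (m : ℤ) {v : VHat b ψ} (hv : v ∈ vHatDeg b ψ m) :
    act (VHat b ψ) l v ∈ vHatDeg b ψ (b.repr l.sum 0 + m) := by
  induction l with
  | nil => simpa using hv
  | cons r l ih =>
    rw [act_cons, List.sum_cons, map_add, Finsupp.add_apply, add_assoc]
    exact vHat_lie_mem b ψ r _ ih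

/-- A vector of negative level killed by the `D(r)` of positive level vanishes. -/
theorem vHat_singular {m : ℤ} (hm : m < 0) {w : VHat b ψ} (hw : w ∈ vHatDeg b ψ m)
    (h1 : ∀ r, 0 < b.repr r 0 → ⁅D r, w⁆ = 0) : w = 0 := by
  obtain ⟨π, hπ⟩ := vHatDeg_gradProj b ψ
  have hδ : ∀ l, act (VHat b ψ) l w ∈ vHatDeg b ψ (b.repr l.sum 0 + m) := fun l =>
    vHat_act_mem b ψ l m hw
  rcases vHat_irreducible b ψ (gen w) (gen_homogeneous hπ hδ) with H | H
  · have := self_mem_gen w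
    rw [H] at this
    simpa using this
  -- If w generated everything, v₀ would be a combination of words of level -m > 0 applied to w;
  -- straightening shows that these vanish, so v₀ = 0 and the whole module is zero.
  · have hv : vac b ψ ∈ gen w := by rw [H]; trivial
    have key := gen_proj_mem hπ hδ hv 0
    rw [hπ.same _ _ (vac_mem b ψ)] at key
    have h0 : vac b ψ = 0 := by
      refine (Submodule.mem_bot ℂ).1 ((Submodule.span_le.2 ?_) key)
      rintro _ ⟨l, hl, rfl⟩
      let S : Submodule ℂ (VHat b ψ) :=
        { carrier := {x | ∀ r, 0 < b.repr r 0 → ⁅D r, x⁆ = 0}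
          add_mem' := fun hx hy r hr => by rw [lie_add, hx r hr, hy r hr, add_zero]
          zero_mem' := fun r _ => lie_zero _
          smul_mem' := fun t x hx r hr => by rw [lie_smul, hx r hr, smul_zero] }
      have := act_top b (fun _ => S) (fun r hr _ x hx => hx r hr) (fun r hr _ x hx r' hr' => by
          rw [lie_lie_D, hx r' hr', lie_zero, hx (r' + r) (by simp [hr, hr']), smul_zero, zero_add,
            zero_add, if_neg]
          intro e
          have := congrArg (fun x => b.repr x 0) e
          simp [hr] at this
          omega)
        (fun m' _ x hx r hr => by
          rw [← lie_D_comm (h m') (h_central m'), hx r hr, lie_zero]) l 0 w h1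
      simpa using this.1 (by omega)
    have ht := gen_vac b ψ
    rw [h0] at ht
    have : w ∈ gen (0 : VHat b ψ) := by rw [ht]; trivial
    have hb : gen (0 : VHat b ψ) ≤ ⊥ := gen_le (zero_mem _)
    simpa using hb this

end Highest


/-! ## The modules `V(ψ)` and their quotients -/

section Loop

variable (b : Module.Basis (Fin 2) ℤ Gam) (ψ : L0 b →ₗ[ℂ] ℂ)

/-- The projection of the Laurent polynomials onto the multiples of `t^k`. -/
def laurentProj (k : ℤ) : ℂ[T;T⁻¹] →ₗ[ℂ] ℂ[T;T⁻¹] where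
  toFun f := f.coeff k • LaurentPolynomial.T k
  map_add' f g := by rw [AddMonoidAlgebra.coeff_add, Finsupp.add_apply, add_smul]
  map_smul' t f := by
    rw [AddMonoidAlgebra.coeff_smul_apply, smul_eq_mul, mul_smul, RingHom.id_apply]

theorem laurentProj_T (k j : ℤ) : laurentProj k (LaurentPolynomial.T j) =
    if j = k then LaurentPolynomial.T j else 0 := by
  change (LaurentPolynomial.T j : ℂ[T;T⁻¹]).coeff k • LaurentPolynomial.T k = _
  rw [LaurentPolynomial.T_apply]
  split_ifs with h
  · rw [h, one_smul]
  · rw [zero_smul]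

/-- The projections onto the homogeneous components of `V(ψ)`, given those of `V̂⁺(ψ)`. -/
def vPsiProj (π : ℤ → VHat b ψ →ₗ[ℂ] VHat b ψ) (γ : Gam) : VPsi b ψ →ₗ[ℂ] VPsi b ψ :=
  (ofTensor b ψ).conj (TensorProduct.map (π (b.repr γ 0)) (laurentProj (b.repr γ 1)))

theorem vPsiProj_tmulT (π : ℤ → VHat b ψ →ₗ[ℂ] VHat b ψ) (γ : Gam) (k : ℤ) (v : VHat b ψ) :
    vPsiProj b ψ π γ (tmulT b ψ k v) =
      if k = b.repr γ 1 then tmulT b ψ k (π (b.repr γ 0) v) else 0 := by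
  have : vPsiProj b ψ π γ (tmulT b ψ k v) =
      ofTensor b ψ (π (b.repr γ 0) v ⊗ₜ laurentProj (b.repr γ 1) (LaurentPolynomial.T k)) :=
    congrArg (ofTensor b ψ) (TensorProduct.map_tmul _ _ _ _)
  rw [this, laurentProj_T]
  split_ifs
  · rfl
  · rw [TensorProduct.tmul_zero, map_zero]

theorem eq_of_repr {γ δ : Gam} (h0 : b.repr γ 0 = b.repr δ 0) (h1 : b.repr γ 1 = b.repr δ 1) :
    γ = δ := by
  rw [repr_eq b γ, repr_eq b δ, h0, h1]

/-- A subspace of `V(ψ)` containing all `v ⊗ t^k` is everything. -/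
theorem vPsi_eq_top {N : Submodule ℂ (VPsi b ψ)} (hN : ∀ k v, tmulT b ψ k v ∈ N) : N = ⊤ := by
  refine eq_top_iff.2 fun x _ => ?_
  obtain ⟨y, rfl⟩ := (ofTensor b ψ).surjective x
  induction y using TensorProduct.induction_on with
  | zero => rw [map_zero]; exact zero_mem _
  | add x y hx hy => rw [map_add]; exact add_mem (hx trivial) (hy trivial)
  | tmul v p =>
    induction p using LaurentPolynomial.induction_on' with
    | add p q hp hq =>
      rw [TensorProduct.tmul_add, map_add]
      exact add_mem (hp trivial) (hq trivial)
    | C_mul_T n a =>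
      rw [← LaurentPolynomial.smul_eq_C_mul, TensorProduct.tmul_smul, map_smul]
      exact N.smul_mem a (hN n v)

theorem tmulT_mem_deg {m k : ℤ} {v : VHat b ψ} (hv : v ∈ vHatDeg b ψ m) :
    tmulT b ψ k v ∈ vPsiDeg b ψ (m • b 0 + k • b 1) := by
  rw [vPsiDeg, repr_comb_zero, repr_comb_one]
  exact Submodule.mem_map_of_mem hv

theorem vPsiDeg_gradProj {π : ℤ → VHat b ψ →ₗ[ℂ] VHat b ψ} (hπ : GradProj (vHatDeg b ψ) π) :
    GradProj (vPsiDeg b ψ) (vPsiProj b ψ π) := by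
  refine ⟨?_, ?_, ?_⟩
  · rintro γ _ ⟨v, hv, rfl⟩
    rw [vPsiProj_tmulT, if_pos rfl, hπ.same _ _ hv]
  · rintro γ δ hγδ _ ⟨v, hv, rfl⟩
    rw [vPsiProj_tmulT]
    split_ifs with h1
    · rw [hπ.ne _ _ _ _ hv, map_zero]
      exact fun h0 => hγδ (eq_of_repr b h0 h1.symm)
    · rfl
  · refine vPsi_eq_top b ψ fun k v => ?_
    have hv : v ∈ ⨆ m, vHatDeg b ψ m := hπ.span ▸ Submodule.mem_top
    induction hv using Submodule.iSup_induction' with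
    | mem m v hv => exact Submodule.mem_iSup_of_mem _ (tmulT_mem_deg b ψ hv)
    | zero => rw [map_zero]; exact zero_mem _
    | add x y _ _ hx hy => rw [map_add]; exact add_mem hx hy

theorem vPsi_lie_mem (m n : Gam) (v : VPsi b ψ) (hv : v ∈ vPsiDeg b ψ n) :
    ⁅D m, v⁆ ∈ vPsiDeg b ψ (m + n) := by
  obtain ⟨x, hx, rfl⟩ := hv
  rw [lie_D_tmulT, vPsiDeg, map_add, Finsupp.add_apply, Finsupp.add_apply,
    add_comm (b.repr m 1)]
  exact Submodule.mem_map_of_mem (vHat_lie_mem b ψ m _ hx)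

theorem act_tmulT (l : List Gam) (k : ℤ) (v : VHat b ψ) :
    act (VPsi b ψ) l (tmulT b ψ k v) = tmulT b ψ (k + b.repr l.sum 1) (act (VHat b ψ) l v) := by
  induction l with
  | nil => simp
  | cons r l ih =>
    rw [act_cons, ih, lie_D_tmulT, act_cons, List.sum_cons, map_add, Finsupp.add_apply]
    congr 2
    ring

theorem lie_h_tmulT (m : Gam) (k : ℤ) (v : VHat b ψ) :
    ⁅h m, tmulT b ψ k v⁆ = tmulT b ψ k ⁅h m, v⁆ := by
  rw [h_lie, h_lie, lie_c₁_tmulT, lie_c₂_tmulT, map_add, map_smul, map_smul]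

/-- The vector `v₀ ⊗ t^k`. -/
def vk (k : ℤ) : VPsi b ψ := tmulT b ψ k (vac b ψ)

theorem vk_mem (k : ℤ) : vk b ψ k ∈ vPsiDeg b ψ (k • b 1) := by
  have := tmulT_mem_deg b ψ (k := k) (vac_mem b ψ)
  rwa [zero_smul, zero_add] at this

theorem vPsiDeg_top (k : ℤ) : vPsiDeg b ψ (k • b 1) = Submodule.span ℂ {vk b ψ k} := by
  rw [vPsiDeg, repr_smul_zero, repr_smul_one, vHatDeg_zero, Submodule.map_span, Set.image_singleton]
  rfl

theorem vk_lie_pos {r : Gam} (hr : 0 < b.repr r 0) (k : ℤ) : ⁅D r, vk b ψ k⁆ = 0 := by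
  rw [vk, lie_D_tmulT, vac_lie_pos b ψ hr, map_zero]

theorem vk_lie_zero {r : Gam} (hr : b.repr r 0 = 0) (k : ℤ) :
    ⁅D r, vk b ψ k⁆ = ψ (L0.D b (b.repr r 1)) • vk b ψ (k + b.repr r 1) := by
  rw [vk, lie_D_tmulT, vac_lie_zero b ψ hr, map_smul, vk]

theorem vk_lie_D (j k : ℤ) : ⁅D (j • b 1), vk b ψ k⁆ = ψ (L0.D b j) • vk b ψ (k + j) := by
  rw [vk_lie_zero b ψ (repr_smul_zero b j), repr_smul_one]

theorem vk_lie_h (m : Gam) (k : ℤ) : ⁅h m, vk b ψ k⁆ = ψ (L0.h b m) • vk b ψ k := by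
  rw [vk, lie_h_tmulT, vac_lie_h, map_smul]

/-! ### Weights of products of the D(k b₂), and the step s -/

theorem sum_map_smul (σ : List ℤ) (x : Gam) : (σ.map fun k => k • x).sum = σ.sum • x := by
  induction σ with
  | nil => simp
  | cons k σ ih => simp only [List.map_cons, List.sum_cons, ih, add_smul]

/-- The scalar by which the product of the `D(k b₂)`, `k ∈ σ`, acts. -/
def wt (σ : List ℤ) : ℂ := (σ.map fun k => ψ (L0.D b k)).prod

theorem act_vk (σ : List ℤ) (k : ℤ) : act (VPsi b ψ) (σ.map fun j => j • b 1) (vk b ψ k) =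
    wt b ψ σ • vk b ψ (k + σ.sum) := by
  induction σ with
  | nil => simp [wt]
  | cons j σ ih =>
    rw [List.map_cons, act_cons, ih, lie_smul, vk_lie_D, smul_smul, List.sum_cons]
    congr 1
    · simp [wt, mul_comm]
    · congr 1; ring

/-- The consequences of `HasStep`: the `k` with `ψ(D(k b₂)) ≠ 0` are multiples of `s`, and every
multiple of `s` is a sum of such `k`. -/
def Steps (s : ℕ) : Prop := (∀ k : ℤ, ψ (L0.D b k) ≠ 0 → (s : ℤ) ∣ k) ∧
  ∀ k : ℤ, (s : ℤ) ∣ k → ∃ σ : List ℤ, σ.sum = k ∧ wt b ψ σ ≠ 0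

theorem L0_D_zero : L0.D b 0 = 0 := Subtype.ext (by simp [L0.D])

theorem coeff_mul_ne_zero {f g : ℂ[T;T⁻¹]} {k : ℤ} (hk : (f * g).coeff k ≠ 0) :
    ∃ i j, i + j = k ∧ f.coeff i ≠ 0 ∧ g.coeff j ≠ 0 := by
  by_contra! H
  refine hk ?_
  rw [AddMonoidAlgebra.coeff_mul]
  refine Finset.sum_eq_zero fun i _ => Finset.sum_eq_zero fun j _ => ?_
  change (if i + j = k then f.coeff i * g.coeff j else 0) = 0
  split_ifs with hij
  · by_cases hi : f.coeff i = 0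
    · rw [hi, zero_mul]
    · rw [H i j hij hi, mul_zero]
  · rfl

theorem coeff_algebraMap_ne_zero {c : ℂ} {k : ℤ}
    (hk : (algebraMap ℂ ℂ[T;T⁻¹] c).coeff k ≠ 0) : k = 0 := by
  rw [← LaurentPolynomial.C_eq_algebraMap, LaurentPolynomial.C_apply] at hk
  by_contra h
  rw [if_neg h] at hk
  exact hk rfl

theorem dvd_of_mem_adjoin {s : ℕ} {f : ℂ[T;T⁻¹]}
    (hf : f ∈ Algebra.adjoin ℂ {LaurentPolynomial.T (s : ℤ), LaurentPolynomial.T (-(s : ℤ))})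
    {k : ℤ} (hk : f.coeff k ≠ 0) : (s : ℤ) ∣ k := by
  induction hf using Algebra.adjoin_induction generalizing k with
  | mem x hx =>
    rcases hx with rfl | rfl
    · rw [LaurentPolynomial.T_apply] at hk
      by_cases h : (s : ℤ) = k
      · rw [h]
      · rw [if_neg h] at hk; exact absurd rfl hk
    · rw [LaurentPolynomial.T_apply] at hk
      by_cases h : -(s : ℤ) = k
      · exact ⟨-1, by omega⟩
      · rw [if_neg h] at hk; exact absurd rfl hk
  | algebraMap c => rw [coeff_algebraMap_ne_zero hk]; exact dvd_zero _
  | add x y _ _ hx hy =>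
    by_cases h : x.coeff k = 0
    · refine hy fun h' => hk ?_
      rw [AddMonoidAlgebra.coeff_add, Finsupp.add_apply, h, h', add_zero]
    · exact hx h
  | mul x y _ _ hx hy =>
    obtain ⟨i, j, rfl, hi, hj⟩ := coeff_mul_ne_zero hk
    exact dvd_add (hx hi) (hy hj)

/-- An exponent can only occur through a product of generators with nonzero coefficients, and such a
product is recorded by its list of indices σ. -/
theorem exists_wt_of_mem_aPsi {f : ℂ[T;T⁻¹]} (hf : f ∈ aPsi b ψ) {k : ℤ} (hk : f.coeff k ≠ 0) :
    ∃ σ : List ℤ, σ.sum = k ∧ wt b ψ σ ≠ 0 := by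
  induction hf using Algebra.adjoin_induction generalizing k with
  | mem x hx =>
    obtain ⟨j, hj, rfl⟩ := hx
    rw [AddMonoidAlgebra.coeff_smul_apply, LaurentPolynomial.T_apply, smul_eq_mul] at hk
    by_cases h : j = k
    · refine ⟨[k], by simp, ?_⟩
      rw [← h]
      simpa [wt] using left_ne_zero_of_mul hk
    · rw [if_neg h, mul_zero] at hk; exact absurd rfl hk
  | algebraMap c => exact ⟨[], by simp [coeff_algebraMap_ne_zero hk], by simp [wt]⟩
  | add x y _ _ hx hy =>
    by_cases h : x.coeff k = 0
    · refine hy fun h' => hk ?_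
      rw [AddMonoidAlgebra.coeff_add, Finsupp.add_apply, h, h', add_zero]
    · exact hx h
  | mul x y _ _ hx hy =>
    obtain ⟨i, j, rfl, hi, hj⟩ := coeff_mul_ne_zero hk
    obtain ⟨σ, h1, h2⟩ := hx hi
    obtain ⟨τ, h3, h4⟩ := hy hj
    refine ⟨σ ++ τ, by simp [h1, h3], ?_⟩
    simpa [wt] using ⟨by simpa [wt] using h2, by simpa [wt] using h4⟩

theorem HasStep.steps {s : ℕ} (hs : HasStep b ψ s) : Steps b ψ s := by
  have hT : ∀ j : ℤ, LaurentPolynomial.T (j * s) ∈ aPsi b ψ := by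
    intro j
    rw [hs.2]
    obtain ⟨n, rfl | rfl⟩ := j.eq_nat_or_neg
    · rw [← LaurentPolynomial.T_pow]
      exact Subalgebra.pow_mem _ (Algebra.subset_adjoin (by simp)) n
    · rw [neg_mul, ← mul_neg, ← LaurentPolynomial.T_pow]
      exact Subalgebra.pow_mem _ (Algebra.subset_adjoin (by simp)) n
  refine ⟨fun k hk => ?_, fun k hk => ?_⟩
  · by_cases h0 : k = 0
    · rw [h0]; exact dvd_zero _
    · have : ψ (L0.D b k) • LaurentPolynomial.T k ∈ aPsi b ψ := Algebra.subset_adjoin ⟨k, h0, rfl⟩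
      rw [hs.2] at this
      refine dvd_of_mem_adjoin this (k := k) ?_
      rw [AddMonoidAlgebra.coeff_smul_apply, LaurentPolynomial.T_apply, if_pos rfl]
      simpa using hk
  · obtain ⟨j, rfl⟩ := hk
    refine exists_wt_of_mem_aPsi b ψ (hT j) ?_
    rw [mul_comm, LaurentPolynomial.T_apply, if_pos rfl]
    exact one_ne_zero

/-- The span of the `v₀ ⊗ t^(i + k)` with `s ∣ k`. -/
def topSpan (s : ℕ) (i : ℤ) : Submodule ℂ (VPsi b ψ) :=
  Submodule.span ℂ {x | ∃ k : ℤ, (s : ℤ) ∣ k ∧ x = vk b ψ (i + k)}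

/-- The span is ℋ-stable, because D(k b₂) kills the v₀ ⊗ t^j unless s divides k. This inclusion is
all that is used about W_i besides v₀ ⊗ t^i ∈ W_i. -/
theorem topSpace_le {s : ℕ} (hs : Steps b ψ s) (i : ℤ) : topSpace b ψ i ≤ topSpan b ψ s i := by
  refine sInf_le ⟨Submodule.subset_span ⟨0, dvd_zero _, by rw [add_zero]; rfl⟩, ?_⟩
  intro x hx w hw
  let P : Submodule ℂ L :=
    { carrier := {x | ⁅x, w⁆ ∈ topSpan b ψ s i}
      add_mem' := fun {x y} ha hb => by
        change ⁅x + y, w⁆ ∈ topSpan b ψ s i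
        rw [add_lie]; exact add_mem ha hb
      zero_mem' := by change ⁅(0 : L), w⁆ ∈ topSpan b ψ s i; rw [zero_lie]; exact zero_mem _
      smul_mem' := fun t x hx => by
        change ⁅t • x, w⁆ ∈ topSpan b ψ s i
        rw [smul_lie]; exact Submodule.smul_mem _ t hx }
  refine (Submodule.span_le (p := P)).2 ?_ hx
  rintro _ (⟨k, rfl⟩ | hy)
  · change ⁅D (k • b 1), w⁆ ∈ topSpan b ψ s i
    induction hw using Submodule.span_induction with
    | mem w hw =>
      obtain ⟨j, hj, rfl⟩ := hw
      rw [vk_lie_D]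
      by_cases h0 : ψ (L0.D b k) = 0
      · rw [h0, zero_smul]; exact zero_mem _
      · exact Submodule.smul_mem _ _ (Submodule.subset_span
          ⟨j + k, dvd_add hj (hs.1 k h0), by rw [add_assoc]⟩)
    | zero => rw [lie_zero]; exact zero_mem _
    | add x y _ _ hx hy => rw [lie_add]; exact add_mem hx hy
    | smul a x _ hx => rw [lie_smul]; exact Submodule.smul_mem _ a hx
  · rw [Set.mem_singleton_iff.1 hy]
    change ⁅h (b 1), w⁆ ∈ topSpan b ψ s i
    induction hw using Submodule.span_induction with
    | mem w hw =>
      obtain ⟨j, hj, rfl⟩ := hw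
      rw [vk_lie_h]
      exact Submodule.smul_mem _ _ (Submodule.subset_span ⟨j, hj, rfl⟩)
    | zero => rw [lie_zero]; exact zero_mem _
    | add x y _ _ hx hy => rw [lie_add]; exact add_mem hx hy
    | smul a x _ hx => rw [lie_smul]; exact Submodule.smul_mem _ a hx

theorem vk_mem_topSpace (i : ℤ) : vk b ψ i ∈ topSpace b ψ i :=
  (Submodule.mem_sInf).2 fun _ hN => hN.1

theorem topSpan_proj {π : ℤ → VHat b ψ →ₗ[ℂ] VHat b ψ} (hπ : GradProj (vHatDeg b ψ) π) {s : ℕ}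
    {i : ℤ} {w : VPsi b ψ} (hw : w ∈ topSpan b ψ s i) (γ : Gam) :
    vPsiProj b ψ π γ w ∈ Submodule.span ℂ
      {x | ∃ k : ℤ, (s : ℤ) ∣ k ∧ γ = (i + k) • b 1 ∧ x = vk b ψ (i + k)} := by
  have hP := vPsiDeg_gradProj b ψ hπ
  induction hw using Submodule.span_induction with
  | mem w hw =>
    obtain ⟨j, hj, rfl⟩ := hw
    by_cases hγ : γ = (i + j) • b 1
    · subst hγ
      rw [hP.same _ _ (vk_mem b ψ _)]
      exact Submodule.subset_span ⟨j, hj, rfl, rfl⟩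
    · rw [hP.ne _ _ hγ _ (vk_mem b ψ _)]
      exact zero_mem _
  | zero => rw [map_zero]; exact zero_mem _
  | add x y _ _ hx hy => rw [map_add]; exact add_mem hx hy
  | smul a x _ hx => rw [map_smul]; exact Submodule.smul_mem _ a hx

theorem act_tmulT_vac_mem (l : List Gam) (k : ℤ) :
    act (VPsi b ψ) l (vk b ψ k) ∈ vPsiDeg b ψ (l.sum + k • b 1) :=
  act_mem (vPsi_lie_mem b ψ) l (vk_mem b ψ k)

/-- The submodules generated by the `v₀ ⊗ t^j` with `j` not congruent to `i` modulo `s` meet `W_i`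
trivially. -/
theorem gen_vk_inf {s : ℕ} (hs : Steps b ψ s) {i j : ℤ} (hij : ¬ (s : ℤ) ∣ j - i) :
    (gen (vk b ψ j)).toSubmodule ⊓ topSpace b ψ i = ⊥ := by
  obtain ⟨π, hπ⟩ := vHatDeg_gradProj b ψ
  have hP := vPsiDeg_gradProj b ψ hπ
  rw [eq_bot_iff]
  rintro x ⟨hx, hxi⟩
  refine (Submodule.mem_bot ℂ).2 (hP.eq_zero fun γ => ?_)
  have h1 := topSpan_proj b ψ hπ (topSpace_le b ψ hs i hxi) γ
  have h2 := gen_proj_mem hP (δ := fun l => l.sum + j • b 1)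
    (fun l => act_tmulT_vac_mem b ψ l j) hx γ
  by_cases hγ : ∃ k : ℤ, (s : ℤ) ∣ k ∧ γ = (i + k) • b 1
  · obtain ⟨k, hk, rfl⟩ := hγ
    refine (Submodule.mem_bot ℂ).1 ((Submodule.span_le.2 ?_) h2)
    rintro _ ⟨l, hl, rfl⟩
    have h0 : b.repr l.sum 0 = 0 := by
      have := congrArg (fun x => b.repr x 0) hl
      simpa only [map_add, Finsupp.add_apply, repr_smul_zero, add_zero] using this
    have h1 : b.repr l.sum 1 + j = i + k := by
      have := congrArg (fun x => b.repr x 1) hl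
      simpa only [map_add, Finsupp.add_apply, repr_smul_one] using this
    -- Words of level zero keep the exponent in the class of j modulo s, whereas components of W_i
    -- have exponents in the class of i.
    have := (act_top b (fun m => Submodule.span ℂ {x | (s : ℤ) ∣ m - j ∧ x = vk b ψ m}) ?_ ?_ ?_ l j
      (vk b ψ j) (Submodule.subset_span ⟨by simp, rfl⟩)).2 h0
    · refine Submodule.span_le.2 ?_ this
      rintro x ⟨hd, -⟩
      refine absurd ?_ hij
      have e : j - i = k - (j + b.repr l.sum 1 - j) := by omega
      rw [e]
      exact dvd_sub hk hd
    · intro r hr k x hx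
      induction hx using Submodule.span_induction with
      | mem w hw => rw [hw.2, vk_lie_pos b ψ hr]
      | zero => rw [lie_zero]
      | add x y _ _ hx hy => rw [lie_add, hx, hy, add_zero]
      | smul a x _ hx => rw [lie_smul, hx, smul_zero]
    · intro r hr k x hx
      induction hx using Submodule.span_induction with
      | mem w hw =>
        rw [hw.2, vk_lie_zero b ψ hr]
        by_cases h0 : ψ (L0.D b (b.repr r 1)) = 0
        · rw [h0, zero_smul]; exact zero_mem _
        · refine Submodule.smul_mem _ _ (Submodule.subset_span ⟨?_, rfl⟩)
          rw [add_sub_right_comm]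
          exact dvd_add hw.1 (hs.1 _ h0)
      | zero => rw [lie_zero]; exact zero_mem _
      | add x y _ _ hx hy => rw [lie_add]; exact add_mem hx hy
      | smul a x _ hx => rw [lie_smul]; exact Submodule.smul_mem _ a hx
    · intro m k x hx
      induction hx using Submodule.span_induction with
      | mem w hw =>
        rw [hw.2, vk_lie_h b ψ]
        exact Submodule.smul_mem _ _ (Submodule.subset_span ⟨hw.1, rfl⟩)
      | zero => rw [lie_zero]; exact zero_mem _
      | add x y _ _ hx hy => rw [lie_add]; exact add_mem hx hy
      | smul a x _ hx => rw [lie_smul]; exact Submodule.smul_mem _ a hx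
  · refine (Submodule.mem_bot ℂ).1 ((Submodule.span_le.2 ?_) h1)
    rintro _ ⟨k, hk, hk', -⟩
    exact absurd ⟨k, hk, hk'⟩ hγ

theorem gen_vk_le {s : ℕ} (hs : Steps b ψ s) {i j : ℤ} (hij : ¬ (s : ℤ) ∣ j - i) :
    gen (vk b ψ j) ≤ maxSub b ψ i := by
  obtain ⟨π, hπ⟩ := vHatDeg_gradProj b ψ
  exact le_sSup ⟨gen_homogeneous (vPsiDeg_gradProj b ψ hπ)
    (fun l => act_tmulT_vac_mem b ψ l j), gen_vk_inf b ψ hs hij⟩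

theorem maxSub_eq (i : ℤ) : (maxSub b ψ i).toSubmodule = sSup {N' | ∃ N : LieSubmodule ℂ L (VPsi b ψ),
    (IsHomogeneous (vPsiDeg b ψ) N.toSubmodule ∧ N.toSubmodule ⊓ topSpace b ψ i = ⊥) ∧
      N.toSubmodule = N'} :=
  LieSubmodule.sSup_toSubmodule _

theorem maxSub_homogeneous (i : ℤ) : IsHomogeneous (vPsiDeg b ψ) (maxSub b ψ i).toSubmodule := by
  rw [maxSub_eq]
  refine GradProj.sSup_homogeneous ?_
  rintro _ ⟨N, hN, rfl⟩
  exact hN.1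

/-- The component of degree i b₂ is the line of v₀ ⊗ t^i and lies in W_i. Every submodule in the
supremum misses it, and by homogeneity so does the supremum. -/
theorem vk_notMem_maxSub {i : ℤ} (hv : vk b ψ i ≠ 0) : vk b ψ i ∉ maxSub b ψ i := by
  intro H
  obtain ⟨π, hπ⟩ := vHatDeg_gradProj b ψ
  have key := (vPsiDeg_gradProj b ψ hπ).sSup_inf_eq_bot (i • b 1)
    (S := {N' | ∃ N : LieSubmodule ℂ L (VPsi b ψ), (IsHomogeneous (vPsiDeg b ψ) N.toSubmodule ∧
      N.toSubmodule ⊓ topSpace b ψ i = ⊥) ∧ N.toSubmodule = N'}) (by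
    rintro _ ⟨N, hN, rfl⟩
    refine ⟨hN.1, eq_bot_iff.2 ?_⟩
    rw [← hN.2]
    refine inf_le_inf_left _ ?_
    rw [vPsiDeg_top, Submodule.span_le]
    simpa using vk_mem_topSpace b ψ i)
  rw [← maxSub_eq] at key
  have : vk b ψ i ∈ (⊥ : Submodule ℂ (VPsi b ψ)) := key ▸ ⟨H, vk_mem b ψ i⟩
  exact hv (by simpa using this)

theorem tmulT_ne_zero {v : VHat b ψ} (hv : v ≠ 0) (k : ℤ) : tmulT b ψ k v ≠ 0 := by
  intro H
  have h1 : v ⊗ₜ[ℂ] (LaurentPolynomial.T k : ℂ[T;T⁻¹]) = 0 := (ofTensor b ψ).map_eq_zero_iff.1 H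
  let q : ℂ[T;T⁻¹] →ₗ[ℂ] ℂ :=
    { toFun := fun f => f.coeff k
      map_add' := fun f g => by rw [AddMonoidAlgebra.coeff_add, Finsupp.add_apply]
      map_smul' := fun t f => by rw [AddMonoidAlgebra.coeff_smul_apply]; rfl }
  have h2 := congrArg (fun x => TensorProduct.rid ℂ _ (LinearMap.lTensor (VHat b ψ) q x)) h1
  have hq : q (LaurentPolynomial.T k) = 1 := by
    change (LaurentPolynomial.T k : ℂ[T;T⁻¹]).coeff k = 1
    rw [LaurentPolynomial.T_apply, if_pos rfl]
  simp only [LinearMap.lTensor_tmul, hq, TensorProduct.rid_tmul, one_smul, map_zero] at h2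
  exact hv h2

/-! ### Generation and irreducibility of V̄(ψ, i, s) -/

/-- The projection of `V(ψ)` onto `V̄(ψ, i, s)`. -/
def toVBar (i : ℤ) : VPsi b ψ →ₗ[ℂ] VBar b ψ i :=
  (LieSubmodule.Quotient.mk' (maxSub b ψ i)).toLinearMap

theorem toVBar_lie (i : ℤ) (x : L) (v : VPsi b ψ) : toVBar b ψ i ⁅x, v⁆ = ⁅x, toVBar b ψ i v⁆ :=
  (LieSubmodule.Quotient.mk' (maxSub b ψ i)).map_lie x v

theorem toVBar_surjective (i : ℤ) : Function.Surjective (toVBar b ψ i) :=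
  LieSubmodule.Quotient.surjective_mk' _

theorem toVBar_eq_zero (i : ℤ) (v : VPsi b ψ) :
    toVBar b ψ i v = 0 ↔ v ∈ (maxSub b ψ i).toSubmodule :=
  LieSubmodule.Quotient.mk_eq_zero _

/-- The image of `v₀ ⊗ t^k` in `V̄(ψ, i, s)`. -/
def vBark (i k : ℤ) : VBar b ψ i := toVBar b ψ i (vk b ψ k)

theorem vBark_mem (i k : ℤ) : vBark b ψ i k ∈ vBarDeg b ψ i (k • b 1) :=
  Submodule.mem_map_of_mem (vk_mem b ψ k)

theorem vBar_lie_mem (i : ℤ) (m n : Gam) (v : VBar b ψ i) (hv : v ∈ vBarDeg b ψ i n) :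
    ⁅D m, v⁆ ∈ vBarDeg b ψ i (m + n) := by
  obtain ⟨x, hx, rfl⟩ := hv
  change ⁅D m, toVBar b ψ i x⁆ ∈ _
  rw [← toVBar_lie]
  exact Submodule.mem_map_of_mem (vPsi_lie_mem b ψ m n x hx)

theorem vBark_lie_pos {r : Gam} (hr : 0 < b.repr r 0) (i k : ℤ) : ⁅D r, vBark b ψ i k⁆ = 0 := by
  rw [vBark, ← toVBar_lie, vk_lie_pos b ψ hr, map_zero]

theorem act_vBark (σ : List ℤ) (i k : ℤ) :
    act (VBar b ψ i) (σ.map fun j => j • b 1) (vBark b ψ i k) =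
      wt b ψ σ • vBark b ψ i (k + σ.sum) := by
  rw [vBark, ← map_act (toVBar b ψ i) (fun r v => toVBar_lie b ψ i (D r) v), act_vk, map_smul, vBark]

theorem vBarDeg_gradProj_aux (i : ℤ) {π : ℤ → VHat b ψ →ₗ[ℂ] VHat b ψ}
    (hπ : GradProj (vHatDeg b ψ) π) : ∃ π', GradProj (vBarDeg b ψ i) π' ∧
      ∀ γ x, π' γ (toVBar b ψ i x) = toVBar b ψ i (vPsiProj b ψ π γ x) :=
  (vPsiDeg_gradProj b ψ hπ).map (toVBar b ψ i) (toVBar_surjective b ψ i) (toVBar_eq_zero b ψ i)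
    (maxSub_homogeneous b ψ i)

theorem vBarDeg_gradProj (i : ℤ) : ∃ π, GradProj (vBarDeg b ψ i) π := by
  obtain ⟨π, hπ⟩ := vHatDeg_gradProj b ψ
  obtain ⟨π', hπ', -⟩ := vBarDeg_gradProj_aux b ψ i hπ
  exact ⟨π', hπ'⟩

/-- The v₀ ⊗ t^j with j ≡ i mod s are reached from v₀ ⊗ t^i by products of nonzero weight, the
others vanish in the quotient, and words applied to all of them span V(ψ). -/
theorem gen_vBark {s : ℕ} (hs : Steps b ψ s) (i : ℤ) : gen (vBark b ψ i i) = ⊤ := by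
  have hvk : ∀ j, vBark b ψ i j ∈ gen (vBark b ψ i i) := by
    intro j
    by_cases hj : (s : ℤ) ∣ j - i
    · obtain ⟨σ, h1, h2⟩ := hs.2 _ hj
      have := act_mem_gen (σ.map fun j => j • b 1) (vBark b ψ i i)
      rw [act_vBark, h1, add_sub_cancel] at this
      have := (gen (vBark b ψ i i)).smul_mem (wt b ψ σ)⁻¹ this
      rwa [smul_smul, inv_mul_cancel₀ h2, one_smul] at this
    · have : vBark b ψ i j = 0 :=
        (toVBar_eq_zero b ψ i _).2 (gen_vk_le b ψ hs hj (self_mem_gen _))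
      rw [this]
      exact zero_mem _
  refine eq_top_iff.2 fun x _ => ?_
  obtain ⟨y, rfl⟩ := toVBar_surjective b ψ i x
  have : (gen (vBark b ψ i i)).toSubmodule.comap (toVBar b ψ i) = ⊤ := by
    refine vPsi_eq_top b ψ fun k v => ?_
    have hv : v ∈ gen (vac b ψ) := by rw [gen_vac]; trivial
    refine (Submodule.span_le (p := (((gen (vBark b ψ i i)).toSubmodule.comap
      (toVBar b ψ i)).comap (tmulT b ψ k)))).2 ?_ hv
    rintro _ ⟨l, rfl⟩
    have e := act_tmulT b ψ l (k - b.repr l.sum 1) (vac b ψ)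
    rw [sub_add_cancel] at e
    change toVBar b ψ i (tmulT b ψ k (act (VHat b ψ) l (vac b ψ))) ∈ gen (vBark b ψ i i)
    rw [← e, map_act (toVBar b ψ i) (fun r v => toVBar_lie b ψ i (D r) v)]
    exact act_mem_of_lie_mem _ l (hvk _)
  have hy : y ∈ (gen (vBark b ψ i i)).toSubmodule.comap (toVBar b ψ i) := by rw [this]; trivial
  exact hy

theorem vBark_ne_zero (hv : vac b ψ ≠ 0) (i : ℤ) : vBark b ψ i i ≠ 0 := fun H =>
  vk_notMem_maxSub b ψ (tmulT_ne_zero b ψ hv i) ((toVBar_eq_zero b ψ i _).1 H)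

/-- `V̄(ψ, i, s)` is irreducible as a graded module. -/
theorem vBar_irreducible {s : ℕ} (hs : Steps b ψ s) (i : ℤ) (N : LieSubmodule ℂ L (VBar b ψ i))
    (hN : IsHomogeneous (vBarDeg b ψ i) N.toSubmodule) : N = ⊥ ∨ N = ⊤ := by
  obtain ⟨π, hπ⟩ := vHatDeg_gradProj b ψ
  have hP := vPsiDeg_gradProj b ψ hπ
  obtain ⟨π', hπ', hc⟩ := vBarDeg_gradProj_aux b ψ i hπ
  let N' : LieSubmodule ℂ L (VPsi b ψ) := lieSubOfD (N.toSubmodule.comap (toVBar b ψ i)) (by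
    intro r v hv
    change toVBar b ψ i ⁅D r, v⁆ ∈ N
    rw [toVBar_lie]
    exact N.lie_mem hv)
  have hN' : IsHomogeneous (vPsiDeg b ψ) N'.toSubmodule := hP.comap_homogeneous hπ' hc hN
  by_cases h0 : N'.toSubmodule ⊓ topSpace b ψ i = ⊥
  · left
    refine eq_bot_iff.2 fun x hx => ?_
    obtain ⟨y, rfl⟩ := toVBar_surjective b ψ i x
    have hle : N' ≤ maxSub b ψ i := le_sSup ⟨hN', h0⟩
    have hy : y ∈ N' := hx
    rw [(toVBar_eq_zero b ψ i y).2 (hle hy)]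
    exact zero_mem _
  · right
    -- A nonzero element of W_i has a homogeneous component that is a nonzero multiple of some v₀ ⊗
    -- t^(i + k) with s ∣ k; a product of total -k and nonzero weight brings it back to v₀ ⊗ t^i.
    obtain ⟨w, ⟨hwN, hwt⟩, hw0⟩ := Submodule.exists_mem_ne_zero_of_ne_bot h0
    obtain ⟨γ, hγ⟩ := hP.exists_ne hw0
    have h1 := topSpan_proj b ψ hπ (topSpace_le b ψ hs i hwt) γ
    have h2 : vPsiProj b ψ π γ w ∈ N' := hP.proj_mem hN' γ hwN
    have hk : ∃ k : ℤ, (s : ℤ) ∣ k ∧ γ = (i + k) • b 1 := by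
      by_contra H
      refine hγ ((Submodule.mem_bot ℂ).1 ((Submodule.span_le.2 ?_) h1))
      rintro _ ⟨k, hk, hk', -⟩
      exact absurd ⟨k, hk, hk'⟩ H
    obtain ⟨k, hk, rfl⟩ := hk
    have h3 := hP.apply_mem ((i + k) • b 1) w
    rw [vPsiDeg_top] at h3
    obtain ⟨c, hc'⟩ := Submodule.mem_span_singleton.1 h3
    have hc0 : c ≠ 0 := by
      rintro rfl
      rw [zero_smul] at hc'
      exact hγ hc'.symm
    have h4 : vk b ψ (i + k) ∈ N' := by
      rw [← hc'] at h2
      have := N'.smul_mem c⁻¹ h2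
      rwa [smul_smul, inv_mul_cancel₀ hc0, one_smul] at this
    obtain ⟨σ, h5, h6⟩ := hs.2 (-k) ((dvd_neg).2 hk)
    have h7 := act_mem_of_lie_mem N' (σ.map fun j => j • b 1) h4
    rw [act_vk, h5, add_neg_cancel_right] at h7
    have h8 := N'.smul_mem (wt b ψ σ)⁻¹ h7
    rw [smul_smul, inv_mul_cancel₀ h6, one_smul] at h8
    have h9 : vBark b ψ i i ∈ N := h8
    rw [eq_top_iff, ← gen_vBark b ψ hs i]
    exact gen_le h9

end Loop


/-! ## Linear recurrences -/

section Recurrence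

open Polynomial

variable {M : Type*} [AddCommGroup M] [Module ℂ M]

/-- The value `∑ Q_i u(n + i)` of the polynomial `Q` in the shift on the sequence `u`. -/
def recL (u : ℤ → M) (n : ℤ) : ℂ[X] →ₗ[ℂ] M :=
  Polynomial.lsum fun i => LinearMap.toSpanSingleton ℂ M (u (n + i))

theorem recL_monomial (u : ℤ → M) (n : ℤ) (i : ℕ) (a : ℂ) :
    recL u n (monomial i a) = a • u (n + i) := by
  simp [recL, Polynomial.lsum_apply, Polynomial.sum_monomial_index]

theorem recL_eq_sum (u : ℤ → M) (n : ℤ) (Q : ℂ[X]) :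
    recL u n Q = ∑ i ∈ Q.support, Q.coeff i • u (n + i) := by
  simp [recL, Polynomial.lsum_apply, Polynomial.sum]

theorem recL_mul_X_pow (u : ℤ → M) (n : ℤ) (Q : ℂ[X]) (k : ℕ) :
    recL u n (Q * X ^ k) = recL u (n + k) Q := by
  induction Q using Polynomial.induction_on' with
  | add p q hp hq => rw [add_mul, map_add, map_add, hp, hq]
  | monomial i a =>
    rw [monomial_mul_X_pow, recL_monomial, recL_monomial]
    congr 2
    push_cast
    ring

theorem recL_mul_eq_zero {u : ℤ → M} {P : ℂ[X]} (hP : ∀ n, recL u n P = 0) (Q : ℂ[X]) (n : ℤ) :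
    recL u n (P * Q) = 0 := by
  induction Q using Polynomial.induction_on' with
  | add p q hp hq => rw [mul_add, map_add, hp, hq, add_zero]
  | monomial i a =>
    rw [← C_mul_X_pow_eq_monomial, mul_left_comm, ← smul_eq_C_mul, map_smul, recL_mul_X_pow, hP,
      smul_zero]

theorem recL_of_dvd {u : ℤ → M} {P Q : ℂ[X]} (hP : ∀ n, recL u n P = 0) (h : P ∣ Q) (n : ℤ) :
    recL u n Q = 0 := by
  obtain ⟨R, rfl⟩ := h
  exact recL_mul_eq_zero hP R n

/-- Linear factors of a recurrence can be peeled off one at a time, each replacing the sequence by a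
first order difference. -/
theorem recL_sub_C_mul (u : ℤ → M) (n : ℤ) (α : ℂ) (Q : ℂ[X]) :
    recL u n ((X - C α) * Q) = recL (fun m => u (m + 1) - α • u m) n Q := by
  induction Q using Polynomial.induction_on' with
  | add p q hp hq => rw [mul_add, map_add, map_add, hp, hq]
  | monomial i a =>
    rw [sub_mul, map_sub, X_mul_monomial, C_mul_monomial, recL_monomial, recL_monomial,
      recL_monomial, smul_sub, smul_smul, mul_comm α a]
    congr 3
    push_cast
    ring

theorem map_recL {M' : Type*} [AddCommGroup M'] [Module ℂ M'] (f : M →ₗ[ℂ] M') (u : ℤ → M) (n : ℤ)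
    (Q : ℂ[X]) : f (recL u n Q) = recL (fun m => f (u m)) n Q := by
  simp [recL_eq_sum]

theorem recL_mem {N : Submodule ℂ M} {u : ℤ → M} (hu : ∀ m, u m ∈ N) (n : ℤ) (Q : ℂ[X]) :
    recL u n Q ∈ N := by
  rw [recL_eq_sum]
  exact Submodule.sum_mem _ fun i _ => N.smul_mem _ (hu _)

/-- The factor X - α replaces p(k) by α (p(k + 1) - p(k)), which has smaller degree. -/
theorem recL_polynomial_mul_pow (p : ℂ[X]) {α : ℂ} (hα : α ≠ 0) (d : ℕ) (hd : p.degree < d)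
    (n : ℤ) : recL (fun k : ℤ => p.eval (k : ℂ) * α ^ k) n ((X - C α) ^ d) = 0 := by
  induction d generalizing p with
  | zero =>
    have : p = 0 := by
      rw [← degree_eq_bot, ← Nat.WithBot.lt_zero_iff]
      simpa using hd
    simp [this, recL_eq_sum]
  | succ d ih =>
    rw [pow_succ', recL_sub_C_mul]
    have e : (fun m : ℤ => p.eval ((m + 1 : ℤ) : ℂ) * α ^ (m + 1) - α • (p.eval (m : ℂ) * α ^ m)) =
        fun k : ℤ => (C α * (taylor 1 p - p)).eval (k : ℂ) * α ^ k := by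
      funext m
      rw [zpow_add_one₀ hα, eval_mul, eval_C, eval_sub, taylor_eval, smul_eq_mul]
      push_cast
      ring
    rw [e]
    refine ih _ ?_
    by_cases h0 : p = 0
    · simp only [h0, map_zero, sub_zero, mul_zero, degree_zero]
      exact WithBot.bot_lt_coe d
    · have h1 : (taylor 1 p - p).degree < p.degree := by
        rw [← degree_taylor p 1]
        refine degree_sub_lt_left (degree_taylor p 1) ?_ ?_
        · exact fun h => h0 ((taylor_injective 1) (by rw [h, map_zero]))
        · rw [leadingCoeff_taylor]
      rw [degree_C_mul hα]
      have h2 : p.degree ≤ d := by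
        rw [Nat.cast_succ] at hd
        exact Order.le_of_lt_succ hd
      exact h1.trans_le h2

theorem recL_sum {ι : Type*} [Fintype ι] (f : ι → ℤ → M) (n : ℤ) (Q : ℂ[X]) :
    recL (fun k => ∑ i, f i k) n Q = ∑ i, recL (f i) n Q := by
  simp only [recL_eq_sum, Finset.smul_sum]
  exact Finset.sum_comm

/-- An exp-polynomial sequence satisfies a linear recurrence. -/
theorem exists_recurrence {r : ℕ} (p : Fin r → ℂ[X]) (α : Fin r → ℂ) (hα : ∀ i, α i ≠ 0) :
    ∃ P : ℂ[X], P.Monic ∧ P.coeff 0 ≠ 0 ∧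
      ∀ n, recL (fun k : ℤ => ∑ i, (p i).eval (k : ℂ) * α i ^ k) n P = 0 := by
  refine ⟨∏ i, (X - C (α i)) ^ ((p i).natDegree + 1), monic_prod_of_monic _ _ fun i _ =>
    (monic_X_sub_C _).pow _, ?_, fun n => ?_⟩
  · rw [coeff_zero_eq_eval_zero, eval_prod, Finset.prod_ne_zero_iff]
    intro i _
    simp [hα i]
  · rw [recL_sum (fun i (k : ℤ) => (p i).eval (k : ℂ) * α i ^ k)]
    refine Finset.sum_eq_zero fun i _ => ?_
    have h1 : (p i).degree < ((p i).natDegree + 1 : ℕ) :=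
      degree_le_natDegree.trans_lt (WithBot.coe_lt_coe.2 (Nat.lt_succ_self _))
    have h2 : (X - C (α i)) ^ ((p i).natDegree + 1) ∣
        ∏ i, (X - C (α i)) ^ ((p i).natDegree + 1) :=
      Finset.dvd_prod_of_mem (fun i => (X - C (α i)) ^ ((p i).natDegree + 1)) (Finset.mem_univ i)
    exact recL_of_dvd (recL_polynomial_mul_pow (p i) (hα i) _ h1) h2 n

/-- The terms of a sequence satisfying a two-sided linear recurrence span a finite-dimensional
space. -/
theorem fg_span_of_recurrence {u : ℤ → M} {P : ℂ[X]} (hP : P.Monic) (h0 : P.coeff 0 ≠ 0)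
    (hu : ∀ n, recL u n P = 0) : (Submodule.span ℂ (Set.range u)).FG := by
  set d := P.natDegree with hd
  let S : Submodule ℂ M := Submodule.span ℂ ((fun i : ℕ => u i) '' {i | i < d})
  -- Every window of d consecutive terms lies in the span of the window at 0: the leading
  -- coefficient 1 slides it to the right, the nonzero constant coefficient to the left.
  suffices H : ∀ m : ℤ, ∀ i : ℕ, i < d → u (m + i) ∈ S by
    by_cases hd0 : d = 0
    · have hP1 : P = 1 := hP.natDegree_eq_zero.1 hd0
      have : ∀ n, u n = 0 := fun n => by
        have := hu n
        rw [hP1, ← monomial_zero_one, recL_monomial] at this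
        simpa using this
      have : Submodule.span ℂ (Set.range u) = ⊥ := by
        rw [Submodule.span_eq_bot]
        rintro _ ⟨n, rfl⟩
        exact this n
      rw [this]
      exact Submodule.fg_bot
    · have : Submodule.span ℂ (Set.range u) = S := by
        refine le_antisymm (Submodule.span_le.2 ?_) (Submodule.span_mono ?_)
        · rintro _ ⟨m, rfl⟩
          simpa using H m 0 (Nat.pos_of_ne_zero hd0)
        · rintro _ ⟨i, -, rfl⟩
          exact ⟨i, rfl⟩
      rw [this]
      exact Submodule.fg_span ((Set.finite_lt_nat d).image _)
  have hsum : ∀ n, ∑ i ∈ Finset.range (d + 1), P.coeff i • u (n + i) = 0 := by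
    intro n
    rw [← hu n, recL_eq_sum]
    symm
    refine Finset.sum_subset (fun i hi => ?_) (fun i _ hi => ?_)
    · rw [Finset.mem_range]
      exact Nat.lt_succ_of_le (le_natDegree_of_mem_supp i hi)
    · rw [notMem_support_iff.1 hi, zero_smul]
  intro m
  induction m using Int.induction_on with
  | zero =>
    intro i hi
    refine Submodule.subset_span ⟨i, hi, ?_⟩
    rw [zero_add]
  | succ m ih =>
    intro i hi
    by_cases hi' : i + 1 < d
    · have := ih (i + 1) hi'
      push_cast at this
      rwa [add_comm (i : ℤ) 1, ← add_assoc] at this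
    · have hi1 : d = i + 1 := by omega
      have := hsum m
      rw [Finset.sum_range_succ, hP.coeff_natDegree, one_smul] at this
      have e : u ((m : ℤ) + 1 + i) = -∑ j ∈ Finset.range d, P.coeff j • u (m + j) := by
        rw [← eq_neg_iff_add_eq_zero.2 ((add_comm _ _).trans this)]
        congr 1
        rw [hi1]
        push_cast
        ring
      rw [e]
      exact neg_mem (Submodule.sum_mem _ fun j hj => S.smul_mem _ (ih j (Finset.mem_range.1 hj)))
  | pred m ih =>
    intro i hi
    rcases i with _ | i
    · have := hsum (-(m : ℤ) - 1)
      rw [Finset.sum_range_succ'] at this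
      have e : u (-(m : ℤ) - 1 + (0 : ℕ)) = (P.coeff 0)⁻¹ •
          -∑ j ∈ Finset.range d, P.coeff (j + 1) • u (-(m : ℤ) - 1 + (j + 1 : ℕ)) := by
        rw [← eq_neg_iff_add_eq_zero.2 ((add_comm _ _).trans this), smul_smul, inv_mul_cancel₀ h0,
          one_smul]
      rw [e]
      refine S.smul_mem _ (neg_mem (Submodule.sum_mem _ fun j hj => S.smul_mem _ ?_))
      have := ih j (Finset.mem_range.1 hj)
      have e2 : -(m : ℤ) - 1 + (j + 1 : ℕ) = -(m : ℤ) + j := by push_cast; ring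
      rwa [e2]
    · have := ih i (by omega)
      have e2 : -(m : ℤ) - 1 + (i + 1 : ℕ) = -(m : ℤ) + i := by push_cast; ring
      rwa [e2]

end Recurrence

/-! ## Finite-dimensionality of the levels of `V̂⁺(ψ)` -/

section Quasifinite

open Polynomial

variable (b : Module.Basis (Fin 2) ℤ Gam)

theorem det_comb (a k j m : ℤ) : det (a • b 0 + k • b 1) (j • b 0 + m • b 1) =
    (a * m - k * j) * det (b 0) (b 1) := by
  simp only [det, Prod.fst_add, Prod.snd_add, Prod.smul_fst, Prod.smul_snd, smul_eq_mul]
  ring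

/-- By `det_comb` the determinant of the standard basis, which is 1, is a multiple of it. -/
theorem det_basis_ne_zero : det (b 0) (b 1) ≠ 0 := by
  intro H
  have h1 := repr_eq b (1, 0)
  have h2 := repr_eq b (0, 1)
  generalize b.repr (1, 0) 0 = p at h1
  generalize b.repr (1, 0) 1 = q at h1
  generalize b.repr (0, 1) 0 = p' at h2
  generalize b.repr (0, 1) 1 = q' at h2
  have h3 := det_comb b p q p' q'
  rw [← h1, ← h2, H, mul_zero] at h3
  simp [det] at h3

/-- The sequence `m ↦ D(j b₁ + m b₂)`. -/
def E (j m : ℤ) : L := D (j • b 0 + m • b 1)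

/-- The structure constant, proportional to a (n + i) - k j, is affine in the summation index i, and
multiplying the coefficients by i is the operator X d/dX. So divisibility by P^(K + 1) survives a
bracket as divisibility by P^K. -/
theorem lie_recL_E {a j : ℤ} (haj : a + j ≠ 0) (k n : ℤ) (Q : ℂ[X]) :
    ⁅E b a k, recL (E b j) n Q⁆ = recL (E b (a + j)) (k + n) (C (-(det (b 0) (b 1) : ℂ)) *
      (C ((a : ℂ) * n - k * j) * Q + C (a : ℂ) * (X * derivative Q))) := by
  induction Q using Polynomial.induction_on' with
  | add p q hp hq =>
    rw [map_add, lie_add, hp, hq, ← map_add]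
    congr 1
    rw [derivative_add]
    ring
  | monomial i c =>
    have e1 : X * derivative (monomial i c) = monomial i (c * i) := by
      rw [derivative_monomial]
      rcases i with _ | i
      · simp
      · rw [X_mul_monomial]
        simp
    rw [recL_monomial, e1, C_mul_monomial, C_mul_monomial, ← map_add, C_mul_monomial, recL_monomial,
      lie_smul]
    have e2 : a • b 0 + k • b 1 + (j • b 0 + (n + i : ℤ) • b 1) =
        (a + j) • b 0 + (k + n + i : ℤ) • b 1 := by
      simp only [add_smul]
      abel
    have e3 : (a + j) • b 0 + (k + n + i : ℤ) • b 1 ≠ 0 := by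
      intro H
      have := congrArg (fun x => b.repr x 0) H
      rw [repr_comb_zero] at this
      exact haj (by simpa using this)
    rw [E, E, lie_D_D, det_comb, e2, if_neg e3, add_zero, E, ← Int.cast_smul_eq_zsmul ℂ, smul_smul]
    congr 1
    push_cast
    ring

/-- Elements of level `±(j + 1)` are, up to a scalar, brackets of elements of level `±1` and
`±j`. -/
theorem exists_split {ε j : ℤ} (hε : ε = 1 ∨ ε = -1) (hj : 1 ≤ j) {r : Gam}
    (hr : b.repr r 0 = ε * (j + 1)) : ∃ r₁ r₂, b.repr r₁ 0 = ε ∧ b.repr r₂ 0 = ε * j ∧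
      r₁ + r₂ = r ∧ det r₁ r₂ ≠ 0 := by
  have key : ∀ a : ℤ, ε * (b.repr r 1 - a) - a * (ε * j) ≠ 0 → ∃ r₁ r₂, b.repr r₁ 0 = ε ∧
      b.repr r₂ 0 = ε * j ∧ r₁ + r₂ = r ∧ det r₁ r₂ ≠ 0 := by
    intro a ha
    refine ⟨ε • b 0 + a • b 1, (ε * j) • b 0 + (b.repr r 1 - a) • b 1, repr_comb_zero b _ _,
      repr_comb_zero b _ _, ?_, ?_⟩
    · conv_rhs => rw [repr_eq b r, hr]
      simp only [mul_add, add_smul, sub_smul, mul_one]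
      abel
    · rw [det_comb]
      exact mul_ne_zero ha (det_basis_ne_zero b)
  -- The splitting with a = 0 works unless r is a multiple of b₁; in that case a = 1 gives
  -- determinant -ε (j + 1) det(b₁, b₂).
  by_cases h0 : b.repr r 1 = 0
  · refine key 1 ?_
    rw [h0]
    rcases hε with rfl | rfl <;> omega
  · refine key 0 ?_
    rcases hε with rfl | rfl <;> omega

section

variable {V : Type*} [AddCommGroup V] [Module ℂ V] [LieRingModule L V] [LieModule ℂ L V]

/-- The linear map `y ↦ y x` from `L` to a module. -/
def lieAt (x : V) : L →ₗ[ℂ] V where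
  toFun y := ⁅y, x⁆
  map_add' y z := add_lie y z x
  map_smul' t y := smul_lie t y x

/-- For non-proportional r₁, r₂ the bracket is a nonzero multiple of D(r₁ + r₂) with no central
term. In particular a vector killed by D(r₁) and D(r₂) is killed by D(r₁ + r₂). -/
theorem lie_add_of_det_ne {r₁ r₂ : Gam} (hd : det r₁ r₂ ≠ 0) (x : V) : ⁅D (r₁ + r₂), x⁆ =
    (-(det r₁ r₂ : ℂ))⁻¹ • (⁅D r₁, ⁅D r₂, x⁆⁆ - ⁅D r₂, ⁅D r₁, x⁆⁆) := by
  have h0 : r₁ + r₂ ≠ 0 := by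
    intro H
    refine hd ?_
    rw [eq_neg_of_add_eq_zero_right H]
    simp [det, mul_comm]
  have hd' : (-(det r₁ r₂ : ℂ)) ≠ 0 := neg_ne_zero.2 (by exact_mod_cast hd)
  rw [lie_lie_D r₁, if_neg h0, add_zero, add_sub_cancel_left, smul_smul, inv_mul_cancel₀ hd',
    one_smul]

/-- The `D(r)` of level one generate those of positive level. -/
theorem lie_pos_of_lie_one {x : V} (h1 : ∀ r, b.repr r 0 = 1 → ⁅D r, x⁆ = 0) (r : Gam)
    (hr : 0 < b.repr r 0) : ⁅D r, x⁆ = 0 := by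
  obtain ⟨n, hn⟩ : ∃ n : ℕ, b.repr r 0 = n + 1 := ⟨(b.repr r 0 - 1).toNat, by omega⟩
  induction n generalizing r with
  | zero => exact h1 r (by simpa using hn)
  | succ n ih =>
    obtain ⟨r₁, r₂, h3, h4, rfl, h6⟩ := exists_split b (j := n + 1) (Or.inl rfl) (by omega) (r := r)
      (by rw [hn]; push_cast; ring)
    rw [lie_add_of_det_ne h6, ih r₂ (by omega) (by omega), h1 r₁ h3, lie_zero, lie_zero, sub_zero,
      smul_zero]

end

variable (ψ : L0 b →ₗ[ℂ] ℂ)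

theorem vHat_lie_h (m : Gam) (x : VHat b ψ) : ⁅h m, x⁆ = ψ (L0.h b m) • x := by
  let N : Submodule ℂ (VHat b ψ) := LinearMap.ker
    (LieModule.toEnd ℂ L (VHat b ψ) (h m) - ψ (L0.h b m) • LinearMap.id)
  have hN : ∀ y, y ∈ N ↔ ⁅h m, y⁆ = ψ (L0.h b m) • y := by
    intro y
    simp [N, sub_eq_zero]
  have hD : ∀ r, ∀ y ∈ N, ⁅D r, y⁆ ∈ N := by
    intro r y hy
    rw [hN] at hy ⊢
    rw [lie_D_comm _ (h_central m), hy, lie_smul]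
  have : gen (vac b ψ) ≤ lieSubOfD N hD := gen_le ((hN _).2 (vac_lie_h b ψ m))
  rw [gen_vac] at this
  exact (hN x).1 (this (by trivial))

/-- Here the shape of an exp-polynomial function enters: the structure constant of D((k + m) b₂)
cancels the denominator of ψ, and for k + m = 0 the central term supplies exactly g(0). -/
theorem lie_one_lie_neg_one {g : ℤ → ℂ} (hg : ∀ k : ℤ, k ≠ 0 → ψ (L0.D b k) = g k / k)
    (hg0 : ψ (L0.h b (b 0)) = -(det (b 0) (b 1) : ℂ) * g 0) (hb : ψ (L0.h b (b 1)) = 0) (k m : ℤ) :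
    ⁅E b 1 k, ⁅E b (-1) m, vac b ψ⁆⁆ = (-(det (b 0) (b 1) : ℂ) * g (k + m)) • vac b ψ := by
  have e : (1 : ℤ) • b 0 + k • b 1 + ((-1 : ℤ) • b 0 + m • b 1) = (k + m) • b 1 := by
    simp only [add_smul, neg_smul]; abel
  rw [E, E, lie_lie_D, vac_lie_pos b ψ (by rw [repr_comb_zero]; norm_num), lie_zero, zero_add, e,
    vac_lie_zero b ψ (repr_smul_zero b _), repr_smul_one, det_comb]
  by_cases h0 : k + m = 0
  · have e2 : L0.h b ((1 : ℤ) • b 0 + k • b 1) = L0.h b (b 0) + k • L0.h b (b 1) := by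
      refine Subtype.ext ?_
      change h _ = h _ + k • h _
      simp only [h, Prod.fst_add, Prod.snd_add, Prod.smul_fst, Prod.smul_snd, smul_eq_mul, add_smul,
        one_mul, mul_smul, smul_add]
      abel
    rw [h0, L0_D_zero, LinearMap.map_zero, zero_smul ℂ, smul_zero, zero_add, if_pos (zero_smul ℤ _),
      vac_lie_h, e2, map_add, map_zsmul, hb, smul_zero, add_zero, hg0]
  · have h2 : (k + m) • b 1 ≠ 0 := by
      intro H
      have := congrArg (fun x => b.repr x 1) H
      simp only [repr_smul_one] at this
      exact h0 (by simpa using this)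
    rw [if_neg h2, add_zero, smul_smul, hg _ h0]
    congr 1
    have : ((k : ℂ) + m) ≠ 0 := by exact_mod_cast h0
    push_cast
    field_simp
    ring

-- A vector of negative level killed by all of level one is zero. Operators of level one lower the
-- index of the level at the cost of one factor P, and at level -1 they produce the recurrence of g,
-- which P annihilates.
variable {b ψ} in
theorem recL_vac_eq_zero {g : ℤ → ℂ} (hg : ∀ k : ℤ, k ≠ 0 → ψ (L0.D b k) = g k / k)
    (hg0 : ψ (L0.h b (b 0)) = -(det (b 0) (b 1) : ℂ) * g 0) (hb : ψ (L0.h b (b 1)) = 0) {P : ℂ[X]}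
    (hP : ∀ n, recL g n P = 0) (j : ℕ) (Q : ℂ[X]) (hQ : P ^ (j + 1) ∣ Q) (n : ℤ) :
    ⁅recL (E b (-(j + 1 : ℕ))) n Q, vac b ψ⁆ = 0 := by
  have hL : ∀ (j n : ℤ) (Q : ℂ[X]) (x : VHat b ψ),
      ⁅recL (E b j) n Q, x⁆ = recL (fun m => ⁅E b j m, x⁆) n Q := fun j n Q x =>
    map_recL (lieAt x) (E b j) n Q
  induction j generalizing Q n with
  | zero =>
    refine vHat_singular b ψ (m := -1) (by norm_num) ?_ (lie_pos_of_lie_one b fun r hr => ?_)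
    · rw [hL]
      refine recL_mem (fun m => ?_) n Q
      have := vHat_lie_mem b ψ ((-1 : ℤ) • b 0 + m • b 1) 0 (vac_mem b ψ)
      rwa [repr_comb_zero, add_zero] at this
    · have er : D r = E b 1 (b.repr r 1) := by
        rw [E, ← hr, ← repr_eq]
      rw [hL, er]
      have := map_recL (LieModule.toEnd ℂ L (VHat b ψ) (E b 1 (b.repr r 1)))
        (fun m => ⁅E b (-1) m, vac b ψ⁆) n Q
      simp only [LieModule.toEnd_apply_apply, lie_one_lie_neg_one b ψ hg hg0 hb] at this
      have h3 : (-(0 + 1 : ℕ) : ℤ) = -1 := by norm_num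
      rw [h3, this]
      have h4 := map_recL (LinearMap.toSpanSingleton ℂ (VHat b ψ)
        ((-(det (b 0) (b 1) : ℂ)) • vac b ψ)) g (b.repr r 1 + n) Q
      rw [recL_of_dvd hP (by simpa using hQ), map_zero] at h4
      rw [h4]
      simp only [recL_eq_sum, LinearMap.toSpanSingleton_apply, smul_smul, add_assoc]
      refine Finset.sum_congr rfl fun i _ => ?_
      congr 1
      ring
  | succ j ih =>
    refine vHat_singular b ψ (m := -(j + 1 + 1 : ℕ)) (by omega) ?_
      (lie_pos_of_lie_one b fun r hr => ?_)
    · rw [hL]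
      refine recL_mem (fun m => ?_) n Q
      have := vHat_lie_mem b ψ ((-(j + 1 + 1 : ℕ) : ℤ) • b 0 + m • b 1) 0 (vac_mem b ψ)
      rwa [repr_comb_zero, add_zero] at this
    · have er : D r = E b 1 (b.repr r 1) := by
        rw [E, ← hr, ← repr_eq]
      rw [leibniz_lie, vac_lie_pos b ψ (by omega), lie_zero, add_zero, er,
        lie_recL_E b (by push_cast; omega)]
      have e : (1 + -((j + 1 + 1 : ℕ) : ℤ)) = -((j + 1 : ℕ) : ℤ) := by push_cast; ring
      rw [e]
      refine ih _ (Dvd.dvd.mul_left (dvd_add (Dvd.dvd.mul_left ?_ _)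
        (Dvd.dvd.mul_left (Dvd.dvd.mul_left ?_ _) _)) _) _
      · exact (pow_dvd_pow P (Nat.le_succ _)).trans hQ
      · simpa only [Nat.add_sub_cancel] using pow_sub_one_dvd_derivative_of_pow_dvd hQ

/-- The vectors on which high powers of `P` act trivially in every negative level. -/
def PowNil (P : ℂ[X]) (w : VHat b ψ) : Prop := ∀ j : ℕ, ∃ K : ℕ, ∀ Q : ℂ[X], P ^ K ∣ Q → ∀ n,
  ⁅recL (E b (-(j + 1 : ℕ))) n Q, w⁆ = 0

variable {b ψ}

/-- Commuting past an element of level -1 leads one level further down and, because of the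
derivative in `lie_recL_E`, uses up one factor P. -/
theorem PowNil.lie {P : ℂ[X]} {w : VHat b ψ} (hw : PowNil b ψ P w) (k : ℤ) :
    PowNil b ψ P ⁅E b (-1) k, w⁆ := by
  intro j
  obtain ⟨K, hK⟩ := hw j
  obtain ⟨K', hK'⟩ := hw (j + 1)
  refine ⟨max K (K' + 1), fun Q hQ n => ?_⟩
  rw [leibniz_lie, hK Q ((pow_dvd_pow P (le_max_left _ _)).trans hQ), lie_zero, add_zero, ← lie_skew,
    neg_lie, lie_recL_E b (by push_cast; omega), neg_eq_zero]
  have e : (-1 + -((j + 1 : ℕ) : ℤ)) = -((j + 1 + 1 : ℕ) : ℤ) := by push_cast; ring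
  rw [e]
  have h1 : P ^ (K' + 1) ∣ Q := (pow_dvd_pow P (le_max_right _ _)).trans hQ
  refine hK' _ (Dvd.dvd.mul_left (dvd_add (Dvd.dvd.mul_left ?_ _)
    (Dvd.dvd.mul_left (Dvd.dvd.mul_left ?_ _) _)) _) _
  · exact (pow_dvd_pow P (Nat.le_succ _)).trans h1
  · simpa only [Nat.add_sub_cancel] using pow_sub_one_dvd_derivative_of_pow_dvd h1

theorem PowNil.add {P : ℂ[X]} {w w' : VHat b ψ} (hw : PowNil b ψ P w) (hw' : PowNil b ψ P w') :
    PowNil b ψ P (w + w') := by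
  intro j
  obtain ⟨K, hK⟩ := hw j
  obtain ⟨K', hK'⟩ := hw' j
  refine ⟨max K K', fun Q hQ n => ?_⟩
  rw [lie_add, hK Q ((pow_dvd_pow P (le_max_left _ _)).trans hQ),
    hK' Q ((pow_dvd_pow P (le_max_right _ _)).trans hQ), add_zero]

theorem PowNil.smul {P : ℂ[X]} {w : VHat b ψ} (hw : PowNil b ψ P w) (t : ℂ) :
    PowNil b ψ P (t • w) := by
  intro j
  obtain ⟨K, hK⟩ := hw j
  exact ⟨K, fun Q hQ n => by rw [lie_smul, hK Q hQ, smul_zero]⟩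

variable (b ψ)

/-- The span of the products of `m` elements of level `-1` applied to `v₀`. -/
def lowSpan : ℕ → Submodule ℂ (VHat b ψ)
  | 0 => Submodule.span ℂ {vac b ψ}
  | m + 1 => Submodule.span ℂ {x | ∃ k, ∃ y ∈ lowSpan m, x = ⁅E b (-1) k, y⁆}

theorem lie_mem_lowSpan (k : ℤ) {m : ℕ} {y : VHat b ψ} (hy : y ∈ lowSpan b ψ m) :
    ⁅E b (-1) k, y⁆ ∈ lowSpan b ψ (m + 1) := Submodule.subset_span ⟨k, y, hy, rfl⟩

/-- By `exists_split` level -1 generates all negative levels, so products of operators of level -1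
suffice to span V̂⁺(ψ). -/
theorem lie_neg_mem_lowSpan (j : ℕ) (r : Gam) (hr : b.repr r 0 = -(j + 1 : ℕ)) {m : ℕ}
    {y : VHat b ψ} (hy : y ∈ lowSpan b ψ m) : ⁅D r, y⁆ ∈ lowSpan b ψ (m + (j + 1)) := by
  induction j generalizing r m y with
  | zero =>
    have er : D r = E b (-1) (b.repr r 1) := by
      have h1 : b.repr r 0 = -1 := by simpa using hr
      rw [E, ← h1, ← repr_eq]
    rw [er]
    exact lie_mem_lowSpan b ψ _ hy
  | succ j ih =>
    obtain ⟨r₁, r₂, h3, h4, rfl, h6⟩ := exists_split b (j := j + 1) (Or.inr rfl) (by omega) (r := r)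
      (by rw [hr]; push_cast; ring)
    have er : D r₁ = E b (-1) (b.repr r₁ 1) := by
      rw [E, ← h3, ← repr_eq]
    have h4' : b.repr r₂ 0 = -(j + 1 : ℕ) := by rw [h4]; push_cast; ring
    rw [lie_add_of_det_ne h6, er]
    refine Submodule.smul_mem _ _ (sub_mem (lie_mem_lowSpan b ψ _ (ih r₂ h4' hy)) ?_)
    have := ih r₂ h4' (lie_mem_lowSpan b ψ (b.repr r₁ 1) hy)
    have e : m + 1 + (j + 1) = m + (j + 1 + 1) := by ring
    rwa [e] at this

theorem lie_nonneg_mem_lowSpan (m : ℕ) (j : ℕ) (r : Gam) (hr : b.repr r 0 = j) {y : VHat b ψ}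
    (hy : y ∈ lowSpan b ψ m) : (m < j → ⁅D r, y⁆ = 0) ∧
      (j ≤ m → ⁅D r, y⁆ ∈ lowSpan b ψ (m - j)) := by
  induction m generalizing j r y with
  | zero =>
    obtain ⟨c, rfl⟩ := Submodule.mem_span_singleton.1 hy
    refine ⟨fun hj => ?_, fun hj => ?_⟩
    · rw [lie_smul, vac_lie_pos b ψ (by omega), smul_zero]
    · obtain rfl : j = 0 := by omega
      rw [lie_smul, vac_lie_zero b ψ (by simpa using hr)]
      exact Submodule.smul_mem _ _ (Submodule.smul_mem _ _ (Submodule.mem_span_singleton_self _))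
  | succ m ih =>
    rw [lowSpan] at hy
    induction hy using Submodule.span_induction with
    | mem x hx =>
      obtain ⟨k, y, hy, rfl⟩ := hx
      have h1 := ih j r hr hy
      have hlvl : b.repr (r + ((-1 : ℤ) • b 0 + k • b 1)) 0 = j - 1 := by
        rw [map_add, Finsupp.add_apply, repr_comb_zero, hr]; ring
      have e : ⁅D r, ⁅E b (-1) k, y⁆⁆ = ⁅E b (-1) k, ⁅D r, y⁆⁆ +
          (-(det r ((-1 : ℤ) • b 0 + k • b 1) : ℂ)) • ⁅D (r + ((-1 : ℤ) • b 0 + k • b 1)), y⁆ +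
          if r + ((-1 : ℤ) • b 0 + k • b 1) = 0 then ⁅h r, y⁆ else 0 := by
        rw [E, lie_lie_D]
      rw [e]
      refine ⟨fun hj => ?_, fun hj => ?_⟩
      · have h2 := (ih (j - 1) _ (by rw [hlvl]; omega) hy).1 (by omega)
        rw [h1.1 (by omega), h2, lie_zero, smul_zero, zero_add, zero_add, if_neg]
        intro H
        rw [H, LinearEquiv.map_zero, Finsupp.zero_apply] at hlvl
        omega
      · refine add_mem (add_mem ?_ (Submodule.smul_mem _ _ ?_)) ?_
        · rcases Nat.lt_or_ge m j with hmj | hmj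
          · rw [h1.1 hmj, lie_zero]; exact zero_mem _
          · have := lie_mem_lowSpan b ψ k (h1.2 hmj)
            rwa [← Nat.sub_add_comm hmj] at this
        · rcases j with _ | j
          · exact lie_neg_mem_lowSpan b ψ 0 _ (by rw [hlvl]; simp) hy
          · have := (ih j _ (by rw [hlvl]; push_cast; ring) hy).2 (by omega)
            have e : m + 1 - (j + 1) = m - j := by omega
            rwa [e]
        · split_ifs with H
          · rw [H, LinearEquiv.map_zero, Finsupp.zero_apply] at hlvl
            rw [vHat_lie_h]
            have e : m + 1 - j = m := by omega
            rw [e]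
            exact Submodule.smul_mem _ _ hy
          · exact zero_mem _
    | zero => simp
    | add x y _ _ hx hy =>
      refine ⟨fun hj => ?_, fun hj => ?_⟩
      · rw [lie_add, hx.1 hj, hy.1 hj, add_zero]
      · rw [lie_add]; exact add_mem (hx.2 hj) (hy.2 hj)
    | smul a x _ hx =>
      refine ⟨fun hj => ?_, fun hj => ?_⟩
      · rw [lie_smul, hx.1 hj, smul_zero]
      · rw [lie_smul]; exact Submodule.smul_mem _ _ (hx.2 hj)

theorem lowSpan_le (m : ℕ) : lowSpan b ψ m ≤ vHatDeg b ψ (-m) := by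
  induction m with
  | zero =>
    rw [lowSpan, Nat.cast_zero, neg_zero, vHatDeg_zero]
  | succ m ih =>
    rw [lowSpan, Submodule.span_le]
    rintro _ ⟨k, y, hy, rfl⟩
    have := vHat_lie_mem b ψ ((-1 : ℤ) • b 0 + k • b 1) _ (ih hy)
    rw [repr_comb_zero] at this
    have e : (-1 : ℤ) + -(m : ℤ) = -((m + 1 : ℕ) : ℤ) := by push_cast; ring
    rwa [e] at this

theorem iSup_lowSpan : ⨆ m, lowSpan b ψ m = ⊤ := by
  have hD : ∀ r, ∀ v ∈ ⨆ m, lowSpan b ψ m, ⁅D r, v⁆ ∈ ⨆ m, lowSpan b ψ m := by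
    intro r v hv
    induction hv using Submodule.iSup_induction' with
    | mem m x hx =>
      rcases le_or_gt 0 (b.repr r 0) with hr | hr
      · obtain ⟨j, hj⟩ := Int.eq_ofNat_of_zero_le hr
        have := lie_nonneg_mem_lowSpan b ψ m j r hj hx
        rcases Nat.lt_or_ge m j with hmj | hmj
        · rw [this.1 hmj]; exact zero_mem _
        · exact Submodule.mem_iSup_of_mem _ (this.2 hmj)
      · exact Submodule.mem_iSup_of_mem _ (lie_neg_mem_lowSpan b ψ (-(b.repr r 0) - 1).toNat r
          (by push_cast; omega) hx)
    | zero => rw [lie_zero]; exact zero_mem _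
    | add x y _ _ hx hy => rw [lie_add]; exact add_mem hx hy
  have : gen (vac b ψ) ≤ lieSubOfD _ hD := gen_le
    (Submodule.mem_iSup_of_mem 0 (Submodule.mem_span_singleton_self _))
  rw [gen_vac] at this
  exact eq_top_iff.2 fun x _ => this (by trivial)

theorem vHatDeg_eq_lowSpan (m : ℕ) : vHatDeg b ψ (-m) = lowSpan b ψ m := by
  obtain ⟨π, hπ⟩ := vHatDeg_gradProj b ψ
  let Y : ℤ → Submodule ℂ (VHat b ψ) := fun n => if n ≤ 0 then lowSpan b ψ (-n).toNat else ⊥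
  have hY : ∀ n, Y n ≤ vHatDeg b ψ n := by
    intro n
    simp only [Y]
    split_ifs with hn
    · have := lowSpan_le b ψ (-n).toNat
      have e : (-((-n).toNat : ℤ)) = n := by omega
      rwa [e] at this
    · exact bot_le
  have hm : ∀ m : ℕ, Y (-m) = lowSpan b ψ m := by
    intro m
    simp only [Y]
    rw [if_pos (by omega)]
    congr 1
    omega
  have htop : ⨆ n, Y n = ⊤ := by
    rw [eq_top_iff, ← iSup_lowSpan b ψ]
    exact iSup_le fun m => by rw [← hm]; exact le_iSup Y _
  rw [← hπ.eq_of_le hY htop, hm]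

/-- Level m + 1 is the sum, over finitely many generators y of level m, of the spans of the
sequences k ↦ D(-b₁ + k b₂) y, each of which satisfies a two-sided recurrence given by a power of P.
The property `PowNil` is carried along the induction. -/
theorem lowSpan_fg {P : ℂ[X]} (hP : P.Monic) (h0 : P.coeff 0 ≠ 0)
    (hv : PowNil b ψ P (vac b ψ)) (m : ℕ) :
    (lowSpan b ψ m).FG ∧ ∀ w ∈ lowSpan b ψ m, PowNil b ψ P w := by
  have hz : PowNil b ψ P 0 := fun j => ⟨0, fun Q _ n => lie_zero _⟩
  induction m with
  | zero =>
    refine ⟨Submodule.fg_span_singleton _, fun w hw => ?_⟩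
    obtain ⟨c, rfl⟩ := Submodule.mem_span_singleton.1 hw
    exact hv.smul c
  | succ m ih =>
    obtain ⟨S, hS⟩ := ih.1
    constructor
    · have e : lowSpan b ψ (m + 1) = ⨆ y ∈ S, Submodule.span ℂ (Set.range fun k => ⁅E b (-1) k, y⁆) := by
        refine le_antisymm ?_ (iSup₂_le fun y hy => Submodule.span_le.2 ?_)
        · rw [lowSpan, Submodule.span_le]
          rintro _ ⟨k, y, hy, rfl⟩
          rw [← hS] at hy
          induction hy using Submodule.span_induction with
          | mem y hy =>
            exact Submodule.mem_iSup_of_mem y (Submodule.mem_iSup_of_mem hy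
              (Submodule.subset_span ⟨k, rfl⟩))
          | zero => rw [lie_zero]; exact zero_mem _
          | add x y _ _ hx hy => rw [lie_add]; exact add_mem hx hy
          | smul a x _ hx => rw [lie_smul]; exact Submodule.smul_mem _ a hx
        · rintro _ ⟨k, rfl⟩
          exact lie_mem_lowSpan b ψ k (hS ▸ Submodule.subset_span hy)
      rw [e]
      refine Submodule.fg_biSup S _ fun y hy => ?_
      obtain ⟨K, hK⟩ := ih.2 y (hS ▸ Submodule.subset_span hy) 0
      refine fg_span_of_recurrence (hP.pow K) ?_ fun n => ?_
      · rw [coeff_zero_eq_eval_zero, eval_pow, ← coeff_zero_eq_eval_zero]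
        exact pow_ne_zero _ h0
      · have := hK _ dvd_rfl n
        have e : (-(0 + 1 : ℕ) : ℤ) = -1 := by norm_num
        rw [e] at this
        rw [← this]
        exact (map_recL (lieAt y) (E b (-1)) n _).symm
    · intro w hw
      rw [lowSpan] at hw
      induction hw using Submodule.span_induction with
      | mem x hx =>
        obtain ⟨k, y, hy, rfl⟩ := hx
        exact (ih.2 y hy).lie k
      | zero => exact hz
      | add x y _ _ hx hy => exact hx.add hy
      | smul a x _ hx => exact hx.smul a

/-- For an exp-polynomial function `ψ` the levels of `V̂⁺(ψ)` are finite-dimensional. -/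
theorem vHatDeg_fg (hψ : IsExpPolynomial b ψ) (m : ℤ) : (vHatDeg b ψ m).FG := by
  obtain ⟨-, hb, r, p, α, hα, hp, hp0⟩ := hψ
  obtain ⟨P, hP, h0, hrec⟩ := exists_recurrence p α hα
  have hv : PowNil b ψ P (vac b ψ) := fun j => ⟨j + 1, fun Q hQ n =>
    recL_vac_eq_zero hp (by rw [hp0]; simp [coeff_zero_eq_eval_zero]) hb hrec j Q hQ n⟩
  rcases lt_or_ge 0 m with hm | hm
  · rw [vHatDeg_pos b ψ hm]
    exact Submodule.fg_bot
  · have e : m = -((-m).toNat : ℤ) := by omega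
    rw [e, vHatDeg_eq_lowSpan]
    exact (lowSpan_fg b ψ hP h0 hv _).1

theorem vBarDeg_fg (hψ : IsExpPolynomial b ψ) (i : ℤ) (γ : Gam) : (vBarDeg b ψ i γ).FG :=
  ((vHatDeg_fg b ψ hψ _).map _).map _

end Quasifinite


/-! ## Gradings of the Laurent polynomials -/

section Laurent

open LaurentPolynomial

/-- A unit of the Laurent polynomials is a monomial. -/
theorem eq_smul_T_of_mul_eq_one {f g : ℂ[T;T⁻¹]} (h : f * g = 1) :
    ∃ (c : ℂ) (n : ℤ), f = c • (T n : ℂ[T;T⁻¹]) := by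
  obtain ⟨m, F, hF⟩ := exists_T_pow f
  obtain ⟨n, G, hG⟩ := exists_T_pow g
  -- After clearing denominators F is a polynomial divisor of a power of X, hence associated to a
  -- power of the prime X.
  have hFG : F * G = Polynomial.X ^ (m + n) := by
    apply Polynomial.toLaurent_injective
    rw [map_mul, hF, hG, Polynomial.toLaurent_X_pow, Nat.cast_add, T_add]
    calc f * T (m : ℤ) * (g * T (n : ℤ)) = f * g * (T (m : ℤ) * T (n : ℤ)) := by ring
      _ = _ := by rw [h, one_mul]
  obtain ⟨k, -, hk⟩ := (dvd_prime_pow Polynomial.prime_X (m + n)).1 ⟨G, hFG.symm⟩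
  obtain ⟨u, hu⟩ := hk
  obtain ⟨c, -, hc⟩ := Polynomial.isUnit_iff.1 (u⁻¹).isUnit
  have hF' : F = Polynomial.C c * Polynomial.X ^ k := by
    rw [hc, ← hu, mul_comm F, ← mul_assoc, Units.inv_mul, one_mul]
  refine ⟨c, k - m, ?_⟩
  have h1 : f = f * T (m : ℤ) * T (-(m : ℤ)) := by
    rw [mul_T_assoc, add_neg_cancel, T_zero, mul_one]
  rw [h1, ← hF, hF', Polynomial.toLaurent_C_mul_X_pow, mul_T_assoc, smul_eq_C_mul, sub_eq_add_neg]

variable {ι : Type*} [AddCommGroup ι] {𝒢 : ι → Submodule ℂ ℂ[T;T⁻¹]}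
  {π : ι → ℂ[T;T⁻¹] →ₗ[ℂ] ℂ[T;T⁻¹]}

/-- The T^n u are homogeneous of the pairwise distinct degrees γ + n a, so f u = ∑ f_n T^n u is
already its decomposition into components. -/
theorem proj_mul (hπ : GradProj 𝒢 π) {a : ι} (ha : ∀ n : ℤ, n • a = 0 → n = 0)
    (hT : ∀ (n : ℤ) (γ : ι), ∀ f ∈ 𝒢 γ, T n * f ∈ 𝒢 (γ + n • a)) {γ : ι} {u : ℂ[T;T⁻¹]}
    (hu : u ∈ 𝒢 γ) (f : ℂ[T;T⁻¹]) (δ : ι) :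
    (∀ n : ℤ, δ = γ + n • a → π δ (f * u) = f.coeff n • (T n * u)) ∧
      ((∀ n : ℤ, δ ≠ γ + n • a) → π δ (f * u) = 0) := by
  induction f using LaurentPolynomial.induction_on' with
  | add p q hp hq =>
    refine ⟨fun n hn => ?_, fun hδ => ?_⟩
    · rw [add_mul, map_add, hp.1 n hn, hq.1 n hn, AddMonoidAlgebra.coeff_add, Finsupp.add_apply,
        add_smul]
    · rw [add_mul, map_add, hp.2 hδ, hq.2 hδ, add_zero]
  | C_mul_T k c =>
    rw [← smul_eq_C_mul, smul_mul_assoc, map_smul]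
    refine ⟨fun n hn => ?_, fun hδ => ?_⟩
    · rw [AddMonoidAlgebra.coeff_smul_apply, T_apply]
      split_ifs with hkn
      · rw [← hkn, hπ.same, smul_eq_mul, mul_one]
        rw [hn, ← hkn]
        exact hT _ _ _ hu
      · rw [hπ.ne δ (γ + k • a) _ _ (hT _ _ _ hu), smul_zero, smul_zero, zero_smul]
        rw [hn]
        intro H
        have := ha (n - k) (by rw [sub_smul, add_left_cancel H, sub_self])
        exact hkn (by omega)
    · rw [hπ.ne δ (γ + k • a) (hδ k) _ (hT _ _ _ hu), smul_zero]

/-- In a grading of the Laurent polynomials for which `T` is homogeneous of nonzero degree, `1` is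
homogeneous. -/
theorem one_homogeneous (hπ : GradProj 𝒢 π) {a : ι} (ha : ∀ n : ℤ, n • a = 0 → n = 0)
    (hT : ∀ (n : ℤ) (γ : ι), ∀ f ∈ 𝒢 γ, T n * f ∈ 𝒢 (γ + n • a)) : ∃ γ, (1 : ℂ[T;T⁻¹]) ∈ 𝒢 γ := by
  obtain ⟨γ₀, h0⟩ := hπ.exists_ne (one_ne_zero (α := ℂ[T;T⁻¹]))
  set u := π γ₀ 1 with hu
  have hu0 : u ∈ 𝒢 γ₀ := hπ.apply_mem _ _
  -- The product of u and another nonzero component of 1 is nonzero and can be decomposed in two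
  -- ways, as multiples of the T^n u and of the T^m π_γ(1). Comparing a nonzero component shows that
  -- π_γ(1) is a monomial times u.
  have key : ∀ γ, π γ 1 ∈ (Ideal.span {u}).restrictScalars ℂ := by
    intro γ
    by_cases hγ : π γ 1 = 0
    · rw [hγ]; exact zero_mem _
    obtain ⟨δ, hδ⟩ := hπ.exists_ne (mul_ne_zero hγ h0)
    have h1 := proj_mul hπ ha hT hu0 (π γ 1) δ
    have h2 := proj_mul hπ ha hT (hπ.apply_mem γ 1) u δ
    obtain ⟨n, hn⟩ : ∃ n : ℤ, δ = γ₀ + n • a := by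
      by_contra! H
      exact hδ (h1.2 H)
    rw [mul_comm u] at h2
    obtain ⟨m, hm⟩ : ∃ m : ℤ, δ = γ + m • a := by
      by_contra! H
      exact hδ (h2.2 H)
    have e1 := h1.1 n hn
    have e2 := h2.1 m hm
    rw [e2] at e1 hδ
    have hc : u.coeff m ≠ 0 := fun H => hδ (by rw [H, zero_smul])
    change π γ 1 ∈ Ideal.span {u}
    have e3 : π γ 1 = (C (u.coeff m)⁻¹ * T (-m) * (C ((π γ 1).coeff n) * T n)) * u := by
      have : T m * π γ 1 = (u.coeff m)⁻¹ • ((π γ 1).coeff n • (T n * u)) := by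
        rw [← e1, smul_smul, inv_mul_cancel₀ hc, one_smul]
      calc π γ 1 = T (-m) * (T m * π γ 1) := by
            rw [← mul_assoc, ← T_add, neg_add_cancel, T_zero, one_mul]
        _ = _ := by
            rw [this, smul_eq_C_mul, smul_eq_C_mul]
            ring
    rw [e3]
    exact Ideal.mul_mem_left _ _ (Ideal.mem_span_singleton_self u)
  have h1 : (1 : ℂ[T;T⁻¹]) ∈ Ideal.span {u} :=
    hπ.mem_of_forall (N := (Ideal.span {u}).restrictScalars ℂ) key
  obtain ⟨g, hg⟩ := Ideal.mem_span_singleton'.1 h1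
  -- Thus 1 lies in the ideal of u, so u is a unit with monomial inverse g, and 1 = g u is
  -- homogeneous.
  obtain ⟨c, n, hcn⟩ := eq_smul_T_of_mul_eq_one hg
  refine ⟨γ₀ + n • a, ?_⟩
  rw [← hg, hcn, smul_mul_assoc]
  exact (𝒢 _).smul_mem _ (hT _ _ _ hu0)

end Laurent

/-! ## The highest weight vectors of `V̄(ψ, i, s)` -/

/-- The vectors of `V` annihilated by the elements of positive level. -/
def highest (b : Module.Basis (Fin 2) ℤ Gam) (V : Type*) [AddCommGroup V] [Module ℂ V]
    [LieRingModule L V] [LieModule ℂ L V] : Submodule ℂ V where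
  carrier := {w | ∀ r, 0 < b.repr r 0 → ⁅D r, w⁆ = 0}
  add_mem' hx hy r hr := by rw [lie_add, hx r hr, hy r hr, add_zero]
  zero_mem' r _ := lie_zero _
  smul_mem' c x hx r hr := by rw [lie_smul, hx r hr, smul_zero]

section Highest

variable {V : Type*} [AddCommGroup V] [Module ℂ V] [LieRingModule L V] [LieModule ℂ L V]
  (b : Module.Basis (Fin 2) ℤ Gam)

theorem highest_lie_zero {r : Gam} (hr : b.repr r 0 = 0) {w : V} (hw : w ∈ highest b V) :
    ⁅D r, w⁆ ∈ highest b V := by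
  intro r' hr'
  have h1 : b.repr (r' + r) 0 = b.repr r' 0 := by rw [map_add, Finsupp.add_apply, hr, add_zero]
  rw [lie_lie_D, hw r' hr', lie_zero, hw _ (h1 ▸ hr'), smul_zero, zero_add, zero_add, if_neg]
  intro H
  rw [H, LinearEquiv.map_zero, Finsupp.zero_apply] at h1
  omega

theorem highest_lie_h (m : Gam) {w : V} (hw : w ∈ highest b V) : ⁅h m, w⁆ ∈ highest b V := by
  intro r hr
  rw [← lie_D_comm (h m) (h_central m), hw r hr, lie_zero]

theorem act_highest_vector (l : List Gam) {w : V} (hw : w ∈ highest b V) :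
    (0 < b.repr l.sum 0 → act V l w = 0) ∧ (b.repr l.sum 0 = 0 → act V l w ∈ highest b V) :=
  act_top b (fun _ => highest b V) (fun _ hr _ _ hx => hx _ hr)
    (fun _ hr _ _ hx => highest_lie_zero b hr hx) (fun m _ _ hx => highest_lie_h b m hx) l 0 w hw

/-- The conditions defining `highest` are homogeneous for any grading with D(r) of degree r, not
only for the standard one. -/
theorem highest_proj {𝒢 : Gam → Submodule ℂ V} {π : Gam → V →ₗ[ℂ] V} (hπ : GradProj 𝒢 π)
    (hD : ∀ m n, ∀ v ∈ 𝒢 n, ⁅D m, v⁆ ∈ 𝒢 (m + n)) {w : V} (hw : w ∈ highest b V) (γ : Gam) :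
    π γ w ∈ highest b V := by
  intro r hr
  have key : ∀ w : V, ⁅D r, π γ w⁆ = π (r + γ) ⁅D r, w⁆ := by
    intro w
    have hw : w ∈ ⨆ i, 𝒢 i := hπ.span ▸ Submodule.mem_top
    induction hw using Submodule.iSup_induction' with
    | mem δ x hx =>
      by_cases h : γ = δ
      · rw [← h] at hx
        rw [hπ.same γ x hx, hπ.same _ _ (hD r γ x hx)]
      · rw [hπ.ne γ δ h x hx, hπ.ne _ (r + δ) (by simpa using h) _ (hD r δ x hx), lie_zero]
    | zero => rw [map_zero, lie_zero, map_zero]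
    | add x y _ _ hx hy => rw [map_add, lie_add, hx, hy, lie_add, map_add]
  rw [key, hw r hr, map_zero]

variable (ψ : L0 b →ₗ[ℂ] ℂ)

theorem vBark_mem_highest (i k : ℤ) : vBark b ψ i k ∈ highest b (VBar b ψ i) :=
  fun _ hr => vBark_lie_pos b ψ hr i k

theorem vBark_eq_zero {s : ℕ} (hs : Steps b ψ s) {i j : ℤ} (hij : ¬ (s : ℤ) ∣ j - i) :
    vBark b ψ i j = 0 :=
  (toVBar_eq_zero b ψ i _).2 (gen_vk_le b ψ hs hij (self_mem_gen _))

theorem vBark_ne_zero_of_dvd {s : ℕ} (hs : Steps b ψ s) (hv : vac b ψ ≠ 0) {i j : ℤ}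
    (hij : (s : ℤ) ∣ j - i) : vBark b ψ i j ≠ 0 := by
  intro H
  obtain ⟨σ, h1, h2⟩ := hs.2 (i - j) (by rwa [← neg_sub, dvd_neg])
  have := act_vBark b ψ σ i j
  rw [H, LinearMap.map_zero, h1, add_sub_cancel] at this
  exact smul_ne_zero h2 (vBark_ne_zero b ψ hv i) this.symm

/-- The highest weight vectors of `V̄(ψ, i, s)` are the combinations of the images of the
`v₀ ⊗ t^k`. -/
theorem highest_vBar_le {s : ℕ} (hs : Steps b ψ s) (hv : vac b ψ ≠ 0) (i : ℤ) :
    highest b (VBar b ψ i) ≤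
      Submodule.span ℂ {x | ∃ n : ℤ, x = vBark b ψ i (i + n * s)} := by
  intro w hw
  obtain ⟨ρ, hρ⟩ := vBarDeg_gradProj b ψ i
  have hD := vBar_lie_mem b ψ i
  refine hρ.mem_of_forall fun γ => ?_
  have hw' := highest_proj b hρ hD hw γ
  have hγ := hρ.apply_mem γ w
  generalize ρ γ w = w' at hw' hγ
  rcases lt_trichotomy (b.repr γ 0) 0 with h0 | h0 | h0
  · by_cases hw0 : w' = 0
    · rw [hw0]; exact zero_mem _
    exfalso
    -- A nonzero highest weight vector of negative level would generate V̄, so v₀ ⊗ t^i would arise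
    -- from it by words of positive level, which kill it.
    have htop := gen_eq_top hρ hD (vBar_irreducible b ψ hs i) hγ hw0
    have h1 := component_eq_span hρ hD hγ htop (i • b 1 - γ)
    have h2 := vBark_mem b ψ i i
    rw [sub_add_cancel] at h1
    rw [h1] at h2
    refine vBark_ne_zero b ψ hv i ((Submodule.mem_bot ℂ).1 (Submodule.span_le.2 ?_ h2))
    rintro _ ⟨l, hl, rfl⟩
    refine (act_highest_vector b l hw').1 ?_
    rw [hl, map_sub, Finsupp.sub_apply, repr_smul_zero]
    omega
  · rw [eq_smul_of_lvl_zero b h0, vBarDeg, vPsiDeg_top, Submodule.map_span, Set.image_singleton] at hγ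
    obtain ⟨c, rfl⟩ := Submodule.mem_span_singleton.1 hγ
    refine Submodule.smul_mem _ _ ?_
    change vBark b ψ i _ ∈ _
    by_cases hd : (s : ℤ) ∣ b.repr γ 1 - i
    · obtain ⟨n, hn⟩ := hd
      refine Submodule.subset_span ⟨n, ?_⟩
      congr 1
      linarith
    · rw [vBark_eq_zero b ψ hs hd]; exact zero_mem _
  · rw [vBarDeg, vPsiDeg, vHatDeg_pos b ψ h0, Submodule.map_bot, Submodule.map_bot] at hγ
    rw [(Submodule.mem_bot ℂ).1 hγ]
    exact zero_mem _

/-- The map `T^n ↦ v₀ ⊗ t^(i + n s)`. -/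
def topMap (s : ℕ) (i : ℤ) : ℂ[T;T⁻¹] →ₗ[ℂ] VBar b ψ i where
  toFun f := Finsupp.linearCombination ℂ (fun n : ℤ => vBark b ψ i (i + n * s)) f.coeff
  map_add' f g := by rw [AddMonoidAlgebra.coeff_add, map_add]
  map_smul' c f := by rw [AddMonoidAlgebra.coeff_smul, map_smul, RingHom.id_apply]

theorem topMap_T (s : ℕ) (i n : ℤ) :
    topMap b ψ s i (LaurentPolynomial.T n) = vBark b ψ i (i + n * s) := by
  change Finsupp.linearCombination ℂ _ (Finsupp.single n (1 : ℂ)) = _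
  rw [Finsupp.linearCombination_single, one_smul]

theorem topMap_mem_highest (s : ℕ) (i : ℤ) (f : ℂ[T;T⁻¹]) :
    topMap b ψ s i f ∈ highest b (VBar b ψ i) := by
  induction f using LaurentPolynomial.induction_on' with
  | add p q hp hq => rw [map_add]; exact add_mem hp hq
  | C_mul_T n a =>
    rw [← LaurentPolynomial.smul_eq_C_mul, map_smul, topMap_T]
    exact Submodule.smul_mem _ _ (vBark_mem_highest b ψ i _)

theorem topMap_injective {s : ℕ} (hs0 : 0 < s) (hs : Steps b ψ s) (hv : vac b ψ ≠ 0) (i : ℤ) :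
    Function.Injective (topMap b ψ s i) := by
  obtain ⟨ρ, hρ⟩ := vBarDeg_gradProj b ψ i
  have key : ∀ (f : ℂ[T;T⁻¹]) (n : ℤ), ρ ((i + n * s) • b 1) (topMap b ψ s i f) =
      f.coeff n • vBark b ψ i (i + n * s) := by
    intro f n
    induction f using LaurentPolynomial.induction_on' with
    | add p q hp hq =>
      rw [map_add, map_add, hp, hq, AddMonoidAlgebra.coeff_add, Finsupp.add_apply, add_smul]
    | C_mul_T k a =>
      rw [← LaurentPolynomial.smul_eq_C_mul, map_smul, map_smul, topMap_T,
        AddMonoidAlgebra.coeff_smul_apply, LaurentPolynomial.T_apply]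
      split_ifs with h
      · rw [h, hρ.same _ _ (vBark_mem b ψ i _), smul_eq_mul, mul_one]
      · rw [hρ.ne _ _ _ _ (vBark_mem b ψ i _), smul_zero, smul_zero, zero_smul]
        intro H
        have := congrArg (fun x => b.repr x 1) H
        simp only [repr_smul_one] at this
        have h3 : (n - k) * (s : ℤ) = 0 := by linarith
        rcases mul_eq_zero.1 h3 with h4 | h4
        · exact h (by omega)
        · omega
  refine (injective_iff_map_eq_zero _).2 fun f hf => ?_
  refine LaurentPolynomial.ext fun n => ?_
  have := key f n
  rw [hf, map_zero] at this
  refine (smul_eq_zero.1 this.symm).resolve_right (vBark_ne_zero_of_dvd b ψ hs hv ?_)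
  exact ⟨n, by ring⟩

/-- In every grading of `V̄(ψ, i, s)` the vector `v₀ ⊗ t^i` is homogeneous. -/
theorem vBark_homogeneous {s : ℕ} (hs0 : 0 < s) (hs : Steps b ψ s) (hv : vac b ψ ≠ 0) (i : ℤ)
    {𝒢 : Gam → Submodule ℂ (VBar b ψ i)} {π : Gam → VBar b ψ i →ₗ[ℂ] VBar b ψ i}
    (hπ : GradProj 𝒢 π) (hD : ∀ m n, ∀ v ∈ 𝒢 n, ⁅D m, v⁆ ∈ 𝒢 (m + n)) :
    ∃ γ, vBark b ψ i i ∈ 𝒢 γ := by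
  let φ := topMap b ψ s i
  have hinj := topMap_injective b ψ hs0 hs hv i
  have hrange : ∀ w ∈ highest b (VBar b ψ i), w ∈ LinearMap.range φ := by
    intro w hw
    refine Submodule.span_le.2 ?_ (highest_vBar_le b ψ hs hv i hw)
    rintro _ ⟨n, rfl⟩
    exact ⟨_, topMap_T b ψ s i n⟩
  -- The space of highest weight vectors is defined without a grading and equals the range of φ, so
  -- any grading of V̄ restricts to it and is carried over to the Laurent polynomials.
  let e := LinearEquiv.ofInjective φ hinj
  let π' : Gam → ℂ[T;T⁻¹] →ₗ[ℂ] ℂ[T;T⁻¹] := fun γ => e.symm.toLinearMap ∘ₗ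
    (π γ ∘ₗ φ).codRestrict _ (fun f =>
      hrange _ (highest_proj b hπ hD (topMap_mem_highest b ψ s i f) γ))
  have hπ' : ∀ γ f, φ (π' γ f) = π γ (φ f) := by
    intro γ f
    have := e.apply_symm_apply ((π γ ∘ₗ φ).codRestrict (LinearMap.range φ) (fun f =>
      hrange _ (highest_proj b hπ hD (topMap_mem_highest b ψ s i f) γ)) f)
    exact congrArg Subtype.val this
  have hG : GradProj (fun γ => (𝒢 γ).comap φ) π' := by
    refine ⟨fun γ f hf => hinj ?_, fun γ δ hγδ f hf => hinj ?_, ?_⟩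
    · exact (hπ' γ f).trans (hπ.same γ _ hf)
    · exact ((hπ' γ f).trans (hπ.ne γ δ hγδ _ hf)).trans (map_zero φ).symm
    · refine eq_top_iff.2 fun f _ => ?_
      have : φ f ∈ (⨆ γ, (𝒢 γ).comap φ).map φ := hπ.mem_of_forall fun γ => by
        refine ⟨π' γ f, Submodule.mem_iSup_of_mem γ ?_, hπ' γ f⟩
        change φ _ ∈ 𝒢 γ
        rw [hπ']
        exact hπ.apply_mem _ _
      obtain ⟨g, hg, hgf⟩ := this
      rwa [hinj hgf] at hg
  -- On the range of φ a product of the D(j b₂) of total n s and nonzero weight is a multiple of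
  -- multiplication by T^n. Hence T^n shifts degrees by n s b₂ in every grading.
  have hT : ∀ (n : ℤ) (γ : Gam), ∀ f ∈ (𝒢 γ).comap φ,
      LaurentPolynomial.T n * f ∈ (𝒢 (γ + n • ((s : ℤ) • b 1))).comap φ := by
    intro n γ f hf
    obtain ⟨σ, h1, h2⟩ := hs.2 (n * s) ⟨n, by ring⟩
    have key : ∀ f, φ (LaurentPolynomial.T n * f) =
        (wt b ψ σ)⁻¹ • act (VBar b ψ i) (σ.map fun j => j • b 1) (φ f) := by
      intro f
      induction f using LaurentPolynomial.induction_on' with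
      | add p q hp hq => rw [mul_add, map_add, hp, hq, map_add, map_add, smul_add]
      | C_mul_T k a =>
        rw [← LaurentPolynomial.smul_eq_C_mul, mul_smul_comm, map_smul, map_smul, map_smul,
          ← LaurentPolynomial.T_add, topMap_T, topMap_T, act_vBark, h1, ← smul_comm a, smul_smul _ (wt b ψ σ),
          inv_mul_cancel₀ h2, one_smul]
        congr 2
        ring
    change φ _ ∈ 𝒢 _
    rw [key]
    refine Submodule.smul_mem _ _ ?_
    have := act_mem hD (σ.map fun j => j • b 1) hf
    rwa [sum_map_smul, h1, add_comm, mul_smul] at this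
  have ha : ∀ n : ℤ, n • ((s : ℤ) • b 1) = 0 → n = 0 := by
    intro n hn
    rw [smul_smul] at hn
    have := congrArg (fun x => b.repr x 1) hn
    simp only [repr_smul_one, LinearEquiv.map_zero, Finsupp.zero_apply] at this
    rcases mul_eq_zero.1 this with h | h
    · exact h
    · omega
  obtain ⟨γ, hγ⟩ := one_homogeneous hG ha hT
  refine ⟨γ, ?_⟩
  have h1 : φ 1 = vBark b ψ i i := by
    have := topMap_T b ψ s i 0
    rwa [LaurentPolynomial.T_zero, zero_mul, add_zero] at this
  rw [← h1]
  exact hγ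

/-- The grading of `V̄(ψ, i, s)` is unique up to a shift. -/
theorem grading_vBar_unique {s : ℕ} (hs0 : 0 < s) (hs : Steps b ψ s) (hv : vac b ψ ≠ 0) (i : ℤ)
    {𝒢 : Gam → Submodule ℂ (VBar b ψ i)} {π : Gam → VBar b ψ i →ₗ[ℂ] VBar b ψ i}
    (hπ : GradProj 𝒢 π) (hD : ∀ m n, ∀ v ∈ 𝒢 n, ⁅D m, v⁆ ∈ 𝒢 (m + n)) :
    ∃ d, ∀ γ, 𝒢 γ = vBarDeg b ψ i (γ + d) := by
  obtain ⟨γ₀, hγ₀⟩ := vBark_homogeneous b ψ hs0 hs hv i hπ hD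
  obtain ⟨ρ, hρ⟩ := vBarDeg_gradProj b ψ i
  refine ⟨i • b 1 - γ₀, fun γ => ?_⟩
  -- Both gradings are determined by the degree that they give to the same homogeneous generator.
  have h1 := component_eq_span hπ hD hγ₀ (gen_vBark b ψ hs i) (γ - γ₀)
  have h2 := component_eq_span hρ (vBar_lie_mem b ψ i) (vBark_mem b ψ i i) (gen_vBark b ψ hs i)
    (γ - γ₀)
  rw [sub_add_cancel] at h1
  rw [h1, ← h2]
  congr 1
  abel

end Highest

/-! ### Transport along an isomorphism that ignores the grading -/

section Iso

variable {V : Type*} [AddCommGroup V] [Module ℂ V] [LieRingModule L V] [LieModule ℂ L V]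

/-- A graded module isomorphic to some `V̄(ψ, i, s)`, with any grading, belongs to `𝒪`. -/
theorem inO_of_equiv {𝒱 : Gam → Submodule ℂ V} (h𝒱 : IsGradedModule 𝒱) [Nontrivial V]
    {b : Module.Basis (Fin 2) ℤ Gam} {ψ : L0 b →ₗ[ℂ] ℂ} {i : ℤ} {s : ℕ} (hψ : IsExpPolynomial b ψ)
    (hs : HasStep b ψ s) (e : V ≃ₗ⁅ℂ,L⁆ VBar b ψ i) : InO 𝒱 := by
  have hst := hs.steps
  obtain ⟨π, hπ⟩ := exists_gradProj h𝒱.isInternal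
  have heD : ∀ (x : L) (v : V), e ⁅x, v⁆ = ⁅x, e v⁆ := fun x v => e.toLieModuleHom.map_lie x v
  let f : V →ₗ[ℂ] VBar b ψ i := e.toLinearEquiv.toLinearMap
  have hf : ∀ v, f v = e v := fun _ => rfl
  obtain ⟨π', hπ', hc⟩ := hπ.map f e.toLinearEquiv.surjective (K := ⊥)
    (fun x => by simp [f]) (hπ.isHomogeneous fun i x hx => by
      rw [(Submodule.mem_bot ℂ).1 hx, map_zero]; exact zero_mem _)
  have hD' : ∀ m n, ∀ v ∈ (𝒱 n).map f, ⁅D m, v⁆ ∈ (𝒱 (m + n)).map f := by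
    rintro m n _ ⟨v, hv, rfl⟩
    exact ⟨_, h𝒱.lie_mem m n v hv, heD _ _⟩
  have hv : vac b ψ ≠ 0 := by
    intro H
    have h1 : vBark b ψ i i = 0 := by
      rw [vBark, vk, H, map_zero, map_zero]
    have h2 := gen_vBark b ψ hst i
    obtain ⟨v, hv⟩ := exists_ne (0 : V)
    refine hv (e.toLinearEquiv.injective ?_)
    have h3 : e v ∈ gen (vBark b ψ i i) := by rw [h2]; trivial
    rw [h1] at h3
    have h4 : gen (0 : VBar b ψ i) ≤ ⊥ := gen_le (zero_mem _)
    have h5 := h4 h3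
    have h6 : e v = 0 := by simpa using h5
    exact h6.trans (map_zero e.toLinearEquiv).symm
  -- Nothing relates e to the given grading of V; uniqueness shows that its image is a shift of the
  -- grading of V̄.
  obtain ⟨d, hd⟩ := grading_vBar_unique b ψ hs.1 hst hv i hπ' hD'
  refine ⟨inferInstance, fun N hN => ?_, fun γ => ?_⟩
  · let N' : LieSubmodule ℂ L (VBar b ψ i) := lieSubOfD (N.toSubmodule.map f) (by
      rintro r _ ⟨v, hv, rfl⟩
      exact ⟨⁅D r, v⁆, N.lie_mem hv, heD _ _⟩)
    obtain ⟨ρ, hρ⟩ := vBarDeg_gradProj b ψ i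
    have hN' : IsHomogeneous (vBarDeg b ψ i) N'.toSubmodule := by
      have h1 : IsHomogeneous (fun γ => (𝒱 γ).map f) N'.toSubmodule := by
        refine hπ'.isHomogeneous fun γ x hx => ?_
        obtain ⟨v, hv, rfl⟩ := hx
        exact ⟨π γ v, hπ.proj_mem hN γ hv, (hc γ v).symm⟩
      rw [IsHomogeneous] at h1 ⊢
      simp only [hd] at h1
      rw [h1]
      conv_lhs => rw [← (Equiv.subRight d).iSup_comp]
      rw [← h1]
      simp only [Equiv.subRight_apply, sub_add_cancel]
    rcases vBar_irreducible b ψ hst i N' hN' with H | H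
    · left
      rw [eq_bot_iff]
      intro v hv
      have : f v ∈ N' := ⟨v, hv, rfl⟩
      rw [H] at this
      have h6 : e v = 0 := (LieSubmodule.mem_bot (e v)).1 this
      exact (LieSubmodule.mem_bot _).2 (e.toLinearEquiv.injective (h6.trans (map_zero e.toLinearEquiv).symm))
    · right
      rw [eq_top_iff]
      intro v _
      have : f v ∈ N' := by rw [H]; trivial
      obtain ⟨w, hw, hwv⟩ := this
      rwa [← e.toLinearEquiv.injective hwv]
  · have h1 : ((𝒱 γ).map f).FG := by
      rw [hd]
      exact vBarDeg_fg b ψ hψ i _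
    have h2 := Submodule.fg_of_fg_map_injective f e.toLinearEquiv.injective h1
    exact Module.Finite.iff_fg.2 h2

end Iso

/-! ## Irreducible quasi-finite modules: central character and growth along a line -/

section Linear

variable {V : Type*} [AddCommGroup V] [Module ℂ V]

theorem exists_eigenvector {S : Submodule ℂ V} [FiniteDimensional ℂ S] (hS : S ≠ ⊥)
    (A : Module.End ℂ V) (hA : ∀ x ∈ S, A x ∈ S) : ∃ (a : ℂ), ∃ v ∈ S, v ≠ 0 ∧ A v = a • v := by
  have : Nontrivial S := Submodule.nontrivial_iff_ne_bot.2 hS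
  obtain ⟨a, ha⟩ := Module.End.exists_eigenvalue (A.restrict hA)
  obtain ⟨v, hv⟩ := ha.exists_hasEigenvector
  refine ⟨a, v, v.2, fun h => hv.2 (Subtype.ext h), ?_⟩
  exact congrArg Subtype.val hv.apply_eq_smul

theorem le_finrank {S : Submodule ℂ V} [FiniteDimensional ℂ S] {N : ℕ} {w : Fin N → V}
    (hw : LinearIndependent ℂ w) (hS : ∀ j, w j ∈ S) : N ≤ Module.finrank ℂ S := by
  have : LinearIndependent ℂ (fun j => (⟨w j, hS j⟩ : S)) :=
    LinearIndependent.of_comp S.subtype hw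
  simpa using this.fintype_card_le_finrank

variable {X Y Z W : Module.End ℂ V} {a a' c c' : ℂ} {v : V}

/-- With [X, Y] = c, each application of X lowers the eigenvalue of Y X by c. -/
theorem lowering_pow (hXY : ∀ u, X (Y u) = Y (X u) + c • u) (hv : Y (X v) = a • v) (p : ℕ) :
    Y (X ((X ^ p) v)) = (a - p * c) • (X ^ p) v := by
  induction p with
  | zero => simpa using hv
  | succ p ih =>
    have h1 := hXY (X ((X ^ p) v))
    rw [ih, map_smul] at h1
    rw [pow_succ', Module.End.mul_apply, ← sub_eq_iff_eq_add.2 h1, ← sub_smul]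
    congr 1
    push_cast
    ring

theorem pow_ne_zero_of_forall (hXY : ∀ u, X (Y u) = Y (X u) + c • u) (hv : Y (X v) = a • v)
    (ha : ∀ p : ℕ, a - p * c ≠ 0) (hv0 : v ≠ 0) (p : ℕ) : (X ^ p) v ≠ 0 := by
  induction p with
  | zero => simpa using hv0
  | succ p ih =>
    intro H
    rw [pow_succ', Module.End.mul_apply] at H
    have := lowering_pow hXY hv p
    rw [H, map_zero] at this
    exact smul_ne_zero (ha p) ih this.symm

/-- The vectors are nonzero eigenvectors of Y X with eigenvalues a - f(j) c. Since Z commutes with X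
and Y, its powers do not affect the eigenvalue and can be chosen to adjust the degree. -/
theorem linearIndependent_pow (hXY : ∀ u, X (Y u) = Y (X u) + c • u) (hc : c ≠ 0)
    (hv : Y (X v) = a • v) (ha : ∀ p : ℕ, a - p * c ≠ 0)
    (hZW : ∀ u, Z (W u) = W (Z u) + c' • u) (hv' : W (Z v) = a' • v)
    (ha' : ∀ p : ℕ, a' - p * c' ≠ 0) (hXZ : ∀ u, X (Z u) = Z (X u)) (hYZ : ∀ u, Y (Z u) = Z (Y u))
    (hv0 : v ≠ 0) {ι : Type*} {f g : ι → ℕ} (hf : Function.Injective f) :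
    LinearIndependent ℂ fun j => (X ^ f j) ((Z ^ g j) v) := by
  have hZ : ∀ q : ℕ, Y (X ((Z ^ q) v)) = a • (Z ^ q) v := by
    intro q
    induction q with
    | zero => simpa using hv
    | succ q ih => rw [pow_succ', Module.End.mul_apply, hXZ, hYZ, ih, map_smul]
  refine Module.End.eigenvectors_linearIndependent' (Y * X) (fun j => a - f j * c)
    (fun i j hij => hf ?_) _ fun j => ⟨?_, ?_⟩
  · have : (f i : ℂ) * c = f j * c := by linear_combination -hij
    exact_mod_cast mul_right_cancel₀ hc this
  · rw [Module.End.mem_eigenspace_iff]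
    exact lowering_pow hXY (hZ _) _
  · exact pow_ne_zero_of_forall hXY (hZ _) ha (pow_ne_zero_of_forall hZW hv' ha' hv0 _) _

/-- One of two opposite directions is free. -/
theorem forall_ne_or_forall_ne (a : ℂ) (hc : c ≠ 0) :
    (∀ p : ℕ, a - p * c ≠ 0) ∨ ∀ p : ℕ, a + c - p * (-c) ≠ 0 := by
  by_contra! H
  obtain ⟨⟨p, hp⟩, q, hq⟩ := H
  -- Failure in both directions means a = p c and a + c = -q c.
  have h1 : ((p + q + 1 : ℕ) : ℂ) * c = 0 := by
    push_cast
    linear_combination hq - hp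
  rcases mul_eq_zero.1 h1 with h2 | h2
  · exact Nat.cast_ne_zero.2 (Nat.succ_ne_zero (p + q)) h2
  · exact hc h2

end Linear

/-! ### Scalars of the center and growth of dimensions along a line -/

section Irreducible

variable {V : Type*} [AddCommGroup V] [Module ℂ V] [LieRingModule L V] [LieModule ℂ L V]
  {𝒱 : Gam → Submodule ℂ V}

theorem mem_of_homogeneous_mem (h𝒱 : IsGradedModule 𝒱) (hO : InO 𝒱) {N : Submodule ℂ V}
    (hN : ∀ r, ∀ v ∈ N, ⁅D r, v⁆ ∈ N) {d : Gam} {v : V} (hv : v ∈ 𝒱 d) (hv0 : v ≠ 0) (hvN : v ∈ N)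
    (w : V) : w ∈ N := by
  obtain ⟨π, hπ⟩ := exists_gradProj h𝒱.isInternal
  have h1 := gen_eq_top hπ h𝒱.lie_mem hO.irreducible hv hv0
  have h2 : gen v ≤ lieSubOfD N hN := gen_le hvN
  rw [h1] at h2
  exact h2 (by trivial)

theorem exists_component_ne_bot (h𝒱 : IsGradedModule 𝒱) (hO : InO 𝒱) : ∃ n, 𝒱 n ≠ ⊥ := by
  obtain ⟨π, hπ⟩ := exists_gradProj h𝒱.isInternal
  have := hO.nontrivial
  obtain ⟨v, hv⟩ := exists_ne (0 : V)
  obtain ⟨n, hn⟩ := hπ.exists_ne hv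
  refine ⟨n, fun H => hn ?_⟩
  have := hπ.apply_mem n v
  rwa [H, Submodule.mem_bot] at this

/-- Schur's argument: an eigenvector exists in a finite-dimensional component, and the eigenspace of
a central element is a submodule. -/
theorem exists_scalar (h𝒱 : IsGradedModule 𝒱) (hO : InO 𝒱) {x : L} (hx : ∀ y : L, ⁅x, y⁆ = 0)
    (hdeg : ∀ n, ∀ v ∈ 𝒱 n, ⁅x, v⁆ ∈ 𝒱 n) : ∃ z : ℂ, ∀ v : V, ⁅x, v⁆ = z • v := by
  obtain ⟨n, hn⟩ := exists_component_ne_bot h𝒱 hO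
  have := hO.quasiFinite n
  obtain ⟨z, v, hv, hv0, hz⟩ := exists_eigenvector hn (LieModule.toEnd ℂ L V x) (hdeg n)
  refine ⟨z, fun w => ?_⟩
  let N : Submodule ℂ V := LinearMap.ker (LieModule.toEnd ℂ L V x - z • LinearMap.id)
  have hN : ∀ y, y ∈ N ↔ ⁅x, y⁆ = z • y := by
    intro y
    simp [N, sub_eq_zero]
  refine (hN w).1 (mem_of_homogeneous_mem h𝒱 hO (fun r y hy => ?_) hv hv0 ((hN v).2 hz) w)
  rw [hN] at hy ⊢
  rw [lie_D_comm _ hx, hy, lie_smul]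

/-- The center acts by scalars. -/
theorem exists_central_character (h𝒱 : IsGradedModule 𝒱) (hO : InO 𝒱)
    (hc : (∃ v : V, ⁅c₁, v⁆ ≠ 0) ∨ (∃ v : V, ⁅c₂, v⁆ ≠ 0)) :
    ∃ η : Gam →+ ℂ, (∀ m, ∀ v : V, ⁅h m, v⁆ = η m • v) ∧ ∃ m, η m ≠ 0 := by
  have hneg : ∀ m n : Gam, ∀ v ∈ 𝒱 n, ⁅D m, ⁅D (-m), v⁆⁆ ∈ 𝒱 n := by
    intro m n v hv
    have := h𝒱.lie_mem m _ _ (h𝒱.lie_mem (-m) _ _ hv)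
    rwa [add_neg_cancel_left] at this
  obtain ⟨z₁, hz₁⟩ := exists_scalar h𝒱 hO c₁_lie fun n v hv => by
    rw [c₁_lie_eq]
    exact sub_mem (hneg (1, 0) n v hv) (hneg (-1, 0) n v hv)
  obtain ⟨z₂, hz₂⟩ := exists_scalar h𝒱 hO c₂_lie fun n v hv => by
    rw [c₂_lie_eq]
    exact sub_mem (hneg (0, 1) n v hv) (hneg (0, -1) n v hv)
  let η : Gam →+ ℂ :=
    { toFun := fun m => m.1 * z₁ + m.2 * z₂
      map_zero' := by simp
      map_add' := fun m n => by
        simp only [Prod.fst_add, Prod.snd_add, Int.cast_add]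
        ring }
  refine ⟨η, fun m v => ?_, ?_⟩
  · rw [h_lie, hz₁, hz₂, smul_smul, smul_smul, ← add_smul]
    rfl
  · rcases hc with ⟨v, hv⟩ | ⟨v, hv⟩
    · refine ⟨(1, 0), fun H => hv ?_⟩
      have : z₁ = 0 := by simpa [η] using H
      rw [hz₁, this, zero_smul]
    · refine ⟨(0, 1), fun H => hv ?_⟩
      have : z₂ = 0 := by simpa [η] using H
      rw [hz₂, this, zero_smul]

variable {η : Gam →+ ℂ}

theorem lie_D_smul (hη : ∀ m, ∀ v : V, ⁅h m, v⁆ = η m • v) (m : Gam) (i j : ℤ) (u : V) :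
    ⁅D (i • m), ⁅D (j • m), u⁆⁆ =
      ⁅D (j • m), ⁅D (i • m), u⁆⁆ + (if i • m + j • m = 0 then (i : ℂ) * η m else 0) • u := by
  have hd : det (i • m) (j • m) = 0 := by
    simp only [det, Prod.smul_fst, Prod.smul_snd, smul_eq_mul]
    ring
  rw [lie_lie_D, hd, Int.cast_zero, neg_zero, zero_smul, add_zero]
  split_ifs
  · have : η (i • m) = i * η m := by rw [map_zsmul, zsmul_eq_mul]
    rw [hη, this]
  · rw [zero_smul]

theorem pow_mem (h𝒱 : IsGradedModule 𝒱) (r : Gam) (p : ℕ) {d : Gam} {v : V} (hv : v ∈ 𝒱 d) :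
    ((LieModule.toEnd ℂ L V (D r)) ^ p) v ∈ 𝒱 ((p : ℤ) • r + d) := by
  induction p with
  | zero => simpa using hv
  | succ p ih =>
    rw [pow_succ', Module.End.mul_apply]
    have := h𝒱.lie_mem r _ _ ih
    have e : r + ((p : ℤ) • r + d) = ((p + 1 : ℕ) : ℤ) • r + d := by
      rw [Nat.cast_succ, add_smul, one_smul]
      abel
    rwa [e] at this

/-- If `h(m)` does not act by zero, then the dimensions grow in one of the directions `±m`. -/
theorem exists_sign_le_finrank (h𝒱 : IsGradedModule 𝒱) (hO : InO 𝒱)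
    (hη : ∀ m, ∀ v : V, ⁅h m, v⁆ = η m • v) {m n : Gam} (hm : η m ≠ 0) (hn : 𝒱 n ≠ ⊥) :
    ∃ ε : ℤ, (ε = 1 ∨ ε = -1) ∧
      ∀ N : ℕ, N + 1 ≤ Module.finrank ℂ (𝒱 (n + (2 * N : ℤ) • (ε • m))) := by
  have hm0 : m ≠ 0 := fun H => hm (by rw [H, map_zero])
  have hsm : ∀ i : ℤ, i • m = 0 ↔ i = 0 := fun i => by
    rw [smul_eq_zero, or_iff_left hm0]
  have hcom : ∀ i j : ℤ, ∀ u : V, ⁅D (i • m), ⁅D (j • m), u⁆⁆ =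
      ⁅D (j • m), ⁅D (i • m), u⁆⁆ + (if i + j = 0 then (i : ℂ) * η m else 0) • u := by
    intro i j u
    rw [lie_D_smul hη, ← add_smul]
    simp only [hsm]
  have hcom' : ∀ i j : ℤ, i + j ≠ 0 → ∀ u : V, ⁅D (i • m), ⁅D (j • m), u⁆⁆ =
      ⁅D (j • m), ⁅D (i • m), u⁆⁆ := by
    intro i j hij u
    rw [hcom, if_neg hij, zero_smul, add_zero]
  let O : ℤ → Module.End ℂ V := fun i => LieModule.toEnd ℂ L V (D (i • m))
  have hO' : ∀ i u, O i u = ⁅D (i • m), u⁆ := fun _ _ => rfl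
  have hOmem : ∀ (i : ℤ) (d : Gam) (u : V), u ∈ 𝒱 d → O i u ∈ 𝒱 (i • m + d) :=
    fun i d u hu => h𝒱.lie_mem _ _ _ hu
  have hOO : ∀ (i : ℤ), ∀ u ∈ 𝒱 n, (O (-i) * O i) u ∈ 𝒱 n := by
    intro i u hu
    have := hOmem (-i) _ _ (hOmem i _ _ hu)
    rwa [neg_smul, neg_add_cancel_left] at this
  have := hO.quasiFinite n
  -- The degree zero operators O(-1) O(1) and O(-2) O(2) commute, so they have a common eigenvector
  -- v in `𝒱 n`.
  obtain ⟨a, v₁, hv₁, hv₁0, ha⟩ := exists_eigenvector hn (O (-1) * O 1) (hOO 1)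
  let S : Submodule ℂ V := 𝒱 n ⊓ LinearMap.ker (O (-1) * O 1 - a • LinearMap.id)
  have hS : ∀ u, u ∈ S ↔ u ∈ 𝒱 n ∧ O (-1) (O 1 u) = a • u := by
    intro u
    simp [S, sub_eq_zero]
  have hS0 : S ≠ ⊥ := fun H => hv₁0 (by
    have : v₁ ∈ S := (hS v₁).2 ⟨hv₁, ha⟩
    rwa [H, Submodule.mem_bot] at this)
  have : FiniteDimensional ℂ S := Submodule.finiteDimensional_of_le inf_le_left
  obtain ⟨a', v, hv, hv0, ha'⟩ := exists_eigenvector hS0 (O (-2) * O 2) (fun u hu => by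
    rw [hS] at hu ⊢
    refine ⟨hOO 2 u hu.1, ?_⟩
    simp only [Module.End.mul_apply, hO'] at hu ⊢
    rw [hcom' 1 (-2) (by norm_num), hcom' 1 2 (by norm_num), hcom' (-1) (-2) (by norm_num),
      hcom' (-1) 2 (by norm_num), hu.2, lie_smul, lie_smul])
  obtain ⟨hvn, ha⟩ := (hS v).1 hv
  -- O(k) and O(-k) have a nonzero scalar commutator, so the powers of one of the two never kill v;
  -- ε selects it.
  have hgood : ∀ (k : ℤ), k ≠ 0 → ∀ a : ℂ, O (-k) (O k v) = a • v →
      ∃ ε : ℤ, (ε = 1 ∨ ε = -1) ∧ ∃ a' : ℂ, O (-(ε * k)) (O (ε * k) v) = a' • v ∧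
        ∀ p : ℕ, a' - p * ((ε * k : ℤ) * η m) ≠ 0 := by
    intro k hk a ha
    have hkη : (k : ℂ) * η m ≠ 0 := mul_ne_zero (by exact_mod_cast hk) hm
    rcases forall_ne_or_forall_ne a hkη with H | H
    · exact ⟨1, Or.inl rfl, a, by simpa using ha, by simpa using H⟩
    · refine ⟨-1, Or.inr rfl, a + k * η m, ?_, by simpa using H⟩
      have h1 := hcom k (-k) v
      rw [if_pos (by ring), ← hO', ← hO', ← hO', ← hO', ha, ← add_smul] at h1
      simpa using h1
  obtain ⟨ε, hε, a₁, ha₁, hne₁⟩ := hgood 1 one_ne_zero a ha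
  obtain ⟨ε', hε', a₂, ha₂, hne₂⟩ := hgood 2 two_ne_zero a' ha'
  have hind : ∀ (N : ℕ) (g : Fin N → ℕ), LinearIndependent ℂ fun j : Fin N =>
      (O (ε * 1) ^ (2 * (j : ℕ))) ((O (ε' * 2) ^ g j) v) := by
    intro N g
    refine linearIndependent_pow (Y := O (-(ε * 1))) (W := O (-(ε' * 2)))
      (fun u => ?_) (mul_ne_zero ?_ hm) ha₁ hne₁ (fun u => ?_) ha₂ hne₂ (fun u => ?_) (fun u => ?_)
      hv0 (f := fun j : Fin N => 2 * (j : ℕ)) (fun i j hij => ?_)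
    · simp only [hO']
      rw [hcom, if_pos (by ring)]
    · rcases hε with rfl | rfl <;> norm_num
    · simp only [hO']
      rw [hcom, if_pos (by ring)]
    · exact hcom' _ _ (by omega) u
    · exact hcom' _ _ (by omega) u
    · simp only at hij
      omega
  have hmem : ∀ p q : ℕ, (O (ε * 1) ^ p) ((O (ε' * 2) ^ q) v) ∈
      𝒱 (n + (p * ε + 2 * q * ε' : ℤ) • m) := by
    intro p q
    have := pow_mem h𝒱 ((ε * 1) • m) p (pow_mem h𝒱 ((ε' * 2) • m) q hvn)
    have e : (p : ℤ) • (ε * 1) • m + ((q : ℤ) • (ε' * 2) • m + n) =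
        n + (p * ε + 2 * q * ε' : ℤ) • m := by
      module
    rwa [e] at this
  -- If the free directions along m and 2m agree, the N + 1 independent vectors O(ε)^(2j) O(2ε)^(N -
  -- j) v share the degree n + 2Nε m. If they are opposite, all the independent vectors O(ε)^(2j)
  -- O(2ε')^j v lie in `𝒱 n`, against finite dimension.
  by_cases hεε : ε = ε'
  · subst hεε
    refine ⟨ε, hε, fun N => ?_⟩
    have := hO.quasiFinite (n + (2 * N : ℤ) • (ε • m))
    refine le_finrank (hind (N + 1) fun j => N - j) fun j => ?_
    have h1 := hmem (2 * (j : ℕ)) (N - j)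
    have hj : (j : ℕ) ≤ N := Nat.lt_succ_iff.1 j.2
    have e : (((2 * (j : ℕ) : ℕ) : ℤ) * ε + 2 * ((N - j : ℕ) : ℤ) * ε) = 2 * N * ε := by
      push_cast [hj]
      ring
    rwa [e, mul_smul] at h1
  · exfalso
    have hsum : ε + ε' = 0 := by omega
    have := le_finrank (S := 𝒱 n) (hind (Module.finrank ℂ (𝒱 n) + 1) fun j => j) fun j => by
      have h1 := hmem (2 * (j : ℕ)) j
      have e : (((2 * (j : ℕ) : ℕ) : ℤ) * ε + 2 * ((j : ℕ) : ℤ) * ε') = 0 := by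
        push_cast
        rw [← mul_add, hsum, mul_zero]
      rwa [e, zero_smul, add_zero] at h1
    omega

end Irreducible

/-! ## Directions in which every vector is eventually annihilated -/

open Filter in
/-- The vectors annihilated by `D(s + k r)` for all sufficiently large `k`, for every `s`. -/
def evKilled (V : Type*) [AddCommGroup V] [Module ℂ V] [LieRingModule L V] [LieModule ℂ L V]
    (r : Gam) : Submodule ℂ V where
  carrier := {v | ∀ s : Gam, ∀ᶠ k : ℕ in atTop, ⁅D (s + (k : ℤ) • r), v⁆ = 0}
  add_mem' hx hy s := by
    filter_upwards [hx s, hy s] with k h1 h2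
    rw [lie_add, h1, h2, add_zero]
  zero_mem' s := Eventually.of_forall fun k => lie_zero _
  smul_mem' c x hx s := by
    filter_upwards [hx s] with k h1
    rw [lie_smul, h1, smul_zero]

/-- Every vector of `V` is annihilated by `D(s + k r)` for all sufficiently large `k`. -/
def Pos (V : Type*) [AddCommGroup V] [Module ℂ V] [LieRingModule L V] [LieModule ℂ L V]
    (r : Gam) : Prop := evKilled V r = ⊤

section Pos

open Filter

theorem exists_det_ne_zero {r : Gam} (hr : r ≠ 0) : ∃ s, det r s ≠ 0 := by
  by_contra! H
  have h1 := H (0, 1)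
  have h2 := H (1, 0)
  simp only [det, mul_one, mul_zero, sub_zero, zero_sub, neg_eq_zero] at h1 h2
  exact hr (Prod.ext h1 h2)

/-- Meant for det(s₁ + k r, s₂ + k r') as a function of k. -/
theorem eventually_quadratic_ne_zero {A B C : ℤ} (hAB : A ≠ 0 ∨ B ≠ 0) :
    ∀ᶠ k : ℕ in atTop, A * (k : ℤ) ^ 2 + B * k + C ≠ 0 := by
  rw [← Nat.cofinite_eq_atTop, eventually_cofinite]
  let p : Polynomial ℤ := Polynomial.C A * Polynomial.X ^ 2 + Polynomial.C B * Polynomial.X +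
    Polynomial.C C
  have hp : p ≠ 0 := by
    intro H
    have h0 := congrArg (Polynomial.eval 0) H
    have h1 := congrArg (Polynomial.eval 1) H
    have h2 := congrArg (Polynomial.eval (-1)) H
    simp [p] at h0 h1 h2
    omega
  refine ((Polynomial.finite_setOfPred_isRoot hp).preimage
    (f := fun k : ℕ => (k : ℤ)) (Nat.cast_injective.injOn)).subset fun k hk => ?_
  simp only [not_not, Set.mem_ofPred_eq] at hk
  simp [p, Polynomial.IsRoot, hk]

variable {V : Type*} [AddCommGroup V] [Module ℂ V] [LieRingModule L V] [LieModule ℂ L V]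

theorem Pos.eventually {r : Gam} (hr : Pos V r) (s : Gam) (v : V) :
    ∀ᶠ k : ℕ in atTop, ⁅D (s + (k : ℤ) • r), v⁆ = 0 := by
  have : v ∈ evKilled V r := by rw [hr]; trivial
  exact this s

/-- Commuting D(s + k r) past D(t) only creates D(s + t + k r), and no central term for large k. So
the eventually killed vectors form a submodule, and one nonzero homogeneous one suffices for `Pos`.
-/
theorem lie_mem_evKilled {r : Gam} (hr : r ≠ 0) (t : Gam) {v : V} (hv : v ∈ evKilled V r) :
    ⁅D t, v⁆ ∈ evKilled V r := by
  intro s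
  have h0 : ∀ᶠ k : ℕ in atTop, s + (k : ℤ) • r + t ≠ 0 := by
    rw [← Nat.cofinite_eq_atTop, eventually_cofinite]
    refine Set.Subsingleton.finite fun k hk k' hk' => ?_
    simp only [not_not, Set.mem_ofPred_eq] at hk hk'
    have h1 : ((k : ℤ) - k') • r = 0 := by
      rw [sub_smul, sub_eq_zero]
      have := hk.trans hk'.symm
      exact add_left_cancel (add_right_cancel this)
    rcases smul_eq_zero.1 h1 with h2 | h2
    · omega
    · exact absurd h2 hr
  filter_upwards [hv s, hv (s + t), h0] with k h1 h2 h3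
  rw [add_right_comm] at h2
  rw [lie_lie_D, h1, lie_zero, h2, smul_zero, if_neg h3, add_zero, zero_add]

variable {η : Gam →+ ℂ}

section

variable (hη : ∀ m, ∀ v : V, ⁅h m, v⁆ = η m • v) (hη0 : ∃ m, η m ≠ 0)
include hη hη0

/-- Off the line of r there is s with η(s) ≠ 0. Both D(s) and D(-s) kill v, but their commutator
h(s) acts by η(s). -/
theorem eq_zero_of_forall_det {r : Gam} (hr : r ≠ 0) {v : V}
    (hv : ∀ u, det r u ≠ 0 → ⁅D u, v⁆ = 0) : v = 0 := by
  obtain ⟨s, hs, hs'⟩ : ∃ s, det r s ≠ 0 ∧ η s ≠ 0 := by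
    obtain ⟨s, hs⟩ := exists_det_ne_zero hr
    obtain ⟨m, hm⟩ := hη0
    by_cases h1 : η s = 0
    · by_cases h2 : det r m = 0
      · refine ⟨s + m, ?_, by rwa [map_add, h1, zero_add]⟩
        have : det r (s + m) = det r s + det r m := by
          simp only [det, Prod.fst_add, Prod.snd_add]; ring
        rwa [this, h2, add_zero]
      · exact ⟨m, h2, hm⟩
    · exact ⟨s, hs, h1⟩
  have h1 := lie_lie_D s (-s) v
  have h2 : det r (-s) ≠ 0 := by
    have : det r (-s) = -det r s := by simp only [det, Prod.fst_neg, Prod.snd_neg]; ring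
    rwa [this, neg_ne_zero]
  rw [hv s hs, hv _ h2, lie_zero, lie_zero, add_neg_cancel, D_zero, zero_lie, smul_zero, if_pos rfl,
    zero_add, zero_add, hη] at h1
  exact (smul_eq_zero.1 h1.symm).resolve_left hs'

theorem Pos.ne_zero [Nontrivial V] {r : Gam} (hr : Pos V r) : r ≠ 0 := by
  rintro rfl
  obtain ⟨v, hv⟩ := exists_ne (0 : V)
  refine hv (eq_zero_of_forall_det hη hη0 (r := (1, 0)) (by simp) fun u _ => ?_)
  obtain ⟨k, hk⟩ := (hr.eventually u v).exists
  rwa [smul_zero, add_zero] at hk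

/-- If D(-r) kills v, then brackets with D(-r) carry the vanishing of D(u + k r) v back to D(u) v
for each u off the line of r, and `eq_zero_of_forall_det` applies. -/
theorem Pos.lie_neg_injective [Nontrivial V] {r : Gam} (hr : Pos V r) {v : V}
    (hv : ⁅D (-r), v⁆ = 0) : v = 0 := by
  refine eq_zero_of_forall_det hη hη0 (hr.ne_zero hη hη0) fun u hu => ?_
  have key : ∀ k : ℕ, ∀ s, det r s ≠ 0 → ⁅D (s + (k : ℤ) • r), v⁆ = 0 → ⁅D s, v⁆ = 0 := by
    intro k
    induction k with
    | zero => intro s _ h1; simpa using h1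
    | succ k ih =>
      intro s hs h1
      have hd : det r (s + r) = det r s := by
        simp only [det, Prod.fst_add, Prod.snd_add]; ring
      have h2 : ⁅D (s + r), v⁆ = 0 := by
        refine ih (s + r) (by rwa [hd]) ?_
        rw [Nat.cast_succ, add_smul, one_smul] at h1
        rwa [add_assoc, add_comm r]
      have hd' : det (-r) (s + r) ≠ 0 := by
        have : det (-r) (s + r) = -det r s := by
          simp only [det, Prod.fst_add, Prod.snd_add, Prod.fst_neg, Prod.snd_neg]; ring
        rwa [this, neg_ne_zero]
      have h3 := lie_add_of_det_ne hd' v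
      rw [h2, hv, lie_zero, lie_zero, sub_zero, smul_zero] at h3
      rw [← h3, add_comm s r, neg_add_cancel_left]
  obtain ⟨k, hk⟩ := (hr.eventually u v).exists
  exact key k u hu hk

theorem Pos.finrank_le [Nontrivial V] {𝒱 : Gam → Submodule ℂ V} (h𝒱 : IsGradedModule 𝒱)
    (hO : InO 𝒱) {r : Gam} (hr : Pos V r) (n : Gam) :
    Module.finrank ℂ (𝒱 (n + r)) ≤ Module.finrank ℂ (𝒱 n) := by
  have hf : ∀ x ∈ 𝒱 (n + r), LieModule.toEnd ℂ L V (D (-r)) x ∈ 𝒱 n := by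
    intro x hx
    have := h𝒱.lie_mem (-r) _ _ hx
    rwa [add_comm n, neg_add_cancel_left] at this
  have := hO.quasiFinite n
  refine LinearMap.finrank_le_finrank_of_injective (f := (LieModule.toEnd ℂ L V (D (-r))).restrict hf)
    ((injective_iff_map_eq_zero _).2 fun x hx => Subtype.ext ?_)
  exact hr.lie_neg_injective hη hη0 (congrArg Subtype.val hx)

/-- Split s + k (r + r') as (s₁ + k r) + (s₂ + k r') with s = s₁ + s₂. The determinant of the
summands is a polynomial in k whose linear coefficient is nonzero for a suitable splitting. When r +
r' = 0 the same bracket shows that V is zero, which is what excludes opposite directions later. -/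
theorem Pos.add {r r' : Gam} (hr : Pos V r) (hr' : Pos V r') (h0' : r' ≠ 0) :
    Pos V (r + r') := by
  have key : ∀ (s₁ s₂ : Gam) (v : V), det r r' ≠ 0 ∨ det r s₂ + det s₁ r' ≠ 0 →
      ∀ᶠ k : ℕ in atTop, ⁅D (s₁ + s₂ + (k : ℤ) • (r + r')), v⁆ = 0 := by
    intro s₁ s₂ v hne
    filter_upwards [hr.eventually s₁ v, hr'.eventually s₂ v,
      eventually_quadratic_ne_zero (C := det s₁ s₂) hne] with k h1 h2 h3
    have h4 : det (s₁ + (k : ℤ) • r) (s₂ + (k : ℤ) • r') ≠ 0 := by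
      have : det (s₁ + (k : ℤ) • r) (s₂ + (k : ℤ) • r') =
          det r r' * (k : ℤ) ^ 2 + (det r s₂ + det s₁ r') * k + det s₁ s₂ := by
        simp only [det, Prod.fst_add, Prod.snd_add, Prod.smul_fst, Prod.smul_snd, smul_eq_mul]
        ring
      rwa [this]
    have h5 := lie_add_of_det_ne h4 v
    rw [h1, h2, lie_zero, lie_zero, sub_zero, smul_zero] at h5
    rw [← h5]
    congr 2
    module
  rw [Pos, eq_top_iff]
  intro v _ s
  by_cases h1 : r + r' = 0
  · have hv : v = 0 := by
      refine eq_zero_of_forall_det hη hη0 h0' fun u hu => ?_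
      have h2 := key u 0 v (Or.inr ?_)
      · obtain ⟨k, hk⟩ := h2.exists
        rwa [h1, smul_zero, add_zero, add_zero] at hk
      · have : det r 0 + det u r' = -det r' u := by simp only [det, Prod.fst_zero, Prod.snd_zero]; ring
        rwa [this, neg_ne_zero]
    exact Eventually.of_forall fun k => by rw [hv, lie_zero]
  · obtain ⟨t, ht⟩ := exists_det_ne_zero h1
    have hlin : ∀ c : ℤ, det r (c • t) + det (s - c • t) r' = c * det (r + r') t + det s r' := by
      intro c
      simp only [det, Prod.fst_add, Prod.snd_add, Prod.fst_sub, Prod.snd_sub, Prod.smul_fst,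
        Prod.smul_snd, smul_eq_mul]
      ring
    obtain ⟨c, hc⟩ : ∃ c : ℤ, c * det (r + r') t + det s r' ≠ 0 := by
      by_cases h2 : det s r' = 0
      · exact ⟨1, by rwa [h2, one_mul, add_zero]⟩
      · exact ⟨0, by rwa [zero_mul, zero_add]⟩
    have := key (s - c • t) (c • t) v (Or.inr (by rwa [hlin]))
    rwa [sub_add_cancel] at this

theorem Pos.not_neg [Nontrivial V] {r : Gam} (hr : Pos V r) : ¬ Pos V (-r) := by
  intro H
  have := hr.add hη hη0 H (H.ne_zero hη hη0)
  rw [add_neg_cancel] at this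
  exact this.ne_zero hη hη0 rfl

theorem Pos.add' [Nontrivial V] {r r' : Gam} (hr : Pos V r) (hr' : Pos V r') : Pos V (r + r') :=
  hr.add hη hη0 hr' (hr'.ne_zero hη hη0)

theorem Pos.smul [Nontrivial V] {r : Gam} (hr : Pos V r) {k : ℤ} (hk : 0 < k) : Pos V (k • r) := by
  obtain ⟨n, rfl⟩ : ∃ n : ℕ, k = n + 1 := ⟨(k - 1).toNat, by omega⟩
  induction n with
  | zero => simpa using hr
  | succ n ih =>
    have := (ih (by omega)).add' hη hη0 hr
    rwa [Nat.cast_succ, add_smul, one_smul]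

end

/-- The multiples of r fall into finitely many residue classes modulo k, and the condition holds
eventually on each. -/
theorem Pos.of_smul {r : Gam} {k : ℤ} (hk : 0 < k) (hr : Pos V (k • r)) : Pos V r := by
  obtain ⟨n, rfl⟩ := Int.eq_ofNat_of_zero_le hk.le
  have hn : 0 < n := by exact_mod_cast hk
  rw [Pos, eq_top_iff]
  intro v _ s
  have h1 : ∀ᶠ q : ℕ in atTop, ∀ i ∈ Finset.range n,
      ⁅D (s + (i : ℤ) • r + (q : ℤ) • ((n : ℤ) • r)), v⁆ = 0 :=
    (eventually_all_finset _).2 fun i _ => hr.eventually _ v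
  have h2 := (Nat.tendsto_div_const_atTop hn.ne').eventually h1
  filter_upwards [h2] with j hj
  have h3 := hj (j % n) (Finset.mem_range.2 (Nat.mod_lt _ hn))
  have e : s + ((j % n : ℕ) : ℤ) • r + ((j / n : ℕ) : ℤ) • ((n : ℤ) • r) = s + (j : ℤ) • r := by
    have : (j : ℤ) = ((j % n : ℕ) : ℤ) + ((j / n : ℕ) : ℤ) * n := by
      exact_mod_cast (Nat.mod_add_div' j n).symm
    rw [this, smul_smul, add_smul, ← add_assoc]
  rwa [e] at h3

variable {𝒱 : Gam → Submodule ℂ V}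

/-- A vector annihilated by `D(e₁)` and `D(e₂)`, for a basis `e₁`, `e₂` of `Γ`, gives a direction in
which every vector is eventually annihilated. -/
theorem pos_of_lie_eq_zero (h𝒱 : IsGradedModule 𝒱) (hO : InO 𝒱) {e₁ e₂ : Gam}
    (hd : det e₁ e₂ = 1 ∨ det e₁ e₂ = -1) {d : Gam} {v : V} (hv : v ∈ 𝒱 d) (hv0 : v ≠ 0)
    (h1 : ⁅D e₁, v⁆ = 0) (h2 : ⁅D e₂, v⁆ = 0) : Pos V (e₁ + e₂) := by
  have hd0 : det e₁ e₂ ≠ 0 := by rcases hd with hd | hd <;> rw [hd] <;> norm_num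
  have hself : ∀ x : Gam, det x x = 0 := fun x => by simp only [det]; ring
  have hne : e₁ + e₂ ≠ 0 := by
    intro H
    rw [eq_neg_of_add_eq_zero_right H] at hd0
    refine hd0 ?_
    simp only [det, Prod.fst_neg, Prod.snd_neg]; ring
  -- Brackets with D(e₁) and D(e₂) climb through the open quadrant, which s + k (e₁ + e₂) enters for
  -- large k.
  have key : ∀ a b : ℕ, ⁅D ((a + 1 : ℤ) • e₁ + (b + 1 : ℤ) • e₂), v⁆ = 0 := by
    intro a b
    induction a with
    | zero =>
      induction b with
      | zero =>
        have := lie_add_of_det_ne hd0 v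
        rw [h1, h2, lie_zero, lie_zero, sub_zero, smul_zero] at this
        simpa using this
      | succ b ih =>
        have hd' : det e₂ (((0 : ℕ) + 1 : ℤ) • e₁ + (b + 1 : ℤ) • e₂) ≠ 0 := by
          have : det e₂ (((0 : ℕ) + 1 : ℤ) • e₁ + (b + 1 : ℤ) • e₂) = -det e₁ e₂ := by
            simp only [det, Prod.fst_add, Prod.snd_add, Prod.smul_fst, Prod.smul_snd, smul_eq_mul]
            push_cast; ring
          rwa [this, neg_ne_zero]
        have := lie_add_of_det_ne hd' v
        rw [ih, h2, lie_zero, lie_zero, sub_zero, smul_zero] at this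
        rw [← this]
        congr 2
        push_cast
        module
    | succ a ih =>
      have hd' : det e₁ ((a + 1 : ℤ) • e₁ + (b + 1 : ℤ) • e₂) ≠ 0 := by
        have : det e₁ ((a + 1 : ℤ) • e₁ + (b + 1 : ℤ) • e₂) = (b + 1) * det e₁ e₂ := by
          simp only [det, Prod.fst_add, Prod.snd_add, Prod.smul_fst, Prod.smul_snd, smul_eq_mul]
          ring
        rw [this]
        exact mul_ne_zero (by omega) hd0
      have := lie_add_of_det_ne hd' v
      rw [ih, h1, lie_zero, lie_zero, sub_zero, smul_zero] at this
      rw [← this]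
      congr 2
      push_cast
      module
  rw [Pos, eq_top_iff]
  intro w _
  refine mem_of_homogeneous_mem h𝒱 hO (fun r x hx => lie_mem_evKilled hne r hx) hv hv0 ?_ w
  intro s
  obtain ⟨α, β, hs⟩ : ∃ α β : ℤ, s = α • e₁ + β • e₂ := by
    -- Cramer's rule; the determinant is ±1, hence its own inverse.
    refine ⟨det e₁ e₂ * det s e₂, det e₁ e₂ * det e₁ s, ?_⟩
    have hsq : det e₁ e₂ * det e₁ e₂ = 1 := by rcases hd with hd | hd <;> rw [hd] <;> norm_num
    refine Prod.ext ?_ ?_ <;>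
    · simp only [det, Prod.fst_add, Prod.snd_add, Prod.smul_fst, Prod.smul_snd, smul_eq_mul] at hsq ⊢
      first
      | linear_combination (-s.1) * hsq
      | linear_combination (-s.2) * hsq
  filter_upwards [eventually_ge_atTop (α.natAbs + β.natAbs + 1)] with k hk
  have h3 := key (α + k - 1).toNat (β + k - 1).toNat
  have e1 : (((α + k - 1).toNat : ℤ) + 1) = α + k := by omega
  have e2 : (((β + k - 1).toNat : ℤ) + 1) = β + k := by omega
  rw [e1, e2] at h3
  rw [← h3, hs]
  congr 2
  module

/-- The elements e₁ = 2N m + ρ and e₂ = (2N + 1) m + ρ form a basis of Γ and map the component of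
degree n - 2N m into those of degrees n + ρ and n + m + ρ. These targets do not depend on N; taking
N to be their total dimension, the source is larger and contains a common kernel vector. -/
theorem exists_pos_add (h𝒱 : IsGradedModule 𝒱) (hO : InO 𝒱) {m ρ n : Gam}
    (hd : det m ρ = 1 ∨ det m ρ = -1)
    (hdim : ∀ N : ℕ, N + 1 ≤ Module.finrank ℂ (𝒱 (n - (2 * N : ℤ) • m))) :
    ∃ N : ℕ, Pos V ((4 * N + 1 : ℤ) • m + (2 : ℤ) • ρ) := by
  set N := Module.finrank ℂ (𝒱 (n + ρ)) + Module.finrank ℂ (𝒱 (n + m + ρ)) with hN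
  refine ⟨N, ?_⟩
  set e₁ := (2 * N : ℤ) • m + ρ with he₁
  set e₂ := (2 * N + 1 : ℤ) • m + ρ with he₂
  have hf₁ : ∀ x : 𝒱 (n - (2 * N : ℤ) • m), ⁅D e₁, (x : V)⁆ ∈ 𝒱 (n + ρ) := by
    intro x
    have := h𝒱.lie_mem e₁ _ _ x.2
    have e : e₁ + (n - (2 * N : ℤ) • m) = n + ρ := by rw [he₁]; abel
    rwa [e] at this
  have hf₂ : ∀ x : 𝒱 (n - (2 * N : ℤ) • m), ⁅D e₂, (x : V)⁆ ∈ 𝒱 (n + m + ρ) := by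
    intro x
    have := h𝒱.lie_mem e₂ _ _ x.2
    have e : e₂ + (n - (2 * N : ℤ) • m) = n + m + ρ := by rw [he₂, add_smul, one_smul]; abel
    rwa [e] at this
  let f := (((LieModule.toEnd ℂ L V (D e₁)) ∘ₗ (𝒱 (n - (2 * N : ℤ) • m)).subtype).codRestrict _ hf₁).prod
    (((LieModule.toEnd ℂ L V (D e₂)) ∘ₗ (𝒱 (n - (2 * N : ℤ) • m)).subtype).codRestrict _ hf₂)
  have := hO.quasiFinite (n + ρ)
  have := hO.quasiFinite (n + m + ρ)
  have := hO.quasiFinite (n - (2 * N : ℤ) • m)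
  have hker : LinearMap.ker f ≠ ⊥ := by
    refine LinearMap.ker_ne_bot_of_finrank_lt ?_
    rw [Module.finrank_prod, ← hN]
    exact hdim N
  obtain ⟨x, hx, hx0⟩ := (Submodule.ne_bot_iff _).1 hker
  have hfx : f x = 0 := hx
  have h1 : ⁅D e₁, (x : V)⁆ = 0 := congrArg (fun y => (y.1 : V)) hfx
  have h2 : ⁅D e₂, (x : V)⁆ = 0 := congrArg (fun y => (y.2 : V)) hfx
  have hd' : det e₁ e₂ = -det m ρ := by
    simp only [he₁, he₂, det, Prod.fst_add, Prod.snd_add, Prod.smul_fst, Prod.smul_snd, smul_eq_mul]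
    ring
  have := pos_of_lie_eq_zero h𝒱 hO (e₁ := e₁) (e₂ := e₂) (by rw [hd']; omega) x.2
    (fun H => hx0 (Subtype.ext H)) h1 h2
  have e : e₁ + e₂ = (4 * N + 1 : ℤ) • m + (2 : ℤ) • ρ := by rw [he₁, he₂]; module
  rwa [e] at this

theorem exists_primitive {m : Gam} (hm : m ≠ 0) : ∃ (k : ℤ) (m' ρ : Gam), 0 < k ∧ m = k • m' ∧
    det m' ρ = 1 := by
  have hg : (Int.gcd m.1 m.2 : ℤ) ≠ 0 := by
    intro H
    have := Int.gcd_eq_zero_iff.1 (by exact_mod_cast H : Int.gcd m.1 m.2 = 0)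
    exact hm (Prod.ext this.1 this.2)
  obtain ⟨x, hx⟩ := Int.gcd_dvd_left m.1 m.2
  obtain ⟨y, hy⟩ := Int.gcd_dvd_right m.1 m.2
  refine ⟨Int.gcd m.1 m.2, (x, y), (-Int.gcdB m.1 m.2, Int.gcdA m.1 m.2), ?_, Prod.ext hx hy, ?_⟩
  · have : (0 : ℤ) ≤ Int.gcd m.1 m.2 := Int.natCast_nonneg _
    omega
  · have h1 := Int.gcd_eq_gcd_ab m.1 m.2
    have h2 : (Int.gcd m.1 m.2 : ℤ) * (x * Int.gcdA m.1 m.2 + y * Int.gcdB m.1 m.2) =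
        Int.gcd m.1 m.2 * 1 := by
      calc _ = ((Int.gcd m.1 m.2 : ℤ) * x) * Int.gcdA m.1 m.2 +
            ((Int.gcd m.1 m.2 : ℤ) * y) * Int.gcdB m.1 m.2 := by ring
        _ = _ := by rw [← hx, ← hy, mul_one, ← h1]
    have h3 := mul_left_cancel₀ hg h2
    simp only [det]
    linarith

/-- If `h(m)` does not act by zero, then `m` or `-m` is a direction in which every vector is
eventually annihilated. -/
theorem pos_or_pos_neg (h𝒱 : IsGradedModule 𝒱) (hO : InO 𝒱)
    (hη : ∀ m, ∀ v : V, ⁅h m, v⁆ = η m • v) {m : Gam} (hm : η m ≠ 0) : Pos V m ∨ Pos V (-m) := by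
  have := hO.nontrivial
  have hη0 : ∃ m, η m ≠ 0 := ⟨m, hm⟩
  obtain ⟨k, m', ρ, hk, rfl, hd⟩ := exists_primitive (m := m) (fun H => hm (by rw [H, map_zero]))
  have hm' : η m' ≠ 0 := fun H => hm (by rw [map_zsmul, H, smul_zero])
  obtain ⟨n, hn⟩ := exists_component_ne_bot h𝒱 hO
  obtain ⟨ε, hε, hdim⟩ := exists_sign_le_finrank h𝒱 hO hη hm' hn
  set μ := (-ε) • m' with hμ
  have hdim' : ∀ N : ℕ, N + 1 ≤ Module.finrank ℂ (𝒱 (n - (2 * N : ℤ) • μ)) := by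
    intro N
    have := hdim N
    have e : n - (2 * N : ℤ) • μ = n + (2 * N : ℤ) • (ε • m') := by rw [hμ]; module
    rwa [e]
  have hdμ : det μ ρ = -ε := by
    have : det μ ρ = -ε * det m' ρ := by
      simp only [hμ, det, Prod.smul_fst, Prod.smul_snd, smul_eq_mul]; ring
    rw [this, hd, mul_one]
  have hdμ' : det μ (-ρ) = ε := by
    have : det μ (-ρ) = -det μ ρ := by simp only [det, Prod.fst_neg, Prod.snd_neg]; ring
    rw [this, hdμ, neg_neg]
  -- The vector μ points against the growth. Adding the conclusions for ρ and -ρ cancels ρ and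
  -- leaves a positive multiple of μ.
  obtain ⟨N, hN⟩ := exists_pos_add h𝒱 hO (ρ := ρ) (by rw [hdμ]; omega) hdim'
  obtain ⟨N', hN'⟩ := exists_pos_add h𝒱 hO (ρ := -ρ) (by rw [hdμ']; omega) hdim'
  have h1 := hN.add' hη hη0 hN'
  have e : (4 * N + 1 : ℤ) • μ + (2 : ℤ) • ρ + ((4 * N' + 1 : ℤ) • μ + (2 : ℤ) • -ρ) =
      (4 * N + 4 * N' + 2 : ℤ) • μ := by module
  rw [e] at h1
  have h2 : Pos V μ := h1.of_smul (by omega)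
  rcases hε with rfl | rfl
  · right
    rw [hμ, neg_smul, one_smul] at h2
    have := h2.smul hη hη0 hk
    rwa [smul_neg] at this
  · left
    rw [hμ, neg_neg, one_smul] at h2
    exact h2.smul hη hη0 hk

end Pos

/-! ## The half plane of eventually annihilating directions -/

section HalfPlane

theorem exists_basis_of_det {x y : Gam} (hd : det x y = 1) :
    ∃ b : Module.Basis (Fin 2) ℤ Gam, b 0 = x ∧ b 1 = y := by
  let e : Gam ≃ₗ[ℤ] (Fin 2 → ℤ) :=
    { toFun := fun r => ![det r y, det x r]
      map_add' := fun r s => by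
        ext i
        fin_cases i <;> simp [det] <;> ring
      map_smul' := fun c r => by
        ext i
        fin_cases i <;> simp [det] <;> ring
      invFun := fun f => f 0 • x + f 1 • y
      left_inv := fun r => by
        simp only [det] at hd
        refine Prod.ext ?_ ?_
        · simp [det]
          linear_combination r.1 * hd
        · simp [det]
          linear_combination r.2 * hd
      right_inv := fun f => by
        simp only [det] at hd
        ext i
        fin_cases i
        · simp [det]
          linear_combination f 0 * hd
        · simp [det]
          linear_combination f 1 * hd }
  refine ⟨Module.Basis.ofEquivFun e, ?_, ?_⟩
  · rw [Module.Basis.coe_ofEquivFun]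
    change (Pi.single 0 1 : Fin 2 → ℤ) 0 • x + (Pi.single 0 1 : Fin 2 → ℤ) 1 • y = x
    simp
  · rw [Module.Basis.coe_ofEquivFun]
    change (Pi.single 1 1 : Fin 2 → ℤ) 0 • x + (Pi.single 1 1 : Fin 2 → ℤ) 1 • y = y
    simp

variable {η : Gam →+ ℂ}

/-- Two independent vectors in the kernel would force η = 0, by det(x, y) u = det(u, y) x + det(x,
u) y. So the kernel has rank at most one. -/
theorem det_ne_zero_of_eq_zero (hη0 : ∃ m, η m ≠ 0) {x y : Gam} (hx : η x = 0) (hd : det x y ≠ 0) :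
    η y ≠ 0 := by
  intro hy
  obtain ⟨u, hu⟩ := hη0
  have e : det x y • u = det u y • x + det x u • y := by
    refine Prod.ext ?_ ?_ <;>
    · simp only [det, Prod.fst_add, Prod.snd_add, Prod.smul_fst, Prod.smul_snd, smul_eq_mul]
      ring
  have h1 := congrArg η e
  rw [map_add, map_zsmul, map_zsmul, map_zsmul, hx, hy, smul_zero, smul_zero, add_zero] at h1
  exact hu ((smul_eq_zero.1 h1).resolve_left hd)

variable {V : Type*} [AddCommGroup V] [Module ℂ V] [LieRingModule L V] [LieModule ℂ L V]
  {𝒱 : Gam → Submodule ℂ V}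

section

variable (h𝒱 : IsGradedModule 𝒱) (hO : InO 𝒱) (hη : ∀ m, ∀ v : V, ⁅h m, v⁆ = η m • v)
  (hη0 : ∃ m, η m ≠ 0)
include h𝒱 hO hη hη0

/-- A direction in the kernel of the central character along which `Pos` is invariant gives a basis
for which all vectors of positive level are in `Pos`. -/
theorem exists_basis_of_invariant {e : Gam} (he0 : e ≠ 0) (he : η e = 0)
    (H : ∀ r, Pos V r → det e r ≠ 0 → ∀ k : ℤ, Pos V (r + k • e)) :
    ∃ b : Module.Basis (Fin 2) ℤ Gam, η (b 1) = 0 ∧ ∀ r, 0 < b.repr r 0 → Pos V r := by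
  have := hO.nontrivial
  obtain ⟨k, m, ρ, hk, hkm, hd⟩ := exists_primitive he0
  have hm : η m = 0 := by
    rw [hkm, map_zsmul] at he
    exact (smul_eq_zero.1 he).resolve_left hk.ne'
  have hρ : η ρ ≠ 0 := det_ne_zero_of_eq_zero hη0 hm (by rw [hd]; norm_num)
  -- The sign makes b₁ = σ ρ positive; b₂ = -σ m then keeps the determinant equal to 1.
  obtain ⟨σ, hσ, hpos⟩ : ∃ σ : ℤ, σ * σ = 1 ∧ Pos V (σ • ρ) := by
    rcases pos_or_pos_neg h𝒱 hO hη hρ with h1 | h1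
    · exact ⟨1, rfl, by rwa [one_smul]⟩
    · exact ⟨-1, rfl, by rwa [neg_smul, one_smul]⟩
  have hd' : det (σ • ρ) ((-σ) • m) = 1 := by
    have : det (σ • ρ) ((-σ) • m) = σ * σ * det m ρ := by
      simp only [det, Prod.smul_fst, Prod.smul_snd, smul_eq_mul]; ring
    rw [this, hσ, hd, one_mul]
  obtain ⟨b, hb0, hb1⟩ := exists_basis_of_det hd'
  refine ⟨b, by rw [hb1, map_zsmul, hm, smul_zero], fun r hr => ?_⟩
  have h1 : Pos V ((k * b.repr r 0) • b 0) := by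
    rw [hb0]
    exact hpos.smul hη hη0 (mul_pos hk hr)
  have h2 : det e ((k * b.repr r 0) • b 0) ≠ 0 := by
    have : det e ((k * b.repr r 0) • b 0) = k * (k * b.repr r 0) * σ * det m ρ := by
      rw [hkm, hb0]
      simp only [det, Prod.smul_fst, Prod.smul_snd, smul_eq_mul]; ring
    rw [this, hd, mul_one]
    refine mul_ne_zero (mul_ne_zero hk.ne' (mul_ne_zero hk.ne' hr.ne')) fun H => ?_
    rw [H] at hσ
    norm_num at hσ
  -- Since e = k m and b₂ = -σ m, the vector obtained is k r, and the factor k is removed by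
  -- `Pos.of_smul`.
  have h3 := H _ h1 h2 (-σ * b.repr r 1)
  refine Pos.of_smul hk ?_
  convert h3 using 1
  conv_lhs => rw [repr_eq b r, hb1]
  rw [hkm]
  module

omit h𝒱 in
theorem not_pos_smul_of_not_pos {m : Gam} (h1 : ¬ Pos V m) (h2 : ¬ Pos V (-m)) (k : ℤ) :
    ¬ Pos V (k • m) := by
  have := hO.nontrivial
  intro H
  rcases lt_trichotomy k 0 with hk | rfl | hk
  · refine h2 (Pos.of_smul (k := -k) (by omega) ?_)
    rwa [smul_neg, neg_smul, neg_neg]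
  · rw [zero_smul] at H
    exact H.ne_zero hη hη0 rfl
  · exact h1 (H.of_smul hk)

/-- By `pos_or_pos_neg`, η(m) = 0. If r were positive and r + k m not, then -(r + k m) would be, and
the sum -k m would be positive. So `Pos` is invariant along m away from its line. -/
theorem exists_basis_of_not_total {m : Gam} (hm0 : m ≠ 0) (h1 : ¬ Pos V m) (h2 : ¬ Pos V (-m)) :
    ∃ b : Module.Basis (Fin 2) ℤ Gam, η (b 1) = 0 ∧ ∀ r, 0 < b.repr r 0 → Pos V r := by
  have := hO.nontrivial
  have hm : η m = 0 := by
    by_contra H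
    exact (pos_or_pos_neg h𝒱 hO hη H).elim h1 h2
  refine exists_basis_of_invariant h𝒱 hO hη hη0 hm0 hm fun r hr hd k => ?_
  have h3 : η (r + k • m) ≠ 0 := by
    rw [map_add, map_zsmul, hm, smul_zero, add_zero]
    exact det_ne_zero_of_eq_zero hη0 hm hd
  refine (pos_or_pos_neg h𝒱 hO hη h3).resolve_right fun H => ?_
  have h4 := hr.add' hη hη0 H
  have e : r + -(r + k • m) = (-k) • m := by module
  rw [e] at h4
  exact not_pos_smul_of_not_pos hO hη hη0 h1 h2 _ h4

/-- With N the dimension in degree n - u, growth along ±m gives dimension at least N + 1 in degree n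
+ 2Nε m, while injectivity of the operator opposite to u + 2Nε m bounds it by N. -/
theorem finrank_bound_false {n u : Gam} {m : Gam} (hm : η m ≠ 0) (hn : 𝒱 n ≠ ⊥)
    (H : ∀ ε : ℤ, ε = 1 ∨ ε = -1 →
      Pos V (u + (2 * Module.finrank ℂ (𝒱 (n - u)) : ℤ) • (ε • m))) : False := by
  have := hO.nontrivial
  obtain ⟨ε, hε, hdim⟩ := exists_sign_le_finrank h𝒱 hO hη hm hn
  have h1 := hdim (Module.finrank ℂ (𝒱 (n - u)))
  have h2 := (H ε hε).finrank_le hη hη0 h𝒱 hO (n - u)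
  have e : n - u + (u + (2 * Module.finrank ℂ (𝒱 (n - u)) : ℤ) • (ε • m)) =
      n + (2 * Module.finrank ℂ (𝒱 (n - u)) : ℤ) • (ε • m) := by abel
  rw [e] at h2
  omega

/-- In the total order defined by `Pos`, a positive r off the line of the least element e stays
positive when multiples of e are subtracted. If η(e) ≠ 0, the whole line r + ℤe contradicts
`finrank_bound_false`. -/
theorem exists_basis_of_least {e : Gam} (htot : ∀ m : Gam, m ≠ 0 → Pos V m ∨ Pos V (-m))
    (he : Pos V e) (hle : ∀ r, Pos V r → r = e ∨ Pos V (r - e)) :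
    ∃ b : Module.Basis (Fin 2) ℤ Gam, η (b 1) = 0 ∧ ∀ r, 0 < b.repr r 0 → Pos V r := by
  have := hO.nontrivial
  have he0 := he.ne_zero hη hη0
  have H : ∀ r, Pos V r → det e r ≠ 0 → ∀ k : ℤ, Pos V (r + k • e) := by
    intro r hr hd k
    induction k using Int.induction_on with
    | zero => rwa [zero_smul, add_zero]
    | succ k ih =>
      have := ih.add' hη hη0 he
      rwa [add_assoc, ← add_one_zsmul] at this
    | pred k ih =>
      have h1 := (hle _ ih).resolve_left fun h2 => hd ?_
      · have e2 : r + -(k : ℤ) • e - e = r + (-(k : ℤ) - 1) • e := by module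
        rwa [e2] at h1
      · have e3 : det e (r + -(k : ℤ) • e) = det e r := by
          simp only [det, Prod.fst_add, Prod.snd_add, Prod.smul_fst, Prod.smul_snd, smul_eq_mul]
          ring
        rw [← e3, h2]
        simp only [det]; ring
  refine exists_basis_of_invariant h𝒱 hO hη hη0 he0 ?_ H
  by_contra hηe
  obtain ⟨n, hn⟩ := exists_component_ne_bot h𝒱 hO
  obtain ⟨r, hr, hd⟩ : ∃ r, Pos V r ∧ det e r ≠ 0 := by
    obtain ⟨s, hs⟩ := exists_det_ne_zero he0
    rcases htot s (by rintro rfl; exact hs (by simp [det])) with h1 | h1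
    · exact ⟨s, h1, hs⟩
    · refine ⟨-s, h1, ?_⟩
      have : det e (-s) = -det e s := by simp only [det, Prod.fst_neg, Prod.snd_neg]; ring
      rwa [this, neg_ne_zero]
  refine finrank_bound_false h𝒱 hO hη hη0 hηe hn (u := r) fun ε _ => ?_
  rw [smul_smul]
  exact H r hr hd _

omit h𝒱 in
theorem exists_small (htot : ∀ m : Gam, m ≠ 0 → Pos V m ∨ Pos V (-m))
    (hne : ∀ e, Pos V e → ∃ r, Pos V r ∧ Pos V (e - r)) {u : Gam} (hu : Pos V u) (N : ℕ) :
    ∃ m, Pos V m ∧ Pos V (u - (N + 1 : ℤ) • m) := by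
  have := hO.nontrivial
  -- Of r and u - r the smaller one is less than half of u; in the case of equality a smaller
  -- positive vector below r is taken.
  have half : ∀ u, Pos V u → ∃ m, Pos V m ∧ Pos V (u - (2 : ℤ) • m) := by
    intro u hu
    obtain ⟨r, hr, hur⟩ := hne u hu
    by_cases h0 : u - (2 : ℤ) • r = 0
    · obtain ⟨m, hm, hrm⟩ := hne r hr
      refine ⟨m, hm, ?_⟩
      have := hrm.smul hη hη0 (k := 2) (by norm_num)
      have e : (2 : ℤ) • (r - m) = u - (2 : ℤ) • m := by
        rw [sub_eq_zero.1 h0]; module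
      rwa [e] at this
    · rcases htot _ h0 with h1 | h1
      · exact ⟨r, hr, h1⟩
      · refine ⟨u - r, hur, ?_⟩
        have e : -(u - (2 : ℤ) • r) = u - (2 : ℤ) • (u - r) := by module
        rwa [e] at h1
  induction N with
  | zero =>
    obtain ⟨r, hr, hur⟩ := hne u hu
    exact ⟨r, hr, by simpa using hur⟩
  | succ N ih =>
    obtain ⟨m, hm, hum⟩ := ih
    obtain ⟨m', hm', hmm'⟩ := half m hm
    refine ⟨m', hm', ?_⟩
    have h1 := hum.add' hη hη0 (hmm'.smul hη hη0 (k := N + 1) (by omega))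
    rcases Nat.eq_zero_or_pos N with rfl | hN
    · convert h1 using 1
      push_cast
      module
    · have h2 := h1.add' hη hη0 (hm'.smul hη hη0 (k := N) (by omega))
      convert h2 using 1
      push_cast
      module

/-- In a dense order there are arbitrarily small positive m, so u + 2N m and u - 2N m are both
positive for a prescribed N, against `finrank_bound_false` as soon as η(m) ≠ 0. -/
theorem not_dense (htot : ∀ m : Gam, m ≠ 0 → Pos V m ∨ Pos V (-m))
    (hne : ∀ e, Pos V e → ∃ r, Pos V r ∧ Pos V (e - r)) : False := by
  have := hO.nontrivial
  -- Otherwise every positive vector has a positive element of the kernel of η below it. For a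
  -- primitive m' in the kernel, which has rank at most one, this element is c m' with c > 0, and (1
  -- - c) m' cannot be positive.
  obtain ⟨u, hu, hreg⟩ : ∃ u, Pos V u ∧ ∀ m, Pos V m → Pos V (u - m) → η m ≠ 0 := by
    by_contra! H
    obtain ⟨x, hx⟩ := hη0
    have hη0 : ∃ m, η m ≠ 0 := ⟨x, hx⟩
    obtain ⟨u, hu⟩ : ∃ u, Pos V u := (pos_or_pos_neg h𝒱 hO hη hx).elim (fun h => ⟨_, h⟩)
      fun h => ⟨_, h⟩
    obtain ⟨m, hm, -, hηm⟩ := H u hu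
    obtain ⟨k, m', ρ, hk, hkm, hd⟩ := exists_primitive (hm.ne_zero hη hη0)
    rw [hkm] at hm hηm
    have hm' := hm.of_smul hk
    rw [map_zsmul] at hηm
    have hηm' := (smul_eq_zero.1 hηm).resolve_left hk.ne'
    obtain ⟨m₁, hm₁, hsub, hηm₁⟩ := H m' hm'
    have hd₁ : det m' m₁ = 0 := by
      by_contra hd₁
      exact det_ne_zero_of_eq_zero hη0 hηm' hd₁ hηm₁
    have e : m₁ = det m₁ ρ • m' := by
      have hd2 := hd
      simp only [det] at hd₁ hd2
      refine Prod.ext ?_ ?_ <;>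
      · simp only [det, Prod.smul_fst, Prod.smul_snd, smul_eq_mul]
        first
        | linear_combination (-m₁.1) * hd2 + ρ.1 * hd₁
        | linear_combination (-m₁.2) * hd2 + ρ.2 * hd₁
    generalize det m₁ ρ = c at e
    rw [e] at hm₁ hsub
    have hc : 0 < c := by
      by_contra hc
      rcases (not_lt.1 hc).lt_or_eq with hc | rfl
      · have := hm'.smul hη hη0 (k := -c) (by omega)
        rw [neg_smul] at this
        exact hm₁.not_neg hη hη0 this
      · rw [zero_smul] at hm₁
        exact hm₁.ne_zero hη hη0 rfl
    have e2 : m' - c • m' = (1 - c) • m' := by module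
    rw [e2] at hsub
    by_cases hc1 : c = 1
    · rw [hc1, sub_self, zero_smul] at hsub
      exact hsub.ne_zero hη hη0 rfl
    · have := hm'.smul hη hη0 (k := c - 1) (by omega)
      refine hsub.not_neg hη hη0 ?_
      rwa [← neg_smul, neg_sub]
  obtain ⟨n, hn⟩ := exists_component_ne_bot h𝒱 hO
  set N := Module.finrank ℂ (𝒱 (n - u)) with hN
  obtain ⟨m, hm, hum⟩ := exists_small hO hη hη0 htot hne hu (2 * N)
  have hum' : ∀ k : ℤ, 0 ≤ k → k ≤ 2 * N + 1 → Pos V (u - k • m) := by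
    intro k _ hk
    rcases hk.lt_or_eq with hk | rfl
    · have := hum.add' hη hη0 (hm.smul hη hη0 (k := 2 * N + 1 - k) (by omega))
      convert this using 1
      push_cast
      module
    · exact_mod_cast hum
  refine finrank_bound_false h𝒱 hO hη hη0 (hreg m hm ?_) hn (u := u) fun ε hε => ?_
  · have := hum' 1 (by norm_num) (by omega)
    rwa [one_smul] at this
  · rw [← hN]
    rcases hε with rfl | rfl
    · rcases Nat.eq_zero_or_pos N with h0 | h0
      · rw [h0]
        simpa using hu
      · rw [one_smul]
        exact hu.add' hη hη0 (hm.smul hη hη0 (by omega))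
    · have := hum' (2 * N) (by omega) (by omega)
      convert this using 1
      module

/-- There is a basis `b₁`, `b₂` such that `h(b₂)` acts by zero and every vector is eventually
annihilated in all directions of positive level. -/
theorem exists_halfplane_basis :
    ∃ b : Module.Basis (Fin 2) ℤ Gam, η (b 1) = 0 ∧ ∀ r, 0 < b.repr r 0 → Pos V r := by
  by_cases htot : ∀ m : Gam, m ≠ 0 → Pos V m ∨ Pos V (-m)
  · by_cases hle : ∃ e, Pos V e ∧ ∀ r, Pos V r → r = e ∨ Pos V (r - e)
    · obtain ⟨e, he, hle⟩ := hle
      exact exists_basis_of_least h𝒱 hO hη hη0 htot he hle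
    · exfalso
      push Not at hle
      refine not_dense h𝒱 hO hη hη0 htot fun e he => ?_
      obtain ⟨r, hr, hre, hr'⟩ := hle e he
      refine ⟨r, hr, ?_⟩
      have := (htot (r - e) (sub_ne_zero.2 hre)).resolve_left hr'
      rwa [neg_sub] at this
  · push Not at htot
    obtain ⟨m, hm0, h1, h2⟩ := htot
    exact exists_basis_of_not_total h𝒱 hO hη hη0 hm0 h1 h2

/-- The levels of the degrees of `V` are bounded above. -/
theorem exists_top_level {b : Module.Basis (Fin 2) ℤ Gam} (hb : η (b 1) = 0)
    (hpos : ∀ r, 0 < b.repr r 0 → Pos V r) :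
    ∃ n, 𝒱 n ≠ ⊥ ∧ ∀ r, b.repr n 0 < b.repr r 0 → 𝒱 r = ⊥ := by
  have := hO.nontrivial
  have hb0 : η (b 0) ≠ 0 := by
    refine det_ne_zero_of_eq_zero hη0 hb ?_
    have h1 := det_basis_ne_zero b
    have : det (b 1) (b 0) = -det (b 0) (b 1) := by simp only [det]; ring
    rwa [this, neg_ne_zero]
  set d := Module.finrank ℂ (𝒱 0) with hd
  -- If the level of n exceeds 2d, then n ± 2d b₁ still has positive level, so its component embeds
  -- into `𝒱 0`, of dimension d; growth along b₁ makes one of the two dimensions at least d + 1.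
  have hbdd : ∀ n, 𝒱 n ≠ ⊥ → b.repr n 0 ≤ 2 * d := by
    intro n hn
    by_contra! H
    obtain ⟨ε, hε, hdim⟩ := exists_sign_le_finrank h𝒱 hO hη hb0 hn
    have h1 := hdim d
    have h2 : Pos V (n + (2 * d : ℤ) • (ε • b 0)) := by
      refine hpos _ ?_
      rw [smul_smul, map_add, map_zsmul, Module.Basis.repr_self, Finsupp.add_apply, Finsupp.smul_apply,
        Finsupp.single_eq_same, smul_eq_mul, mul_one]
      rcases hε with rfl | rfl
      · omega
      · omega
    have h3 := h2.finrank_le hη hη0 h𝒱 hO 0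
    rw [zero_add] at h3
    omega
  obtain ⟨n₀, hn₀⟩ := exists_component_ne_bot h𝒱 hO
  obtain ⟨ℓ, ⟨n, hn, rfl⟩, hmax⟩ := Int.exists_greatest_of_bdd (P := fun z => ∃ n, 𝒱 n ≠ ⊥ ∧
    b.repr n 0 = z) ⟨2 * d, by rintro _ ⟨n, hn, rfl⟩; exact hbdd n hn⟩ ⟨_, n₀, hn₀, rfl⟩
  refine ⟨n, hn, fun r hr => ?_⟩
  by_contra H
  have := hmax _ ⟨r, H, rfl⟩
  omega

end

end HalfPlane

/-! ## Two-sided linear recurrences and exp-polynomial sequences -/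

section ExpPoly

open Polynomial

/-- The space of exp-polynomial sequences. -/
def expPoly : Submodule ℂ (ℤ → ℂ) :=
  Submodule.span ℂ {u | ∃ (p : ℂ[X]) (α : ℂ), α ≠ 0 ∧ u = fun k : ℤ => p.eval (k : ℂ) * α ^ k}

theorem mem_expPoly (p : ℂ[X]) {α : ℂ} (hα : α ≠ 0) :
    (fun k : ℤ => p.eval (k : ℂ) * α ^ k) ∈ expPoly := Submodule.subset_span ⟨p, α, hα, rfl⟩

theorem exists_of_mem_expPoly {g : ℤ → ℂ} (hg : g ∈ expPoly) : ∃ (r : ℕ) (p : Fin r → ℂ[X])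
    (α : Fin r → ℂ), (∀ i, α i ≠ 0) ∧ ∀ k : ℤ, g k = ∑ i, (p i).eval (k : ℂ) * α i ^ k := by
  obtain ⟨r, c, u, rfl⟩ := Submodule.mem_span_set'.1 hg
  choose p α hα hu using fun i => (u i).2
  refine ⟨r, fun i => C (c i) * p i, α, hα, fun k => ?_⟩
  rw [Finset.sum_apply]
  refine Finset.sum_congr rfl fun i _ => ?_
  rw [hu, Pi.smul_apply, smul_eq_mul, eval_mul, eval_C, mul_assoc]

theorem exists_difference_eq {α β : ℂ} (hα : α ≠ 0) (p : ℂ[X]) :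
    ∃ q : ℂ[X], ∀ k : ℤ, β * q.eval ((k : ℂ) + 1) - α * q.eval (k : ℂ) = p.eval (k : ℂ) := by
  by_cases hαβ : β = α
  · subst hαβ
    induction p using Polynomial.induction_on' with
    | add p p' hp hp' =>
      obtain ⟨q, hq⟩ := hp
      obtain ⟨q', hq'⟩ := hp'
      refine ⟨q + q', fun k => ?_⟩
      rw [eval_add, eval_add, eval_add, ← hq, ← hq']
      ring
    | monomial n c =>
      have hn : ((n + 1 : ℕ) : ℂ) ≠ 0 := Nat.cast_ne_zero.2 (Nat.succ_ne_zero n)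
      -- The resonant case uses B_{n+1}(x + 1) - B_{n+1}(x) = (n + 1) x^n.
      refine ⟨C (c / (β * (n + 1 : ℕ))) * (Polynomial.bernoulli (n + 1)).map (algebraMap ℚ ℂ), fun k => ?_⟩
      have key : ∀ x : ℚ, ((Polynomial.bernoulli (n + 1)).map (algebraMap ℚ ℂ)).eval (x : ℂ) =
          (((Polynomial.bernoulli (n + 1)).eval x : ℚ) : ℂ) := by
        intro x
        have := eval_map_apply (algebraMap ℚ ℂ) (p := Polynomial.bernoulli (n + 1)) x
        simpa using this
      have h1 := key (k : ℚ)
      have h2 := key (1 + (k : ℚ))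
      rw [bernoulli_eval_one_add, Rat.cast_add (eval _ _), ← h1] at h2
      push_cast at h1 h2
      rw [add_comm (k : ℂ) 1]
      simp only [eval_mul, eval_C, eval_monomial, h2]
      push_cast at hn ⊢
      field_simp
      ring
  · have hβα : β - α ≠ 0 := sub_ne_zero.2 hαβ
    suffices H : ∀ d : ℕ, ∀ p : ℂ[X], p.degree < d → ∃ q : ℂ[X], ∀ k : ℤ,
        β * q.eval ((k : ℂ) + 1) - α * q.eval (k : ℂ) = p.eval (k : ℂ) from
      H _ p (degree_le_natDegree.trans_lt (WithBot.coe_lt_coe.2 (Nat.lt_succ_self _)))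
    intro d
    induction d with
    | zero =>
      intro p hp
      have : p = 0 := by
        rw [← degree_eq_bot, ← Nat.WithBot.lt_zero_iff]
        simpa using hp
      exact ⟨0, fun k => by simp [this]⟩
    | succ d ih =>
      intro p hp
      by_cases h0 : p = 0
      · exact ⟨0, fun k => by simp [h0]⟩
      have h1 : (taylor 1 p - p).degree < p.degree := by
        rw [← degree_taylor p 1]
        refine degree_sub_lt_left (degree_taylor p 1) ?_ ?_
        · exact fun h => h0 ((taylor_injective 1) (by rw [h, map_zero]))
        · rw [leadingCoeff_taylor]
      have h2 : (C (β / (β - α)) * (taylor 1 p - p)).degree < d := by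
        refine ((degree_mul_le _ _).trans (add_le_add_left degree_C_le _)).trans_lt ?_
        rw [zero_add]
        rw [Nat.cast_succ] at hp
        exact h1.trans_le (Order.le_of_lt_succ hp)
      obtain ⟨q, hq⟩ := ih _ h2
      -- The first guess p / (β - α) has error β / (β - α) times p(k + 1) - p(k), of lower degree; q
      -- removes it.
      refine ⟨C (β - α)⁻¹ * p - q, fun k => ?_⟩
      have h3 := hq k
      rw [eval_mul, eval_C, eval_sub, taylor_eval] at h3
      simp only [eval_sub, eval_mul, eval_C]
      field_simp at h3 ⊢
      linear_combination -h3

/-- A first order inhomogeneous recurrence: a particular solution from `exists_difference_eq` plus a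
geometric sequence. For α = 0 it is only a translation. -/
theorem mem_expPoly_of_shift {α : ℂ} {g : ℤ → ℂ}
    (hg : (fun n => g (n + 1) - α • g n) ∈ expPoly) : g ∈ expPoly := by
  by_cases hα : α = 0
  · have key : ∀ f ∈ expPoly, (fun n => f (n - 1)) ∈ expPoly := by
      intro f hf
      induction hf using Submodule.span_induction with
      | mem f hf =>
        obtain ⟨p, β, hβ, rfl⟩ := hf
        convert mem_expPoly (C β⁻¹ * taylor (-1) p) hβ using 2 with k
        simp only [eval_mul, eval_C, taylor_eval, zpow_sub_one₀ hβ]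
        push_cast
        rw [← sub_eq_add_neg]
        ring
      | zero => exact zero_mem _
      | add f f' _ _ h1 h2 => exact add_mem h1 h2
      | smul c f _ h1 => exact Submodule.smul_mem _ c h1
    have := key _ hg
    simpa [hα] using this
  · have key : ∀ f ∈ expPoly, ∃ G ∈ expPoly, ∀ n, G (n + 1) - α * G n = f n := by
      intro f hf
      induction hf using Submodule.span_induction with
      | mem f hf =>
        obtain ⟨p, β, hβ, rfl⟩ := hf
        obtain ⟨q, hq⟩ := exists_difference_eq (β := β) hα p
        refine ⟨_, mem_expPoly q hβ, fun n => ?_⟩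
        simp only [← hq, zpow_add_one₀ hβ]
        push_cast
        ring
      | zero => exact ⟨0, zero_mem _, fun n => by simp⟩
      | add f f' _ _ h1 h2 =>
        obtain ⟨G, hG, h1⟩ := h1
        obtain ⟨G', hG', h2⟩ := h2
        refine ⟨G + G', add_mem hG hG', fun n => ?_⟩
        rw [Pi.add_apply, Pi.add_apply, Pi.add_apply, ← h1, ← h2]
        ring
      | smul c f _ h1 =>
        obtain ⟨G, hG, h1⟩ := h1
        refine ⟨c • G, Submodule.smul_mem _ c hG, fun n => ?_⟩
        rw [Pi.smul_apply, Pi.smul_apply, Pi.smul_apply, ← h1]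
        simp only [smul_eq_mul]
        ring
    obtain ⟨G, hG, hrec⟩ := key _ hg
    have hstep : ∀ n, g (n + 1) - G (n + 1) = α * (g n - G n) := by
      intro n
      have := hrec n
      rw [smul_eq_mul] at this
      linear_combination -this
    have hgeo : ∀ n : ℤ, g n - G n = (C (g 0 - G 0)).eval (n : ℂ) * α ^ n := by
      intro n
      rw [eval_C]
      induction n using Int.induction_on with
      | zero => simp
      | succ n ih => rw [hstep, ih, zpow_add_one₀ hα]; ring
      | pred n ih =>
        have h1 := hstep (-(n : ℤ) - 1)
        rw [sub_add_cancel, ih] at h1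
        rw [zpow_sub_one₀ hα]
        field_simp
        linear_combination -h1
    have e : g = G + fun n : ℤ => (C (g 0 - G 0)).eval (n : ℂ) * α ^ n := by
      funext n
      rw [Pi.add_apply, ← hgeo]
      ring
    rw [e]
    exact add_mem hG (mem_expPoly _ hα)

/-- A two-sided sequence that satisfies a linear recurrence is exp-polynomial. -/
theorem mem_expPoly_of_recurrence {P : ℂ[X]} (hP : P ≠ 0) {g : ℤ → ℂ}
    (hg : ∀ n, recL g n P = 0) : g ∈ expPoly := by
  induction hd : P.natDegree generalizing P g with
  | zero =>
    rw [eq_C_of_natDegree_eq_zero hd] at hg hP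
    have hc : P.coeff 0 ≠ 0 := fun H => hP (by rw [H, C_0])
    have : g = 0 := by
      funext n
      have h1 := hg n
      rw [← monomial_zero_left, recL_monomial, Nat.cast_zero, add_zero] at h1
      exact (smul_eq_zero.1 h1).resolve_left hc
    rw [this]
    exact zero_mem _
  | succ d ih =>
    obtain ⟨α, hα⟩ := IsAlgClosed.exists_root P (by
      rw [degree_eq_natDegree hP, hd]
      exact_mod_cast Nat.succ_ne_zero d)
    obtain ⟨Q, rfl⟩ := dvd_iff_isRoot.2 hα
    have hQ : Q ≠ 0 := right_ne_zero_of_mul hP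
    refine mem_expPoly_of_shift (α := α) (ih hQ (fun n => ?_) ?_)
    · rw [← recL_sub_C_mul]
      exact hg n
    · rw [natDegree_mul (X_sub_C_ne_zero α) hQ, natDegree_X_sub_C] at hd
      omega

end ExpPoly

/-! ## The top level of an irreducible module -/

section TopLevel

variable {V : Type*} [AddCommGroup V] [Module ℂ V]

/-- Two commuting operators, inverse to each other at `v`, move `v` along a two-sided sequence. -/
theorem exists_orbit {X Y : Module.End ℂ V} (hXY : ∀ u, X (Y u) = Y (X u)) {v : V}
    (hv : Y (X v) = v) : ∃ u : ℤ → V, u 0 = v ∧ (∀ n, X (u n) = u (n + 1)) ∧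
      ∀ n, Y (u n) = u (n - 1) := by
  have hX : ∀ n : ℕ, X ((Y ^ (n + 1)) v) = (Y ^ n) v := by
    intro n
    induction n with
    | zero => simpa [hXY] using hv
    | succ n ih => rw [pow_succ', Module.End.mul_apply, hXY, ih, pow_succ', Module.End.mul_apply]
  have hY : ∀ n : ℕ, Y ((X ^ (n + 1)) v) = (X ^ n) v := by
    intro n
    induction n with
    | zero => simpa using hv
    | succ n ih => rw [pow_succ', Module.End.mul_apply, ← hXY, ih, pow_succ', Module.End.mul_apply]
  let u : ℤ → V := fun n => if 0 ≤ n then (X ^ n.toNat) v else (Y ^ (-n).toNat) v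
  have hpos : ∀ n : ℕ, u n = (X ^ n) v := fun n => by
    simp only [u]
    rw [if_pos (Int.natCast_nonneg n), Int.toNat_natCast]
  have hneg : ∀ n : ℕ, u (-n) = (Y ^ n) v := fun n => by
    rcases n with _ | n
    · simpa using hpos 0
    · simp only [u]
      rw [if_neg (by omega), neg_neg, Int.toNat_natCast]
  refine ⟨u, by simpa using hpos 0, fun n => ?_, fun n => ?_⟩
  · obtain ⟨m, rfl | rfl⟩ := Int.eq_nat_or_neg n
    · rw [hpos, ← Nat.cast_succ, hpos, pow_succ', Module.End.mul_apply]
    · rcases m with _ | m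
      · have := hpos 1
        simp only [Nat.cast_one, pow_one] at this
        rw [hneg, pow_zero, Module.End.one_apply, Nat.cast_zero, neg_zero, zero_add, this]
      · have e : (-((m + 1 : ℕ) : ℤ) + 1) = -(m : ℤ) := by push_cast; ring
        rw [hneg, hX, e, hneg]
  · obtain ⟨m, rfl | rfl⟩ := Int.eq_nat_or_neg n
    · rcases m with _ | m
      · have := hneg 1
        simp only [Nat.cast_one, pow_one] at this
        rw [hpos, pow_zero, Module.End.one_apply, Nat.cast_zero, zero_sub, this]
      · have e : (((m + 1 : ℕ) : ℤ) - 1) = (m : ℤ) := by push_cast; ring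
        rw [hpos, hY, e, hpos]
    · have e : (-(m : ℤ) - 1) = -((m + 1 : ℕ) : ℤ) := by push_cast; ring
      rw [hneg, e, hneg, pow_succ', Module.End.mul_apply]

variable [LieRingModule L V] [LieModule ℂ L V] {𝒱 : Gam → Submodule ℂ V} {η : Gam →+ ℂ}
  (b : Module.Basis (Fin 2) ℤ Gam)

variable (V) in
/-- The product of the operators `D(k b₂)`, `k ∈ σ`. -/
def hact (σ : List ℤ) : Module.End ℂ V := act V (σ.map fun j => j • b 1)

@[simp] theorem hact_nil (v : V) : hact V b [] v = v := rfl

@[simp] theorem hact_cons (j : ℤ) (σ : List ℤ) (v : V) :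
    hact V b (j :: σ) v = ⁅D (j • b 1), hact V b σ v⁆ := by rw [hact, List.map_cons, act_cons]; rfl

@[simp] theorem hact_append (σ τ : List ℤ) (v : V) :
    hact V b (σ ++ τ) v = hact V b σ (hact V b τ v) := by rw [hact, List.map_append, act_append]; rfl

theorem hact_mem (h𝒱 : IsGradedModule 𝒱) (σ : List ℤ) {d : Gam} {v : V} (hv : v ∈ 𝒱 d) :
    hact V b σ v ∈ 𝒱 (d + σ.sum • b 1) := by
  have := act_mem h𝒱.lie_mem (σ.map fun j => j • b 1) hv
  rwa [sum_map_smul, add_comm] at this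

section

variable (hη : ∀ m, ∀ v : V, ⁅h m, v⁆ = η m • v) (hb : η (b 1) = 0)
include hη hb

/-- The D(j b₂) commute on V because their only commutators are multiples of h(b₂), which acts by
η(b₂) = 0. -/
theorem lie_hact (j : ℤ) (σ : List ℤ) (v : V) :
    ⁅D (j • b 1), hact V b σ v⁆ = hact V b σ ⁅D (j • b 1), v⁆ := by
  induction σ with
  | nil => rfl
  | cons k σ ih => rw [hact_cons, hact_cons, ← ih, lie_D_smul hη, hb, mul_zero, ite_self, zero_smul,
      add_zero]

theorem hact_comm (σ τ : List ℤ) (v : V) :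
    hact V b σ (hact V b τ v) = hact V b τ (hact V b σ v) := by
  induction σ with
  | nil => rfl
  | cons k σ ih => rw [hact_cons, hact_cons, ih, lie_hact b hη hb]

variable (h𝒱 : IsGradedModule 𝒱) (hO : InO 𝒱)
include h𝒱 hO

omit hb in
-- By irreducibility all words in the D(r) applied to v span; straightening reduces a word of level
-- zero on a highest weight vector to products of the D(j b₂).
theorem component_eq_span_hact {d : Gam} {v : V} (hv : v ∈ 𝒱 d) (hv0 : v ≠ 0)
    (hh : v ∈ highest b V) (k : ℤ) :
    𝒱 (d + k • b 1) ≤ Submodule.span ℂ {x | ∃ σ : List ℤ, σ.sum = k ∧ x = hact V b σ v} := by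
  obtain ⟨π, hπ⟩ := exists_gradProj h𝒱.isInternal
  have h1 := gen_eq_top hπ h𝒱.lie_mem hO.irreducible hv hv0
  have h2 := component_eq_span hπ h𝒱.lie_mem hv h1 (k • b 1)
  rw [add_comm d, h2, Submodule.span_le]
  rintro _ ⟨l, hl, rfl⟩
  let T : ℤ → Submodule ℂ V := fun k =>
    Submodule.span ℂ {x | ∃ σ : List ℤ, σ.sum = k ∧ x = hact V b σ v}
  have hT : ∀ k, T k ≤ highest b V := by
    intro k
    refine Submodule.span_le.2 ?_
    rintro _ ⟨σ, -, rfl⟩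
    refine (act_highest_vector b _ hh).2 ?_
    rw [sum_map_smul, repr_smul_zero]
  have h3 := (act_top b T (fun r hr k x hx => hT k hx r hr) (fun r hr k x hx => ?_)
    (fun m k x hx => by rw [hη]; exact (T k).smul_mem _ hx) l 0 v
    (Submodule.subset_span ⟨[], rfl, rfl⟩)).2 (by rw [hl, repr_smul_zero])
  · rw [hl, repr_smul_one, zero_add] at h3
    exact h3
  · rw [eq_smul_of_lvl_zero b hr, repr_smul_one]
    generalize b.repr r 1 = j
    induction hx using Submodule.span_induction with
    | mem x hx =>
      obtain ⟨σ, hσ, rfl⟩ := hx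
      exact Submodule.subset_span ⟨j :: σ, by rw [List.sum_cons, hσ, add_comm], by rw [hact_cons]⟩
    | zero => rw [lie_zero]; exact zero_mem _
    | add x y _ _ hx hy => rw [lie_add]; exact add_mem hx hy
    | smul a x _ hx => rw [lie_smul]; exact Submodule.smul_mem _ a hx

variable {n : Gam} (htop : ∀ r, b.repr n 0 < b.repr r 0 → 𝒱 r = ⊥)
include htop

omit hη hb hO in
theorem mem_highest_of_level {d : Gam} (hd : b.repr d 0 = b.repr n 0) {v : V} (hv : v ∈ 𝒱 d) :
    v ∈ highest b V := by
  intro r hr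
  have := h𝒱.lie_mem r d v hv
  rwa [htop, Submodule.mem_bot] at this
  rw [map_add, Finsupp.add_apply]
  omega

/-- An eigenvector exists, the component is spanned by products of the D(j b₂) applied to it, and
these commute with the operator. It follows that top components have dimension at most one. -/
theorem hact_eq_smul {d : Gam} (hd : b.repr d 0 = b.repr n 0) {σ : List ℤ} (hσ : σ.sum = 0) :
    ∃ c : ℂ, ∀ v ∈ 𝒱 d, hact V b σ v = c • v := by
  by_cases hd0 : 𝒱 d = ⊥
  · refine ⟨0, fun v hv => ?_⟩
    rw [hd0, Submodule.mem_bot] at hv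
    rw [hv, map_zero, smul_zero]
  have := hO.quasiFinite d
  obtain ⟨c, w, hw, hw0, hc⟩ := exists_eigenvector hd0 (hact V b σ) (fun x hx => by
    have := hact_mem b h𝒱 σ hx
    rwa [hσ, zero_smul, add_zero] at this)
  refine ⟨c, fun v hv => ?_⟩
  have h1 := component_eq_span_hact b hη h𝒱 hO hw hw0 (mem_highest_of_level b h𝒱 htop hd hw) 0
  rw [zero_smul, add_zero] at h1
  have h2 := h1 hv
  have e : Submodule.span ℂ {x | ∃ τ : List ℤ, τ.sum = 0 ∧ x = hact V b τ w} ≤ 𝒱 d :=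
    Submodule.span_le.2 (by
      rintro _ ⟨τ, hτ, rfl⟩
      have := hact_mem b h𝒱 τ hw
      rwa [hτ, zero_smul, add_zero] at this)
  induction h2 using Submodule.span_induction with
  | mem x hx =>
    obtain ⟨τ, -, rfl⟩ := hx
    rw [hact_comm b hη hb, hc, map_smul]
  | zero => rw [map_zero, smul_zero]
  | add x y hx' hy' hx hy =>
    rw [map_add, hx (e hx'), hy (e hy'), smul_add]
  | smul a x hx' hx =>
    rw [map_smul, hx (e hx'), smul_comm]

theorem eq_smul_of_level {d : Gam} (hd : b.repr d 0 = b.repr n 0) {v w : V} (hv : v ∈ 𝒱 d)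
    (hv0 : v ≠ 0) (hw : w ∈ 𝒱 d) : ∃ c : ℂ, w = c • v := by
  have h1 := component_eq_span_hact b hη h𝒱 hO hv hv0 (mem_highest_of_level b h𝒱 htop hd hv) 0
  rw [zero_smul, add_zero] at h1
  suffices H : 𝒱 d ≤ Submodule.span ℂ {v} by
    obtain ⟨c, hc⟩ := Submodule.mem_span_singleton.1 (H hw)
    exact ⟨c, hc.symm⟩
  refine h1.trans (Submodule.span_le.2 ?_)
  rintro _ ⟨τ, hτ, rfl⟩
  obtain ⟨c, hc⟩ := hact_eq_smul b hη hb h𝒱 hO htop hd hτ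
  rw [hc v hv]
  exact Submodule.smul_mem _ _ (Submodule.mem_span_singleton_self v)

/-- A nonzero image of v generates the component of v again, so some product τ of opposite total
does not kill it, and τ σ is then a nonzero scalar. -/
theorem exists_hact_inverse {d : Gam} (hd : b.repr d 0 = b.repr n 0) {v : V} (hv : v ∈ 𝒱 d)
    {σ : List ℤ} (hσ : hact V b σ v ≠ 0) : ∃ (τ : List ℤ) (c : ℂ), c ≠ 0 ∧ τ.sum = -σ.sum ∧
      hact V b τ (hact V b σ v) = c • v := by
  have hv0 : v ≠ 0 := fun H => hσ (by rw [H, map_zero])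
  have hd' : b.repr (d + σ.sum • b 1) 0 = b.repr n 0 := by
    rw [map_add, Finsupp.add_apply, repr_smul_zero, add_zero, hd]
  have hm := hact_mem b h𝒱 σ hv
  have h1 := component_eq_span_hact b hη h𝒱 hO hm hσ (mem_highest_of_level b h𝒱 htop hd' hm)
    (-σ.sum)
  have e : d + σ.sum • b 1 + (-σ.sum) • b 1 = d := by module
  rw [e] at h1
  obtain ⟨τ, hτ, hτ0⟩ : ∃ τ : List ℤ, τ.sum = -σ.sum ∧ hact V b τ (hact V b σ v) ≠ 0 := by
    by_contra! H
    refine hv0 ((Submodule.mem_bot ℂ).1 ((h1.trans (Submodule.span_le.2 ?_)) hv))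
    rintro _ ⟨τ, hτ, rfl⟩
    exact H τ hτ
  obtain ⟨c, hc⟩ := hact_eq_smul b hη hb h𝒱 hO htop hd (σ := τ ++ σ) (by
    rw [List.sum_append, hτ, neg_add_cancel])
  have h2 := hc v hv
  rw [hact_append] at h2
  exact ⟨τ, c, fun H => hτ0 (by rw [h2, H, zero_smul]), hτ, h2⟩

/-- The top level of `V` has a basis of vectors `U k`, `s ∣ k`, on which the `D(j b₂)` act by
translations up to scalars. -/
theorem exists_top_sequence (hn : 𝒱 n ≠ ⊥) : ∃ (s : ℕ) (U : ℤ → V) (ψ : ℤ → ℂ),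
    (∀ k, U k ∈ 𝒱 (n + k • b 1)) ∧ (∀ k, (s : ℤ) ∣ k → U k ≠ 0) ∧
    (∀ k, ¬ (s : ℤ) ∣ k → U k = 0) ∧ (∀ j, ¬ (s : ℤ) ∣ j → ψ j = 0) ∧
    (∀ j k, ⁅D (j • b 1), U k⁆ = ψ j • U (k + j)) ∧
    ∃ σ : List ℤ, σ.sum = s ∧ hact V b σ (U 0) ≠ 0 ∧
      ∃ τ : List ℤ, τ.sum = -s ∧ hact V b τ (U 0) ≠ 0 := by
  obtain ⟨v, hv, hv0⟩ := (Submodule.ne_bot_iff _).1 hn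
  -- The shifts reachable from v by a product that does not kill it; inverses come from
  -- `exists_hact_inverse`, and s is the nonnegative generator.
  let S : AddSubgroup ℤ :=
    { carrier := {k | ∃ σ : List ℤ, σ.sum = k ∧ hact V b σ v ≠ 0}
      zero_mem' := ⟨[], rfl, hv0⟩
      add_mem' := by
        rintro _ _ ⟨σ, rfl, hσ⟩ ⟨σ', rfl, hσ'⟩
        refine ⟨σ' ++ σ, by rw [List.sum_append, add_comm], fun H => ?_⟩
        obtain ⟨τ, c, hc, -, hτ⟩ := exists_hact_inverse b hη hb h𝒱 hO htop rfl hv hσ'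
        rw [hact_append] at H
        have h1 : hact V b σ (hact V b τ (hact V b σ' v)) = 0 := by
          rw [hact_comm b hη hb σ, hact_comm b hη hb σ, H, map_zero]
        rw [hτ, map_smul] at h1
        exact smul_ne_zero hc hσ h1
      neg_mem' := by
        rintro _ ⟨σ, rfl, hσ⟩
        obtain ⟨τ, c, hc, hsum, hτ⟩ := exists_hact_inverse b hη hb h𝒱 hO htop rfl hv hσ
        refine ⟨τ, hsum, fun H => ?_⟩
        rw [hact_comm b hη hb, H, map_zero] at hτ
        exact smul_ne_zero hc hv0 hτ.symm }
  have hS : ∀ k, k ∈ S ↔ ∃ σ : List ℤ, σ.sum = k ∧ hact V b σ v ≠ 0 := fun k => Iff.rfl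
  obtain ⟨a, ha⟩ := Int.subgroup_cyclic S
  have haS : ∀ k, k ∈ S ↔ (a.natAbs : ℤ) ∣ k := by
    intro k
    rw [ha, AddSubgroup.mem_closure_singleton, Int.natAbs_dvd]
    constructor
    · rintro ⟨m, rfl⟩
      exact ⟨m, by rw [smul_eq_mul, mul_comm]⟩
    · rintro ⟨m, rfl⟩
      exact ⟨m, by rw [smul_eq_mul, mul_comm]⟩
  set s := a.natAbs
  have hzero : ∀ k, ¬ (s : ℤ) ∣ k → 𝒱 (n + k • b 1) = ⊥ := by
    intro k hk
    rw [← haS, hS] at hk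
    push Not at hk
    rw [eq_bot_iff]
    refine (component_eq_span_hact b hη h𝒱 hO hv hv0
      (mem_highest_of_level b h𝒱 htop rfl hv) k).trans (Submodule.span_le.2 ?_)
    rintro _ ⟨σ, hσ, rfl⟩
    exact hk σ hσ
  obtain ⟨σ, hσ, hσ0⟩ := (hS s).1 ((haS s).2 dvd_rfl)
  obtain ⟨τ, hτ, hτ0⟩ := (hS (-s)).1 ((haS (-s)).2 (dvd_neg.2 dvd_rfl))
  obtain ⟨c, hc⟩ := hact_eq_smul b hη hb h𝒱 hO htop (d := n) rfl (σ := τ ++ σ) (by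
    rw [List.sum_append, hσ, hτ, neg_add_cancel])
  have hc := hc v hv
  rw [hact_append] at hc
  have hc0 : c ≠ 0 := by
    rintro rfl
    obtain ⟨τ', c', hc', -, hτ'⟩ := exists_hact_inverse b hη hb h𝒱 hO htop rfl hv hσ0
    have h1 := congrArg (hact V b τ') hc
    rw [hact_comm b hη hb, hτ', map_smul, zero_smul, map_zero] at h1
    exact smul_ne_zero hc' hτ0 h1
  -- The basis of the top level is normalized as the orbit of v under one product of total s, with
  -- inverse c⁻¹ τ. This makes the scalar of D(j b₂) the same at every point.
  obtain ⟨u, hu0, hX, hY⟩ := exists_orbit (X := hact V b σ) (Y := c⁻¹ • hact V b τ) (v := v)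
    (fun u => by
      rw [LinearMap.smul_apply, LinearMap.smul_apply, map_smul, hact_comm b hη hb])
    (by rw [LinearMap.smul_apply, hc, smul_smul, inv_mul_cancel₀ hc0, one_smul])
  have hune : ∀ m, u m ≠ 0 := by
    intro m
    induction m using Int.induction_on with
    | zero => rwa [hu0]
    | succ m ih =>
      intro H
      have := hY (m + 1)
      rw [H, map_zero, add_sub_cancel_right] at this
      exact ih this.symm
    | pred m ih =>
      intro H
      have := hX (-(m : ℤ) - 1)
      rw [H, map_zero, sub_add_cancel] at this
      exact ih this.symm
  have humem : ∀ m : ℤ, u m ∈ 𝒱 (n + (m * s) • b 1) := by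
    intro m
    induction m using Int.induction_on with
    | zero => rwa [hu0, zero_mul, zero_smul, add_zero]
    | succ m ih =>
      have := hact_mem b h𝒱 σ ih
      rwa [hX, hσ, add_assoc, ← add_smul, ← add_one_mul] at this
    | pred m ih =>
      have := (𝒱 _).smul_mem c⁻¹ (hact_mem b h𝒱 τ ih)
      rwa [← LinearMap.smul_apply, hY, hτ, add_assoc, ← add_smul, ← sub_eq_add_neg,
        ← sub_one_mul] at this
  have hlie : ∀ (j m : ℤ) (t : ℂ), ⁅D (j • b 1), u 0⁆ = t • u m →
      ∀ k, ⁅D (j • b 1), u k⁆ = t • u (m + k) := by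
    intro j m t h0 k
    induction k using Int.induction_on with
    | zero => rwa [add_zero]
    | succ k ih => rw [← hX, lie_hact b hη hb, ih, map_smul, hX, add_assoc]
    | pred k ih =>
      rw [← hY, LinearMap.smul_apply, lie_smul, lie_hact b hη hb, ih, map_smul, smul_comm,
        ← LinearMap.smul_apply, hY, add_sub_assoc]
  -- For s = 0 the quotient is 0, so only `U 0` is nonzero. This degenerate case is ruled out later
  -- by `exists_lie_ne_zero`.
  let U : ℤ → V := fun k => if (s : ℤ) ∣ k then u (k / s) else 0
  have hU : ∀ m : ℤ, U (m * s) = u (if s = 0 then 0 else m) := by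
    intro m
    simp only [U]
    rw [if_pos ⟨m, mul_comm _ _⟩]
    split_ifs with h0
    · simp [h0]
    · rw [Int.mul_ediv_cancel _ (by exact_mod_cast h0)]
  have hU' : ∀ k, ¬ (s : ℤ) ∣ k → U k = 0 := fun k hk => if_neg hk
  have hU0 : U 0 = v := by
    have := hU 0
    rw [ite_self, zero_mul, hu0] at this
    exact this
  have hUmem : ∀ k, U k ∈ 𝒱 (n + k • b 1) := by
    intro k
    by_cases hk : (s : ℤ) ∣ k
    · obtain ⟨m, rfl⟩ := hk
      rw [mul_comm, hU]
      split_ifs with h0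
      · have := humem 0
        rw [zero_mul] at this
        rw [h0, Nat.cast_zero, mul_zero]
        exact this
      · exact humem m
    · rw [hU' k hk]; exact zero_mem _
  have key : ∀ j, ∃ t : ℂ, (¬ (s : ℤ) ∣ j → t = 0) ∧
      ∀ k, ⁅D (j • b 1), U k⁆ = t • U (k + j) := by
    intro j
    by_cases hj : (s : ℤ) ∣ j
    · obtain ⟨m, rfl⟩ := hj
      rw [mul_comm]
      have h1 := h𝒱.lie_mem ((m * s) • b 1) _ _ (humem 0)
      rw [zero_mul, zero_smul, add_zero, add_comm] at h1
      obtain ⟨t, ht⟩ := eq_smul_of_level b hη hb h𝒱 hO htop (d := n + (m * s) • b 1) (by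
        rw [map_add, Finsupp.add_apply, repr_smul_zero, add_zero]) (humem m) (hune m) h1
      refine ⟨t, fun H => absurd ⟨m, mul_comm _ _⟩ H, fun k => ?_⟩
      by_cases hk : (s : ℤ) ∣ k
      · obtain ⟨m', rfl⟩ := hk
        rw [mul_comm (s : ℤ) m', ← add_mul, hU, hU]
        split_ifs with h0
        · rw [h0, Nat.cast_zero, mul_zero, zero_smul, D_zero, zero_lie] at ht ⊢
          have : t = 0 := (smul_eq_zero.1 ht.symm).resolve_right (hune m)
          rw [this, zero_smul]
        · rw [hlie _ _ _ ht, add_comm]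
      · rw [hU' k hk, lie_zero, hU' _ (fun H => hk ((Int.dvd_add_left ⟨m, mul_comm _ _⟩).1 H)),
          smul_zero]
    · refine ⟨0, fun _ => rfl, fun k => ?_⟩
      rw [zero_smul]
      by_cases hk : (s : ℤ) ∣ k
      · have h1 := h𝒱.lie_mem (j • b 1) _ _ (hUmem k)
        have e : j • b 1 + (n + k • b 1) = n + (k + j) • b 1 := by module
        rw [e, hzero _ (fun H => hj ((Int.dvd_add_right hk).1 H)), Submodule.mem_bot] at h1
        exact h1
      · rw [hU' k hk, lie_zero]
  choose ψ hψ1 hψ2 using key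
  refine ⟨s, U, ψ, hUmem, fun k hk => ?_, hU', hψ1, hψ2, σ, hσ, by rwa [hU0], τ, hτ, by rwa [hU0]⟩
  obtain ⟨m, rfl⟩ := hk
  rw [mul_comm, hU]
  exact hune _

end

end TopLevel

/-! ## The function attached to the top level is exp-polynomial -/

section TopFunction

open Polynomial

variable {V : Type*} [AddCommGroup V] [Module ℂ V] [LieRingModule L V] [LieModule ℂ L V]
  {𝒱 : Gam → Submodule ℂ V} {η : Gam →+ ℂ} (b : Module.Basis (Fin 2) ℤ Gam)

section

variable (hη : ∀ m, ∀ v : V, ⁅h m, v⁆ = η m • v) (hb : η (b 1) = 0)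
include hη hb

theorem lie_E_one_E_neg_one (k m : ℤ) (v : V) : ⁅E b 1 k, ⁅E b (-1) m, v⁆⁆ =
    ⁅E b (-1) m, ⁅E b 1 k, v⁆⁆ +
      (-((k + m : ℤ) * det (b 0) (b 1) : ℂ)) • ⁅D ((k + m) • b 1), v⁆ +
      if k + m = 0 then η (b 0) • v else 0 := by
  have e : (1 : ℤ) • b 0 + k • b 1 + ((-1 : ℤ) • b 0 + m • b 1) = (k + m) • b 1 := by module
  have e2 : η ((1 : ℤ) • b 0 + k • b 1) = η (b 0) := by
    rw [map_add, map_zsmul, map_zsmul, hb, smul_zero, add_zero, one_smul]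
  rw [E, E, lie_lie_D, e, det_comb, hη, e2]
  congr 1
  · congr 2
    push_cast
    ring
  · have : (k + m) • b 1 = 0 ↔ k + m = 0 := by
      rw [smul_eq_zero, or_iff_left (b.ne_zero 1)]
    simp only [this]

theorem lie_E_one_lowered (k m : ℤ) {v : V} (hv : v ∈ highest b V) : ⁅E b 1 k, ⁅E b (-1) m, v⁆⁆ =
    (-((k + m : ℤ) * det (b 0) (b 1) : ℂ)) • ⁅D ((k + m) • b 1), v⁆ +
      if k + m = 0 then η (b 0) • v else 0 := by
  have h1 : ⁅E b 1 k, v⁆ = 0 := hv _ (by rw [repr_comb_zero]; norm_num)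
  rw [lie_E_one_E_neg_one b hη hb, h1, lie_zero, zero_add]

omit hη hb in
theorem lie_D_E_neg_one (j m : ℤ) (v : V) : ⁅D (j • b 1), ⁅E b (-1) m, v⁆⁆ =
    ⁅E b (-1) m, ⁅D (j • b 1), v⁆⁆ + (-(j * det (b 0) (b 1) : ℂ)) • ⁅E b (-1) (j + m), v⁆ := by
  have e : j • b 1 + ((-1 : ℤ) • b 0 + m • b 1) = (-1 : ℤ) • b 0 + (j + m) • b 1 := by module
  have hd := det_comb b 0 j (-1) m
  rw [zero_smul, zero_add] at hd
  have h0 : (-1 : ℤ) • b 0 + (j + m) • b 1 ≠ 0 := by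
    intro H
    have := repr_comb_zero b (-1) (j + m)
    rw [H, LinearEquiv.map_zero, Finsupp.zero_apply] at this
    norm_num at this
  rw [E, lie_lie_D, e, if_neg h0, add_zero, hd, E]
  congr 2
  push_cast
  ring

/-- A quasi-finite module has no highest weight vector killed by all `D(k b₂)`. -/
theorem exists_lie_ne_zero (h𝒱 : IsGradedModule 𝒱) (hb0 : η (b 0) ≠ 0)
    (hfin : ∀ n, FiniteDimensional ℂ (𝒱 n)) {n : Gam} {v : V} (hv : v ∈ 𝒱 n) (hv0 : v ≠ 0)
    (hh : v ∈ highest b V) : ∃ j : ℤ, ⁅D (j • b 1), v⁆ ≠ 0 := by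
  by_contra! H
  have hδ : (det (b 0) (b 1) : ℂ) ≠ 0 := by exact_mod_cast det_basis_ne_zero b
  have h1 : ∀ k m : ℤ, ⁅E b 1 k, ⁅E b (-1) m, v⁆⁆ = if k + m = 0 then η (b 0) • v else 0 := by
    intro k m
    rw [lie_E_one_lowered b hη hb k m hh, H, smul_zero, zero_add]
  have hy : ∀ k : ℤ, ⁅E b (-1) k, v⁆ ≠ 0 := by
    intro k hk
    have := h1 (-k) k
    rw [hk, lie_zero, if_pos (neg_add_cancel k)] at this
    exact smul_ne_zero hb0 hv0 this.symm
  -- The vectors on the left before applying level one all lie in degree n - 2b₁. They turn out to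
  -- be independent because the coefficient is a quadratic polynomial plus a Kronecker term.
  have hz : ∀ k p : ℤ, 0 < k → 0 < p → ⁅E b 1 k, ⁅E b (-1) p, ⁅E b (-1) (-p), v⁆⁆⁆ =
      ((det (b 0) (b 1) : ℂ) ^ 2 * (k + p) ^ 2 + if k = p then η (b 0) else 0) •
        ⁅E b (-1) k, v⁆ := by
    intro k p hk hp
    have e1 : k + p + -p = k := by ring
    rw [lie_E_one_E_neg_one b hη hb, h1, lie_D_E_neg_one, H, lie_zero, zero_add,
      if_neg (by omega : ¬ k + p = 0), add_zero, e1, add_smul, smul_smul, add_comm]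
    congr 1
    · congr 1
      push_cast
      ring
    · by_cases hkp : k = p
      · rw [if_pos (by omega), if_pos hkp, hkp, lie_smul]
      · rw [if_neg (by omega), if_neg hkp, lie_zero, zero_smul]
  let N := Module.finrank ℂ (𝒱 ((-2 : ℤ) • b 0 + n)) + 1
  have hfd := hfin ((-2 : ℤ) • b 0 + n)
  have hind : LinearIndependent ℂ fun i : Fin N =>
      ⁅E b (-1) ((i : ℤ) + 1), ⁅E b (-1) (-((i : ℤ) + 1)), v⁆⁆ := by
    rw [Fintype.linearIndependent_iff]
    intro g hg
    have hk : ∀ k : ℤ, 0 < k → ∑ i : Fin N, g i * ((det (b 0) (b 1) : ℂ) ^ 2 *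
        (k + ((i : ℤ) + 1 : ℤ)) ^ 2 + if k = (i : ℤ) + 1 then η (b 0) else 0) = 0 := by
      intro k hk
      have h2 := congrArg (fun x => ⁅E b 1 k, x⁆) hg
      simp only [lie_sum, lie_smul, lie_zero] at h2
      rw [Finset.sum_congr rfl fun i _ => by rw [hz k _ hk (by omega), smul_smul],
        ← Finset.sum_smul] at h2
      exact (smul_eq_zero.1 h2).resolve_right (hy k)
    -- For k > N a linear relation involves only the quadratic part, so Q has infinitely many roots
    -- and vanishes. Evaluating at k = i + 1 then isolates g(i) η(b₁).
    let Q : ℂ[X] := ∑ i : Fin N, C (g i * (det (b 0) (b 1) : ℂ) ^ 2) *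
      (X + C (((i : ℤ) + 1 : ℤ) : ℂ)) ^ 2
    have hQeval : ∀ x : ℂ, Q.eval x = ∑ i : Fin N, g i * ((det (b 0) (b 1) : ℂ) ^ 2 *
        (x + ((i : ℤ) + 1 : ℤ)) ^ 2) := by
      intro x
      rw [eval_finsetSum]
      refine Finset.sum_congr rfl fun i _ => ?_
      simp only [eval_mul, eval_pow, eval_add, eval_X, eval_C]
      ring
    have hQ : Q = 0 := by
      refine eq_zero_of_infinite_isRoot Q ?_
      refine Set.infinite_of_injective_forall_mem (f := fun m : ℕ => ((N + 1 + m : ℕ) : ℂ))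
        (fun a a' haa => by
          have := Nat.cast_injective haa
          omega) fun m => ?_
      change Q.eval _ = 0
      rw [hQeval]
      have h3 := hk (N + 1 + m : ℕ) (by omega)
      rw [← h3]
      refine Finset.sum_congr rfl fun i _ => ?_
      have hi := i.2
      rw [if_neg (by omega), add_zero, Int.cast_natCast]
    intro i
    have h3 := hk (i + 1) (by omega)
    simp only [mul_add] at h3
    rw [Finset.sum_add_distrib] at h3
    have h4 := hQeval ((i + 1 : ℤ) : ℂ)
    rw [hQ, eval_zero] at h4
    rw [← h4, zero_add, Finset.sum_eq_single i, if_pos rfl] at h3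
    · exact (mul_eq_zero.1 h3).resolve_right hb0
    · intro j _ hj
      rw [if_neg, mul_zero]
      intro hij
      exact hj (Fin.ext (by omega))
    · exact fun hi => absurd (Finset.mem_univ i) hi
  have := le_finrank (S := 𝒱 ((-2 : ℤ) • b 0 + n)) hind fun i => by
    have h2 := h𝒱.lie_mem ((-1 : ℤ) • b 0 + ((i : ℤ) + 1) • b 1) _ _
      (h𝒱.lie_mem ((-1 : ℤ) • b 0 + (-((i : ℤ) + 1)) • b 1) _ _ hv)
    have e : (-1 : ℤ) • b 0 + ((i : ℤ) + 1) • b 1 +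
        ((-1 : ℤ) • b 0 + (-((i : ℤ) + 1)) • b 1 + n) = (-2 : ℤ) • b 0 + n := by module
    rwa [e] at h2
  simp only [N] at this
  omega

/-- The finite-dimensionality of a component of level one below the top yields a linear recurrence
for the function `k ↦ k ψ_k`. -/
theorem mem_expPoly_of_top_sequence (h𝒱 : IsGradedModule 𝒱)
    (hfin : ∀ n, FiniteDimensional ℂ (𝒱 n)) {n : Gam} {s : ℕ} (hs : s ≠ 0) {U : ℤ → V}
    {ψ : ℤ → ℂ} (hU : ∀ k, U k ∈ 𝒱 (n + k • b 1)) (hU0 : ∀ k, (s : ℤ) ∣ k → U k ≠ 0)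
    (hUh : ∀ k, U k ∈ highest b V)
    (hψ0 : ∀ j, ¬ (s : ℤ) ∣ j → ψ j = 0) (hψ : ∀ j k, ⁅D (j • b 1), U k⁆ = ψ j • U (k + j)) :
    (fun k : ℤ => if k = 0 then -η (b 0) / (det (b 0) (b 1) : ℂ) else k * ψ k) ∈ expPoly := by
  have hδ : (det (b 0) (b 1) : ℂ) ≠ 0 := by exact_mod_cast det_basis_ne_zero b
  -- The value at 0 encodes the central term, so that `hlie` is uniform in k + m.
  set g : ℤ → ℂ := fun k => if k = 0 then -η (b 0) / (det (b 0) (b 1) : ℂ) else k * ψ k with hg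
  have hlie : ∀ k m : ℤ, ⁅E b 1 k, ⁅E b (-1) m, U (-m)⁆⁆ =
      (-(det (b 0) (b 1) : ℂ) * g (k + m)) • U k := by
    intro k m
    have e : -m + (k + m) = k := by ring
    rw [lie_E_one_lowered b hη hb k m (hUh _), hψ, e, smul_smul]
    by_cases h0 : k + m = 0
    · have e2 : -m = k := by omega
      rw [if_pos h0, e2, ← add_smul, hg]
      simp only [h0, if_true]
      congr 1
      push_cast
      field_simp
      ring
    · rw [if_neg h0, add_zero, hg]
      simp only [h0, if_false]
      congr 1
      ring
  have hfd := hfin ((-1 : ℤ) • b 0 + n)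
  let N := Module.finrank ℂ (𝒱 ((-1 : ℤ) • b 0 + n)) + 1
  -- The shift of `U` compensates that of the operator, so all these vectors lie in the single
  -- component of degree n - b₁.
  have hdep : ¬ LinearIndependent ℂ fun i : Fin N => ⁅E b (-1) (s * (i : ℕ)), U (-(s * (i : ℕ)))⁆ := by
    intro hind
    have := le_finrank (S := 𝒱 ((-1 : ℤ) • b 0 + n)) hind fun i => by
      have h2 := h𝒱.lie_mem ((-1 : ℤ) • b 0 + ((s : ℤ) * (i : ℕ)) • b 1) _ _
        (hU (-(s * (i : ℕ))))
      have e : (-1 : ℤ) • b 0 + ((s : ℤ) * (i : ℕ)) • b 1 + (n + (-((s : ℤ) * (i : ℕ))) • b 1) =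
        (-1 : ℤ) • b 0 + n := by module
      rwa [e] at h2
    simp only [N] at this
    omega
  rw [Fintype.not_linearIndependent_iff] at hdep
  obtain ⟨a, ha, i₀, hi₀⟩ := hdep
  have hsum : ∀ k : ℤ, ∑ i : Fin N, a i * g (k + s * (i : ℕ)) = 0 := by
    intro k
    -- Applying D(b₁ + k b₂) to the dependence gives the relation as a coefficient of `U k`, which
    -- is nonzero only for s ∣ k; for other k all terms vanish by `hψ0`.
    by_cases hk : (s : ℤ) ∣ k
    · have h2 := congrArg (fun x => ⁅E b 1 k, x⁆) ha
      simp only [lie_sum, lie_smul, lie_zero, hlie, smul_smul] at h2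
      rw [← Finset.sum_smul] at h2
      have h3 := (smul_eq_zero.1 h2).resolve_right (hU0 k hk)
      have h4 : -(det (b 0) (b 1) : ℂ) * ∑ i : Fin N, a i * g (k + s * (i : ℕ)) = 0 := by
        rw [Finset.mul_sum, ← h3]
        exact Finset.sum_congr rfl fun i _ => by ring
      exact (mul_eq_zero.1 h4).resolve_left (neg_ne_zero.2 hδ)
    · refine Finset.sum_eq_zero fun i _ => ?_
      have h2 : ¬ (s : ℤ) ∣ k + s * (i : ℕ) := fun H => hk ((Int.dvd_add_left ⟨_, rfl⟩).1 H)
      have h3 : k + s * (i : ℕ) ≠ 0 := fun H => h2 (H ▸ dvd_zero _)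
      rw [hg]
      simp only [h3, if_false, hψ0 _ h2, mul_zero]
  refine mem_expPoly_of_recurrence (P := ∑ i : Fin N, monomial (s * (i : ℕ)) (a i)) (fun H => hi₀ ?_)
    fun k => ?_
  · have h2 := congrArg (fun Q => coeff Q (s * (i₀ : ℕ))) H
    simp only [finsetSum_coeff, coeff_monomial, coeff_zero] at h2
    rw [Finset.sum_eq_single i₀, if_pos rfl] at h2
    · exact h2
    · intro j _ hj
      rw [if_neg]
      intro H'
      exact hj (Fin.ext (Nat.eq_of_mul_eq_mul_left (Nat.pos_of_ne_zero hs) H'))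
    · exact fun hi => absurd (Finset.mem_univ _) hi
  · rw [map_sum, ← hsum k]
    refine Finset.sum_congr rfl fun i _ => ?_
    rw [recL_monomial, smul_eq_mul]
    push_cast
    rfl

end

end TopFunction

/-! ## Irreducible quasi-finite modules are the modules `V̄(ψ, i, s)` -/

section Classification

theorem h_one_zero : h (1, 0) = c₁ := by simp [h]

theorem h_zero_one : h (0, 1) = c₂ := by simp [h]

variable (b : Module.Basis (Fin 2) ℤ Gam)

section TopFun

variable (η : Gam →+ ℂ) (ψ : ℤ → ℂ)

open Classical in
/-- The linear function on `L` that takes the values `ψ_k` at `D(k b₂)` and `η(m)` at `h(m)` and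
vanishes at the other `D(r)`. -/
def levelFun : L →ₗ[ℂ] ℂ :=
  lift (fun r => if b.repr r 0 = 0 then ψ (b.repr r 1) else 0) (η (1, 0)) (η (0, 1))

/-- The restriction of `levelFun` to `L₀`. -/
def topFun : L0 b →ₗ[ℂ] ℂ := (levelFun b η ψ).domRestrict (L0 b)

theorem levelFun_D (hψ : ψ 0 = 0) (k : ℤ) : levelFun b η ψ (D (k • b 1)) = ψ k := by
  rw [levelFun, lift_D, repr_smul_zero, repr_smul_one, if_pos rfl]
  rw [LinearEquiv.map_zero, Finsupp.zero_apply, Finsupp.zero_apply, if_pos rfl, hψ]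

theorem levelFun_h (m : Gam) : levelFun b η ψ (h m) = η m := by
  have e : m = m.1 • (1, 0) + m.2 • (0, 1) := by ext <;> simp
  conv_rhs => rw [e, map_add, map_zsmul, map_zsmul]
  rw [levelFun, h, map_add, map_zsmul, map_zsmul, lift_c₁, lift_c₂]

theorem topFun_D (hψ : ψ 0 = 0) (k : ℤ) : topFun b η ψ (L0.D b k) = ψ k := levelFun_D b η ψ hψ k

theorem topFun_h (m : Gam) : topFun b η ψ (L0.h b m) = η m := levelFun_h b η ψ m

theorem topFun_isExpPolynomial (hb : η (b 1) = 0) (hb0 : η (b 0) ≠ 0) (hψ : ψ 0 = 0)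
    (hg : (fun k : ℤ => if k = 0 then -η (b 0) / (det (b 0) (b 1) : ℂ) else k * ψ k) ∈ expPoly) :
    IsExpPolynomial b (topFun b η ψ) := by
  have hδ : (det (b 0) (b 1) : ℂ) ≠ 0 := by exact_mod_cast det_basis_ne_zero b
  obtain ⟨r, p, α, hα, hp⟩ := exists_of_mem_expPoly hg
  refine ⟨fun H => hb0 ?_, by rw [topFun_h, hb], r, p, α, hα, fun k hk => ?_, ?_⟩
  · rw [← topFun_h b η ψ, H, LinearMap.zero_apply]
  · have hk' : (k : ℂ) ≠ 0 := by exact_mod_cast hk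
    rw [topFun_D b η ψ hψ, ← hp, if_neg hk, mul_div_cancel_left₀ _ hk']
  · have h0 := hp 0
    rw [if_pos rfl] at h0
    have e : ∑ i, (p i).coeff 0 = -η (b 0) / (det (b 0) (b 1) : ℂ) := by
      rw [h0]
      refine Finset.sum_congr rfl fun i _ => ?_
      rw [Int.cast_zero, zpow_zero, mul_one, Polynomial.coeff_zero_eq_eval_zero]
    rw [topFun_h, e]
    field_simp

end TopFun

/-! ### Recovering the step from two words of opposite totals -/

section Step

open LaurentPolynomial

variable (ψ : L0 b →ₗ[ℂ] ℂ)

theorem wt_smul_T_mem (σ : List ℤ) : wt b ψ σ • (T σ.sum : ℂ[T;T⁻¹]) ∈ aPsi b ψ := by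
  induction σ with
  | nil => simp [wt, T_zero]
  | cons j σ ih =>
    have e : wt b ψ (j :: σ) = ψ (L0.D b j) * wt b ψ σ := by simp [wt]
    by_cases hj : j = 0
    · rw [e, hj, L0_D_zero, LinearMap.map_zero, zero_mul, zero_smul]
      exact zero_mem _
    · rw [e, List.sum_cons, T_add, ← smul_mul_smul_comm]
      exact mul_mem (Algebra.subset_adjoin ⟨j, hj, rfl⟩) ih

theorem hasStep_of_wt {s : ℕ} (hs : s ≠ 0) (hψ : ∀ k : ℤ, ¬ (s : ℤ) ∣ k → ψ (L0.D b k) = 0)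
    {σ τ : List ℤ} (hσ : σ.sum = s) (hσ0 : wt b ψ σ ≠ 0) (hτ : τ.sum = -s) (hτ0 : wt b ψ τ ≠ 0) :
    HasStep b ψ s := by
  have h1 : (T (s : ℤ) : ℂ[T;T⁻¹]) ∈ Algebra.adjoin ℂ {T (s : ℤ), T (-(s : ℤ))} :=
    Algebra.subset_adjoin (Set.mem_insert _ _)
  have h2 : (T (-(s : ℤ)) : ℂ[T;T⁻¹]) ∈ Algebra.adjoin ℂ {T (s : ℤ), T (-(s : ℤ))} :=
    Algebra.subset_adjoin (Set.mem_insert_of_mem _ rfl)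
  refine ⟨Nat.pos_of_ne_zero hs, le_antisymm (Algebra.adjoin_le ?_) (Algebra.adjoin_le ?_)⟩
  · rintro _ ⟨k, -, rfl⟩
    by_cases hk : (s : ℤ) ∣ k
    · obtain ⟨m, rfl⟩ := hk
      refine Subalgebra.smul_mem _ ?_ _
      obtain ⟨n, rfl | rfl⟩ := Int.eq_nat_or_neg m
      · have e : (T ((s : ℤ) * n) : ℂ[T;T⁻¹]) = T (s : ℤ) ^ n := by rw [T_pow, mul_comm]
        rw [e]
        exact Subalgebra.pow_mem _ h1 n
      · have e : (T ((s : ℤ) * -n) : ℂ[T;T⁻¹]) = T (-(s : ℤ)) ^ n := by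
          rw [T_pow]
          congr 1
          ring
        rw [e]
        exact Subalgebra.pow_mem _ h2 n
    · change ψ (L0.D b k) • _ ∈ Algebra.adjoin ℂ _
      rw [hψ k hk, zero_smul]
      exact zero_mem _
  · have key : ∀ (σ : List ℤ), wt b ψ σ ≠ 0 → (T σ.sum : ℂ[T;T⁻¹]) ∈ aPsi b ψ := by
      intro σ hσ
      have := (aPsi b ψ).smul_mem (wt_smul_T_mem b ψ σ) (wt b ψ σ)⁻¹
      rwa [smul_smul, inv_mul_cancel₀ hσ, one_smul] at this
    rintro _ (rfl | rfl)
    · exact hσ ▸ key σ hσ0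
    · exact hτ ▸ key τ hτ0

end Step

/-! ### The highest weight vector in the twisted module, and the comparison isomorphism -/

section Module

variable {V : Type*} [AddCommGroup V] [Module ℂ V] [LieRingModule L V] [LieModule ℂ L V]

theorem lie_Lgr_eq_zero {x : V} (hx : x ∈ highest b V) (j : ℤ) (hj : 0 < j) (y : L)
    (hy : y ∈ Lgr b j) : ⁅y, x⁆ = 0 := by
  have : Lgr b j ≤ LinearMap.ker (lieAt x) := by
    rw [Lgr, if_neg hj.ne', sup_bot_eq, Submodule.span_le]
    rintro _ ⟨m, rfl⟩
    exact hx _ (by rwa [repr_comb_zero])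
  exact this hy

/-- A function, as an element of the twisted module. -/
def toTwist {A : Type*} [AddCommGroup A] (φ : Gam →+ A) (f : A → V) : Twist φ V := f

theorem act_twist {A : Type*} [AddCommGroup A] (φ : Gam →+ A) (l : List Gam) (f : Twist φ V)
    (a : A) : act (Twist φ V) l f a = act V l (f (a - φ l.sum)) := by
  induction l generalizing a with
  | nil => simp
  | cons r l ih => rw [act_cons, twist_D_apply, ih, act_cons, List.sum_cons, map_add, sub_sub]

/-- The second coordinate with respect to the basis `b`. -/
def height : Gam →+ ℤ where
  toFun r := b.repr r 1
  map_zero' := by simp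
  map_add' := by simp

variable {b} {η : Gam →+ ℂ} (hη : ∀ m, ∀ v : V, ⁅h m, v⁆ = η m • v) {u : ℤ → V} {ψ : ℤ → ℂ}
  (hψ : ∀ j k, ⁅D (j • b 1), u k⁆ = ψ j • u (k + j))
include hψ

theorem hact_top_sequence (hψ0 : ψ 0 = 0) (σ : List ℤ) (k : ℤ) :
    hact V b σ (u k) = wt b (topFun b η ψ) σ • u (k + σ.sum) := by
  induction σ with
  | nil => simp [wt]
  | cons j σ ih =>
    have e : wt b (topFun b η ψ) (j :: σ) = ψ j * wt b (topFun b η ψ) σ := by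
      simp [wt, topFun_D b η ψ hψ0]
    rw [hact_cons, ih, lie_smul, hψ, e, smul_smul, List.sum_cons, mul_comm]
    congr 2
    ring

variable (hu : ∀ k, u k ∈ highest b V)

include hu in
omit hψ in
theorem twist_mem_highest : toTwist (height b) u ∈ highest b (Twist (height b) V) := by
  intro r hr
  funext a
  rw [twist_D_apply]
  exact hu _ r hr

-- The D(j b₂) translate the sequence u in V. On functions ℤ → V with the argument shifted by the
-- height, the sequence itself becomes an eigenvector of L₀ of weight ψ. This highest weight vector
-- shows that V̂⁺(ψ) is nonzero.
include hη in
theorem twist_lie_L0 (hψ0 : ψ 0 = 0) (y : L0 b) :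
    ⁅(y : L), toTwist (height b) u⁆ = topFun b η ψ y • toTwist (height b) u := by
  let x := toTwist (height b) u
  let P : Submodule ℂ L :=
    LinearMap.ker (lieAt x - (LinearMap.toSpanSingleton ℂ _ x).comp (levelFun b η ψ))
  have hP : ∀ y, y ∈ P ↔ ⁅y, x⁆ = levelFun b η ψ y • x := fun y => by
    rw [LinearMap.mem_ker, LinearMap.sub_apply, sub_eq_zero]
    rfl
  have h1 : levelFun b η ψ c₁ = η (1, 0) := by rw [← h_one_zero, levelFun_h]
  have h2 : levelFun b η ψ c₂ = η (0, 1) := by rw [← h_zero_one, levelFun_h]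
  refine (hP y).1 (L0_induction b (P := P) (fun k => (hP _).2 ?_) ((hP _).2 ?_) ((hP _).2 ?_) y.2)
  · funext a
    rw [twist_D_apply, levelFun_D b η ψ hψ0]
    have e : height b (k • b 1) = k := repr_smul_one b k
    rw [e]
    change ⁅_, u (a - k)⁆ = ψ k • u a
    rw [hψ, sub_add_cancel]
  · funext a
    rw [twist_c₁_apply, h1, ← h_one_zero, hη]
    rfl
  · funext a
    rw [twist_c₂_apply, h2, ← h_zero_one, hη]
    rfl

variable {𝒱 : Gam → Submodule ℂ V}

include hη hu in
/-- An irreducible module with a sequence of highest weight vectors on which `L₀` acts through `ψ`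
is isomorphic to `V̄(ψ, 0, s)`. -/
theorem exists_equiv_vBar (h𝒱 : IsGradedModule 𝒱) (hO : InO 𝒱) (hψ0 : ψ 0 = 0) {s : ℕ}
    (hs : HasStep b (topFun b η ψ) s) {n : Gam} (hn : u 0 ∈ 𝒱 n) (hu0 : u 0 ≠ 0) :
    ∃ (e : V ≃ₗ⁅ℂ,L⁆ VBar b (topFun b η ψ) 0) (d : Gam),
      ∀ γ, (𝒱 γ).map e.toLinearEquiv.toLinearMap = vBarDeg b (topFun b η ψ) 0 (γ + d) := by
  set Ψ := topFun b η ψ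
  obtain ⟨π, hπ⟩ := exists_gradProj h𝒱.isInternal
  obtain ⟨ρ, hρ⟩ := vBarDeg_gradProj b Ψ 0
  have hpos := lie_Lgr_eq_zero b (twist_mem_highest hu)
  have hzero := twist_lie_L0 hη hψ hψ0
  have hv : vac b Ψ ≠ 0 := vac_ne_zero b Ψ
    (vermaVac_ne_zero b Ψ (x := toTwist (height b) u) (fun H => hu0 (congrFun H 0)) hpos hzero)
  obtain ⟨e, he⟩ := exists_graded_equiv hπ h𝒱.lie_mem hO.irreducible hρ (vBar_lie_mem b Ψ 0)
    (vBar_irreducible b Ψ hs.steps 0) hn (vBark_mem b Ψ 0 0) hu0 (vBark_ne_zero b Ψ hv 0) (by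
      -- The scalar of a word of degree zero is read off in the induced module. It passes to `u 0`
      -- by evaluating the twisted module at 0, and to v₀ ⊗ t^0 through V̂⁺(ψ).
      intro l hl
      obtain ⟨c, hc⟩ := (act_highest b (fun r hr => verma_lie_pos b Ψ hr)
        (fun r hr => ⟨Ψ (L0.D b (b.repr r 1)), by
          rw [← verma_lie_L0]
          change _ = ⁅D (b.repr r 1 • b 1), vermaVac b Ψ⁆
          rw [← eq_smul_of_lvl_zero b hr]⟩)
        (fun m => ⟨_, verma_lie_L0 b Ψ (L0.h b m)⟩) l).2 (by
          rw [hl, LinearEquiv.map_zero, Finsupp.zero_apply])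
      refine ⟨c, ?_, ?_⟩
      · have h1 := congrFun (act_eq_smul_of_verma b Ψ hpos hzero hc) 0
        rw [act_twist, hl, map_zero, sub_zero] at h1
        exact h1
      · have h1 := act_eq_smul_of_verma b Ψ
          (lie_Lgr_eq_zero b fun r hr => vac_lie_pos b Ψ hr) (vac_lie_L0 b Ψ) hc
        rw [vBark, ← map_act (toVBar b Ψ 0) (fun r v => toVBar_lie b Ψ 0 (D r) v), vk, act_tmulT,
          h1, hl, LinearEquiv.map_zero, Finsupp.zero_apply, add_zero, map_smul, map_smul])
  exact ⟨e, _, he⟩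

end Module

/-- An irreducible quasi-finite module on which the center acts nontrivially is isomorphic, as a
graded module up to a shift, to some `V̄(ψ, i, s)`. -/
theorem exists_equiv_vBar_of_inO {V : Type*} [AddCommGroup V] [Module ℂ V] [LieRingModule L V]
    [LieModule ℂ L V] {𝒱 : Gam → Submodule ℂ V} (h𝒱 : IsGradedModule 𝒱)
    (hc : (∃ v : V, ⁅c₁, v⁆ ≠ 0) ∨ (∃ v : V, ⁅c₂, v⁆ ≠ 0)) (hO : InO 𝒱) :
    ∃ (b : Module.Basis (Fin 2) ℤ Gam) (ψ : L0 b →ₗ[ℂ] ℂ) (i : ℤ) (s : ℕ),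
      IsExpPolynomial b ψ ∧ HasStep b ψ s ∧
        ∃ (e : V ≃ₗ⁅ℂ,L⁆ VBar b ψ i) (d : Gam),
          ∀ γ, (𝒱 γ).map e.toLinearEquiv.toLinearMap = vBarDeg b ψ i (γ + d) := by
  obtain ⟨η, hη, hη0⟩ := exists_central_character h𝒱 hO hc
  obtain ⟨b, hb, hpos⟩ := exists_halfplane_basis h𝒱 hO hη hη0
  obtain ⟨n, hn, htop⟩ := exists_top_level h𝒱 hO hη hη0 hb hpos
  have hb0 : η (b 0) ≠ 0 := det_ne_zero_of_eq_zero hη0 hb (fun H => det_basis_ne_zero b (by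
    rw [det] at H ⊢
    linear_combination -H))
  obtain ⟨s, u, ψ, hu, hu0, -, hψs, hψ, σ, hσ, hσ0, τ, hτ, hτ0⟩ :=
    exists_top_sequence b hη hb h𝒱 hO htop hn
  have huh : ∀ k, u k ∈ highest b V := fun k => mem_highest_of_level b h𝒱 htop (by
    rw [map_add, Finsupp.add_apply, repr_smul_zero, add_zero]) (hu k)
  have hun : u 0 ∈ 𝒱 n := by
    have := hu 0
    rwa [zero_smul, add_zero] at this
  have hu00 : u 0 ≠ 0 := hu0 0 (dvd_zero _)
  have hψ0 : ψ 0 = 0 := by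
    have := hψ 0 0
    rw [zero_smul, D_zero, zero_lie, add_zero] at this
    exact (smul_eq_zero.1 this.symm).resolve_right hu00
  -- For s = 0 all ψ_j would vanish, so every D(j b₂) would kill the nonzero highest weight vector
  -- `u 0`.
  have hs : s ≠ 0 := by
    rintro rfl
    obtain ⟨j, hj⟩ := exists_lie_ne_zero b hη hb h𝒱 hb0 hO.quasiFinite hun hu00 (huh 0)
    refine hj ?_
    rw [hψ]
    by_cases hj0 : j = 0
    · rw [hj0, hψ0, zero_smul]
    · rw [hψs j (by simpa using hj0), zero_smul]
  have hg := mem_expPoly_of_top_sequence b hη hb h𝒱 hO.quasiFinite hs hu hu0 huh hψs hψ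
  have hwt : ∀ σ : List ℤ, hact V b σ (u 0) ≠ 0 → wt b (topFun b η ψ) σ ≠ 0 := by
    intro σ hσ H
    rw [hact_top_sequence (η := η) hψ hψ0, H, zero_smul] at hσ
    exact hσ rfl
  have hstep : HasStep b (topFun b η ψ) s := hasStep_of_wt b _ hs
    (fun k hk => by rw [topFun_D b η ψ hψ0, hψs k hk]) hσ (hwt σ hσ0) hτ (hwt τ hτ0)
  exact ⟨b, topFun b η ψ, 0, s, topFun_isExpPolynomial b η ψ hb hb0 hψ0 hg, hstep,
    exists_equiv_vBar hη hψ huh h𝒱 hO hψ0 hstep hun hu00⟩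

end Classification

end VirasoroLike

end

open VirasoroLike in
theorem corollary4p8 {V : Type*} [AddCommGroup V] [Module ℂ V] [LieRingModule L V]
    [LieModule ℂ L V] (𝒱 : Gam → Submodule ℂ V) (h𝒱 : IsGradedModule 𝒱)
    (hc : (∃ v : V, ⁅c₁, v⁆ ≠ 0) ∨ (∃ v : V, ⁅c₂, v⁆ ≠ 0)) :
    (InO 𝒱 ↔
      ∃ (b : Module.Basis (Fin 2) ℤ Gam) (ψ : L0 b →ₗ[ℂ] ℂ) (i : ℤ) (s : ℕ),
        IsExpPolynomial b ψ ∧ HasStep b ψ s ∧ Nonempty (V ≃ₗ⁅ℂ,L⁆ VBar b ψ i)) ∧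
    (InO 𝒱 ↔
      ∃ (b : Module.Basis (Fin 2) ℤ Gam) (ψ : L0 b →ₗ[ℂ] ℂ) (i : ℤ) (s : ℕ),
        IsExpPolynomial b ψ ∧ HasStep b ψ s ∧
          ∃ (e : V ≃ₗ⁅ℂ,L⁆ VBar b ψ i) (d : Gam),
            ∀ γ, (𝒱 γ).map e.toLinearEquiv.toLinearMap = vBarDeg b ψ i (γ + d)) := by
  have hV : Nontrivial V := by
    obtain ⟨v, hv⟩ | ⟨v, hv⟩ := hc
    · exact ⟨⟨_, 0, hv⟩⟩
    · exact ⟨⟨_, 0, hv⟩⟩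
  refine ⟨⟨fun hO => ?_, ?_⟩, ⟨fun hO => exists_equiv_vBar_of_inO h𝒱 hc hO, ?_⟩⟩
  · obtain ⟨b, ψ, i, s, hψ, hs, e, -⟩ := exists_equiv_vBar_of_inO h𝒱 hc hO
    exact ⟨b, ψ, i, s, hψ, hs, ⟨e⟩⟩
  · rintro ⟨b, ψ, i, s, hψ, hs, ⟨e⟩⟩
    exact inO_of_equiv h𝒱 hψ hs e
  · rintro ⟨b, ψ, i, s, hψ, hs, e, -⟩
    exact inO_of_equiv h𝒱 hψ hs e
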